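/- Let $\mathfrak g$ be the simple complex Lie algebra of type $G_2$, with simple roots $\alpha_1,\alpha_2$ normalised by $(\alpha_1,\alpha_1)=2$, $(\alpha_1,\alpha_2)=-3$, $(\alpha_2,\alpha_2)=6$. Let $U_q(\mathfrak n)$ be the $\mathbb Q(q)$-algebra generated by $e_1,e_2$ subject to the quantum Serre relations (the positive part of $U_q(\mathfrak g)$). Let $(\cdot,\cdot)$ be its natural scalar product, i.e. the bilinear form with $(1,1)=1$ and $(e_ix,y)=(x,e_i'(y))$, where $e_i'$ is the linear map with $e_i'(1)=0$, $e'_i(e_jx)=\delta_{ij}x+q^{-(\alpha_i,\alpha_j)}e_je_i'(x)$. For the reduced word $w_0=s_{i_1}\cdots s_{i_6}=s_1s_2s_1s_2s_1s_2$ let $E(\beta_k)=T_{i_1}\cdots T_{i_{k-1}}(e_{i_k})$ be the root vectors given by Lusztig's braid group action ($T_i=T'_{i,1}$), where $\beta_1,\dots,\beta_6$ are \[\alpha_1<3\alpha_1+\alpha_2<2\alpha_1+\alpha_2<3\alpha_1+2\alpha_2<\alpha_1+\alpha_2<\alpha_2,\] and let $E(\mathbf m)=E(\beta_1)^{(m_1)}\cdots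 E(\beta_6)^{(m_6)}$, $\mathbf m\in\mathbb N^6$, be the PBW basis (divided powers). Let $\mathbf B$ be the canonical basis (the vectors that are fixed by the bar involution $q\mapsto q^{-1}$, $e_i\mapsto e_i$, and congruent to some $E(\mathbf m)$ modulo $q\bigoplus_{\mathbf p}\mathbb Z[q]E(\mathbf p)$), and let $\mathbf B^*$ and $\{E^*(\mathbf m)\}$ be the bases dual to $\mathbf B$ and $\{E(\mathbf m)\}$ for $(\cdot,\cdot)$. Let $L^*$ be the $\mathbb Z[q]$-lattice spanned by $\mathbf B^*$, and let $\mathbf b(\mathbf m)$ be the unique element of $\mathbf B^*$ with $\mathbf b(\mathbf m)-E^*(\mathbf m)\in qL^*$. An element $b\in\mathbf B^*$ is called imaginary if $b^2\notin q^{\mathbb Z}\mathbf B^*=\{q^mc: m\in\mathbb Z,\ c\in\mathbf B^*\}$. Let $\Phi$ be the quantum shuffle realization of $U_q(\mathfrak n)$: the algebra homomorphism, from $U_q(\mathfrak n)$ to the space of $\mathbb Q(q)$-linear combinations of words $w[i_1,\dots,i_k]$ in the letters $w_1,w_2$, which sends $e_i$ to $w[i]$; here the product of two words $u*v$ is the sum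 of all shuffles of $u$ and $v$, each multiplied by $q^{-e}$ where $e$ is the sum of $(\alpha_i,\alpha_j)$ over all pairs of a letter $w_i$ of $u$ and a letter $w_j$ of $v$ such that $w_i$ stands to the left of $w_j$ in the shuffle. Put $b=\mathbf b(1,0,0,0,1,0)$, $b^{[2]}=\mathbf b(2,0,0,0,2,0)$ and $z=\mathbf b(1,0,1,0,1,0)$. These (uniquely determined) vectors satisfy $\Phi(b)=w[1,2,1]$, $\Phi(z)=(q+q^{-1})\,w[1,2,1,1,2,1]$, \[\Phi(b^{[2]})=(q+q^{-1})w[1,2,1,1,2,1]+(q^5+2q^3+q+q^{-1}+2q^{-3}+q^{-5})w[1,1,2,2,1,1]+(q^2+2+q^{-2})\bigl(w[1,2,1,2,1,1]+w[1,1,2,1,2,1]\bigr),\] and \[ b^2=q^{-1}\bigl(b^{[2]}+z\bigr). \] Moreover $b^2\notin q^{\mathbb Z}\mathbf B^*$, i.e. $b$ is imaginary. Consequently the conjecture of Berenstein and Zelevinsky, that for $b_1,b_2\in\mathbf B^*$ one has $b_1b_2\in q^{\mathbb Z}\mathbf B^*$ if and only if $b_2b_1\in q^{\mathbb Z}b_1b_2$,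 fails for $b_1=b_2=b$. -/

import Mathlib

noncomputable section

namespace QGroupG2

/-! ## Scalars and the Cartan datum of type `G₂` -/

/-- The ground field `ℚ(q)`. -/
abbrev K : Type := RatFunc ℚ

/-- Technical: makes the canonical `ℕ`-algebra structure of `ℚ(q)` the preferred instance. -/
instance : Algebra ℕ K := Semiring.toNatAlgebra

/-- Technical: makes the canonical `ℤ`-algebra structure of `ℚ(q)` the preferred instance. -/
instance : Algebra ℤ K := Ring.toIntAlgebra K

/-- The indeterminate `q`. -/
def q : K := RatFunc.X

/-- `(αᵢ, αⱼ)`. The simple roots `α₁, α₂` are indexed by `0, 1 : Fin 2`; `α₁` is the short one. -/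
def ip (i j : Fin 2) : ℤ := (!![2, -3; -3, 6] : Matrix (Fin 2) (Fin 2) ℤ) i j

/-- `dᵢ = (αᵢ, αᵢ) / 2`. -/
def dd (i : Fin 2) : ℕ := ![1, 3] i

/-- The Cartan integers `aᵢⱼ = (αᵢ, αⱼ) / dᵢ`. -/
def cartan (i j : Fin 2) : ℤ := (!![2, -3; -1, 2] : Matrix (Fin 2) (Fin 2) ℤ) i j

/-- `qᵢ = q ^ dᵢ`. -/
def qi (i : Fin 2) : K := q ^ dd i

/-- The symmetric `q`-integer `[n]ᵢ = (qᵢⁿ - qᵢ⁻ⁿ) / (qᵢ - qᵢ⁻¹)`. -/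
def qInt (i : Fin 2) (n : ℕ) : K := (qi i ^ n - (qi i)⁻¹ ^ n) / (qi i - (qi i)⁻¹)

/-- `[n]ᵢ!`. -/
def qFact (i : Fin 2) (n : ℕ) : K := ∏ k ∈ Finset.range n, qInt i (k + 1)

/-- The divided power `x⁽ⁿ⁾ = xⁿ / [n]ᵢ!`. -/
def divPow {A : Type*} [Ring A] [Algebra K A] (i : Fin 2) (x : A) (n : ℕ) : A :=
  (qFact i n)⁻¹ • x ^ n

/-- The quantum Serre expression
`∑_{r+s = 1-aᵢⱼ} (-1)ʳ x⁽ʳ⁾ y x⁽ˢ⁾`. -/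
def serre {A : Type*} [Ring A] [Algebra K A] (i j : Fin 2) (x y : A) : A :=
  ∑ r ∈ Finset.range ((1 - cartan i j).toNat + 1),
    (-1 : K) ^ r • (divPow i x r * y * divPow i x ((1 - cartan i j).toNat - r))

/-! ## The algebra `U_q(𝔫)` -/

/-- The quantum Serre relations on free generators `e₁, e₂`. -/
inductive SerreRel : FreeAlgebra K (Fin 2) → FreeAlgebra K (Fin 2) → Prop
  | mk (i j : Fin 2) (h : i ≠ j) :
      SerreRel (serre i j (FreeAlgebra.ι K i) (FreeAlgebra.ι K j)) 0

/-- `U_q(𝔫)`. -/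
abbrev Un : Type := RingQuot SerreRel

/-- The Chevalley generators `eᵢ` of `U_q(𝔫)`. -/
def e (i : Fin 2) : Un := RingQuot.mkAlgHom K SerreRel (FreeAlgebra.ι K i)

lemma q_ne_zero : q ≠ 0 := RatFunc.X_ne_zero

lemma q_pow_ne_one {n : ℕ} (hn : n ≠ 0) : q ^ n ≠ 1 := by
  intro h
  have h1 : algebraMap (Polynomial ℚ) K (Polynomial.X ^ n) = algebraMap (Polynomial ℚ) K 1 := by
    rw [map_pow, RatFunc.algebraMap_X, map_one]; exact h
  have h2 := RatFunc.algebraMap_injective ℚ h1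
  have h3 := congrArg Polynomial.natDegree h2
  rw [Polynomial.natDegree_X_pow, Polynomial.natDegree_one] at h3
  exact hn h3

lemma q_pow_sub_one_ne_zero {n : ℕ} (hn : n ≠ 0) : q ^ n - 1 ≠ 0 :=
  sub_ne_zero.mpr (q_pow_ne_one hn)

lemma map_divPow {A B : Type*} [Ring A] [Algebra K A] [Ring B] [Algebra K B]
    (f : A →ₐ[K] B) (i : Fin 2) (x : A) (n : ℕ) : f (divPow i x n) = divPow i (f x) n := by
  simp [divPow]

lemma map_serre {A B : Type*} [Ring A] [Algebra K A] [Ring B] [Algebra K B]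
    (f : A →ₐ[K] B) (i j : Fin 2) (x y : A) : f (serre i j x y) = serre i j (f x) (f y) := by
  simp [serre, map_divPow]

lemma serre_e (i j : Fin 2) (h : i ≠ j) : serre i j (e i) (e j) = 0 := by
  have := RingQuot.mkAlgHom_rel K (SerreRel.mk i j h)
  rwa [map_serre, map_zero] at this

/-- The universal property of `U_q(𝔫)`. -/
def Un.lift {A : Type*} [Ring A] [Algebra K A] (f : Fin 2 → A)
    (hf : ∀ i j, i ≠ j → serre i j (f i) (f j) = 0) : Un →ₐ[K] A :=
  RingQuot.liftAlgHom K ⟨FreeAlgebra.lift K f, by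
    rintro _ _ ⟨i, j, h⟩
    rw [map_serre, map_zero, FreeAlgebra.lift_ι_apply, FreeAlgebra.lift_ι_apply, hf i j h]⟩

lemma Un.lift_e {A : Type*} [Ring A] [Algebra K A] (f : Fin 2 → A)
    (hf : ∀ i j, i ≠ j → serre i j (f i) (f j) = 0) (i : Fin 2) : Un.lift f hf (e i) = f i := by
  simp [Un.lift, e]

lemma Un.induction {C : Un → Prop} (h0 : ∀ c : K, C (algebraMap K Un c)) (h1 : ∀ i, C (e i))
    (hm : ∀ x y, C x → C y → C (x * y)) (ha : ∀ x y, C x → C y → C (x + y)) (x : Un) : C x := by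
  obtain ⟨p, rfl⟩ := RingQuot.mkAlgHom_surjective K SerreRel x
  induction p using FreeAlgebra.induction with
  | grade0 r => simpa using h0 r
  | grade1 i => exact h1 i
  | mul a b ha' hb' => simpa using hm _ _ ha' hb'
  | add a b ha' hb' => simpa using ha _ _ ha' hb'

lemma qPoly_ne_zero : q ^ 2 - 1 ≠ 0 ∧ q ^ 2 + 1 ≠ 0 ∧ q ^ 4 + q ^ 2 + 1 ≠ 0 ∧ q ^ 4 + 1 ≠ 0 ∧
    q ^ 6 - 1 ≠ 0 ∧ q ^ 6 + 1 ≠ 0 := by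
  have h2 := q_pow_sub_one_ne_zero (n := 2) (by norm_num)
  have h4 := q_pow_sub_one_ne_zero (n := 4) (by norm_num)
  have h6 := q_pow_sub_one_ne_zero (n := 6) (by norm_num)
  have h8 := q_pow_sub_one_ne_zero (n := 8) (by norm_num)
  have h12 := q_pow_sub_one_ne_zero (n := 12) (by norm_num)
  refine ⟨h2, fun h => h4 ?_, fun h => h6 ?_, fun h => h8 ?_, h6, fun h => h12 ?_⟩
  · linear_combination (q ^ 2 - 1) * h
  · linear_combination (q ^ 2 - 1) * h
  · linear_combination (q ^ 4 - 1) * h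
  · linear_combination (q ^ 6 - 1) * h

lemma qInt_vals : qInt 0 1 = 1 ∧ qInt 0 2 = (q ^ 2 + 1) / q ∧ qInt 0 3 = (q ^ 4 + q ^ 2 + 1) / q ^ 2 ∧
    qInt 0 4 = (q ^ 2 + 1) * (q ^ 4 + 1) / q ^ 3 ∧ qInt 1 1 = 1 ∧ qInt 1 2 = (q ^ 6 + 1) / q ^ 3 := by
  obtain ⟨h2, h2', h3, h4, h6, h6'⟩ := qPoly_ne_zero
  have hq := q_ne_zero
  have d0 : q - q⁻¹ ≠ 0 := by
    intro h; apply h2; field_simp at h; linear_combination h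
  have d1 : q ^ 3 - (q ^ 3)⁻¹ ≠ 0 := by
    intro h; apply h6; field_simp at h; linear_combination h
  have e0 : qi 0 = q := by simp [qi, dd]
  have e1 : qi 1 = q ^ 3 := by simp [qi, dd]
  refine ⟨?_, ?_, ?_, ?_, ?_, ?_⟩ <;> simp only [qInt, e0, e1] <;>
    first | rw [div_eq_iff d0] | rw [div_eq_iff d1]
  all_goals field_simp
  all_goals ring

lemma serre_zero_one {A : Type*} [Ring A] [Algebra K A] (x y : A) :
    serre 0 1 x y = (q ^ 4 * qFact 0 4)⁻¹ •
      (q ^ 4 • (x * x * x * x * y) - (q * (q ^ 6 + q ^ 4 + q ^ 2 + 1)) • (x * x * x * y * x)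
        + ((q ^ 4 + 1) * (q ^ 4 + q ^ 2 + 1)) • (x * x * y * x * x)
        - (q * (q ^ 6 + q ^ 4 + q ^ 2 + 1)) • (x * y * x * x * x)
        + q ^ 4 • (y * x * x * x * x)) := by
  obtain ⟨h2, h2', h3, h4, h6, h6'⟩ := qPoly_ne_zero
  obtain ⟨v1, v2, v3, v4, -, -⟩ := qInt_vals
  have hq := q_ne_zero
  have hn : (1 - cartan 0 1).toNat = 4 := by simp [cartan]
  have h3' : q ^ 2 * (q ^ 2 + 1) + 1 ≠ 0 := fun h => h3 (by linear_combination h)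
  simp only [serre, hn, Finset.sum_range_succ, Finset.sum_range_zero, divPow, qFact,
    Finset.prod_range_succ, Finset.prod_range_zero, v1, v2, v3, v4, zero_add, one_mul, Nat.reduceAdd,
    Nat.reduceSub, pow_succ, pow_zero, smul_mul_assoc, mul_smul_comm, mul_one, ← mul_assoc]
  match_scalars <;> field_simp <;> ring

lemma serre_one_zero {A : Type*} [Ring A] [Algebra K A] (x y : A) :
    serre 1 0 x y = (q ^ 3 * qFact 1 2)⁻¹ •
      (q ^ 3 • (x * x * y) - (q ^ 6 + 1) • (x * y * x) + q ^ 3 • (y * x * x)) := by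
  obtain ⟨h2, h2', h3, h4, h6, h6'⟩ := qPoly_ne_zero
  obtain ⟨-, -, -, -, v1, v2⟩ := qInt_vals
  have hq := q_ne_zero
  have hn : (1 - cartan 1 0).toNat = 2 := by simp [cartan]
  simp only [serre, hn, Finset.sum_range_succ, Finset.sum_range_zero, divPow, qFact,
    Finset.prod_range_succ, Finset.prod_range_zero, v1, v2, zero_add, one_mul, Nat.reduceAdd,
    Nat.reduceSub, pow_succ, pow_zero, smul_mul_assoc, mul_smul_comm, mul_one, ← mul_assoc]
  match_scalars <;> field_simp

lemma qFact_ne_zero : q ^ 4 * qFact 0 4 ≠ 0 ∧ q ^ 3 * qFact 1 2 ≠ 0 := by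
  obtain ⟨h2, h2', h3, h4, h6, h6'⟩ := qPoly_ne_zero
  obtain ⟨v1, v2, v3, v4, w1, w2⟩ := qInt_vals
  have hq := q_ne_zero
  constructor <;>
    simp only [qFact, Finset.prod_range_succ, Finset.prod_range_zero, v1, v2, v3, v4, w1, w2, zero_add,
      one_mul, Nat.reduceAdd] <;> positivity

/-- Coefficient in the cleared quantum Serre relation. -/
def s3 : K := q * (q ^ 6 + q ^ 4 + q ^ 2 + 1)

/-- Coefficient in the cleared quantum Serre relation. -/
def s2 : K := (q ^ 4 + 1) * (q ^ 4 + q ^ 2 + 1)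

/-- Coefficient in the cleared quantum Serre relation. -/
def s1 : K := q ^ 6 + 1

/-- The quantum Serre relations with denominators cleared. -/
lemma serre_iff {A : Type*} [Ring A] [Algebra K A] (f : Fin 2 → A) :
    (∀ i j, i ≠ j → serre i j (f i) (f j) = 0) ↔
      (q ^ 4 • (f 0 * f 0 * f 0 * f 0 * f 1)
        - s3 • (f 0 * f 0 * f 0 * f 1 * f 0)
        + s2 • (f 0 * f 0 * f 1 * f 0 * f 0)
        - s3 • (f 0 * f 1 * f 0 * f 0 * f 0)
        + q ^ 4 • (f 1 * f 0 * f 0 * f 0 * f 0) = 0) ∧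
      (q ^ 3 • (f 1 * f 1 * f 0) - s1 • (f 1 * f 0 * f 1) + q ^ 3 • (f 0 * f 1 * f 1) = 0) := by
  have h : (∀ i j, i ≠ j → serre i j (f i) (f j) = 0) ↔
      serre 0 1 (f 0) (f 1) = 0 ∧ serre 1 0 (f 1) (f 0) = 0 := by
    constructor
    · exact fun h => ⟨h 0 1 (by decide), h 1 0 (by decide)⟩
    · rintro ⟨h, h'⟩ i j hij
      fin_cases i <;> fin_cases j <;> first | exact absurd rfl hij | assumption
  rw [s3, s2, s1, h, serre_zero_one, serre_one_zero, smul_eq_zero_iff_right (inv_ne_zero qFact_ne_zero.1),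
    smul_eq_zero_iff_right (inv_ne_zero qFact_ne_zero.2)]


/-! ## The bar involution -/

lemma transcendental_X_inv (F : Type*) [Field F] : Transcendental F (RatFunc.X⁻¹ : RatFunc F) :=
  fun h => (RatFunc.transcendental_X (K := F)) (by simpa using h.inv)

lemma eval_X_inv_injective (F : Type*) [Field F] :
    Function.Injective (Polynomial.eval₂RingHom (RatFunc.C : F →+* RatFunc F) RatFunc.X⁻¹) :=
  transcendental_iff_injective.mp (transcendental_X_inv F)

/-- The field automorphism `q ↦ q⁻¹` of `ℚ(q)`. -/
def barK : K →+* K :=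
  RatFunc.liftRingHom (Polynomial.eval₂RingHom (RatFunc.C : ℚ →+* K) q⁻¹)
    (nonZeroDivisors_le_comap_nonZeroDivisors_of_injective _ (eval_X_inv_injective ℚ))

lemma barK_q : barK q = q⁻¹ := by
  have h : barK (algebraMap (Polynomial ℚ) K Polynomial.X) = q⁻¹ := by
    rw [barK, RatFunc.liftRingHom_algebraMap]
    simp
  rwa [RatFunc.algebraMap_X] at h

/-- `U_q(𝔫)` with scalars acting through `q ↦ q⁻¹`. -/
def UnTw : Type := Un

instance : Ring UnTw := inferInstanceAs (Ring Un)

instance : Algebra K UnTw :=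
  RingHom.toAlgebra' (R := K) (S := UnTw) ((algebraMap K Un).comp barK : K →+* Un)
    fun c x => Algebra.commutes (A := Un) (barK c) x

lemma UnTw.tw_smul (c : K) (x : Un) :
    (HSMul.hSMul (α := K) (β := UnTw) (γ := UnTw) c x : UnTw) = (barK c • x : Un) := by
  have h := Algebra.smul_def (A := Un) (barK c) x
  exact h.symm

lemma barAux : ∀ i j, i ≠ j → serre (A := UnTw) i j (e i) (e j) = 0 := by
  obtain ⟨h1, h2⟩ := (serre_iff e).mp serre_e
  have hq := q_ne_zero
  have b4 : barK (q ^ 4) = q⁻¹ ^ 8 * q ^ 4 := by rw [map_pow, barK_q]; field_simp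
  have b3 : barK (q ^ 3) = q⁻¹ ^ 6 * q ^ 3 := by rw [map_pow, barK_q]; field_simp
  have c3 : barK s3 = q⁻¹ ^ 8 * s3 := by simp [s3, barK_q]; field_simp; ring
  have c2 : barK s2 = q⁻¹ ^ 8 * s2 := by simp [s2, barK_q]; field_simp; ring
  have c1 : barK s1 = q⁻¹ ^ 6 * s1 := by simp [s1, barK_q]; field_simp; ring
  refine (serre_iff (A := UnTw) e).mpr ⟨?_, ?_⟩
  · refine Eq.trans ?_ ((congrArg (fun x : Un => (q⁻¹ ^ 8) • x) h1).trans (smul_zero _))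
    simp only [smul_add, smul_sub, smul_smul, ← b4, ← c3, ← c2]
    rfl
  · refine Eq.trans ?_ ((congrArg (fun x : Un => (q⁻¹ ^ 6) • x) h2).trans (smul_zero _))
    simp only [smul_add, smul_sub, smul_smul, ← b3, ← c1]
    rfl

/-- The bar involution of `U_q(𝔫)`: the ring endomorphism with `q ↦ q⁻¹` and `eᵢ ↦ eᵢ`. -/
def bar : Un →+* Un := ((Un.lift (A := UnTw) e barAux : Un →ₐ[K] UnTw) : Un →+* UnTw)

lemma bar_e (i : Fin 2) : bar (e i) = e i := Un.lift_e (A := UnTw) e barAux i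

lemma bar_smul (c : K) (x : Un) : bar (c • x) = barK c • bar x :=
  (map_smul (Un.lift (A := UnTw) e barAux) c x).trans (UnTw.tw_smul c _)

/-! ## Kashiwara's derivations and the scalar product -/

/-- The operator `(x, y) ↦ (eⱼ x, δₖⱼ x + q^{-(αₖ, αⱼ)} eⱼ y)` on pairs. -/
def derOp (k j : Fin 2) : Module.End K (Un × Un) :=
  LinearMap.prod (LinearMap.mulLeft K (e j) ∘ₗ LinearMap.fst K Un Un)
    ((if k = j then (1 : K) else 0) • LinearMap.fst K Un Un +
      q ^ (-ip k j) • (LinearMap.mulLeft K (e j) ∘ₗ LinearMap.snd K Un Un))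

lemma derOp_apply (k j : Fin 2) (x y : Un) : derOp k j (x, y) =
    (e j * x, (if k = j then (1 : K) else 0) • x + q ^ (-ip k j) • (e j * y)) := rfl

lemma q_ip : q ^ (-ip 0 0) = (q ^ 2)⁻¹ ∧ q ^ (-ip 0 1) = q ^ 3 ∧ q ^ (-ip 1 0) = q ^ 3 ∧
    q ^ (-ip 1 1) = (q ^ 6)⁻¹ := by
  refine ⟨?_, ?_, ?_, ?_⟩ <;> simp [ip]

lemma derOp_vals (x y : Un) :
    derOp 0 0 (x, y) = (e 0 * x, x + (q ^ 2)⁻¹ • (e 0 * y)) ∧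
    derOp 0 1 (x, y) = (e 1 * x, q ^ 3 • (e 1 * y)) ∧
    derOp 1 0 (x, y) = (e 0 * x, q ^ 3 • (e 0 * y)) ∧
    derOp 1 1 (x, y) = (e 1 * x, x + (q ^ 6)⁻¹ • (e 1 * y)) := by
  obtain ⟨h1, h2, h3, h4⟩ := q_ip
  simp [derOp_apply, h1, h2, h3, h4]

lemma derOp_serre (k : Fin 2) : ∀ i j, i ≠ j → serre i j (derOp k i) (derOp k j) = 0 := by
  obtain ⟨h1, h2⟩ := (serre_iff e).mp serre_e
  have hq := q_ne_zero
  have v0 := fun x y => (derOp_vals x y).1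
  have v1 := fun x y => (derOp_vals x y).2.1
  have v2 := fun x y => (derOp_vals x y).2.2.1
  have v3 := fun x y => (derOp_vals x y).2.2.2
  refine (serre_iff (derOp k)).mpr ⟨?_, ?_⟩
  · refine LinearMap.ext fun ⟨x, y⟩ => ?_
    have hx := congrArg (· * x) h1
    have hy := congrArg (· * y) h1
    simp only [add_mul, sub_mul, smul_mul_assoc, mul_assoc, zero_mul] at hx hy
    fin_cases k
    · simp only [LinearMap.add_apply, LinearMap.sub_apply, LinearMap.smul_apply,
        Module.End.mul_apply, Fin.zero_eta, v0, v1, Prod.smul_mk, Prod.mk_add_mk, Prod.mk_sub_mk,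
        LinearMap.zero_apply, Prod.mk_eq_zero, mul_add, mul_smul_comm]
      refine ⟨hx, ?_⟩
      linear_combination (norm := skip) (q⁻¹ ^ 5) • hy
      simp only [s3, s2]
      match_scalars <;> field_simp <;> ring
    · simp only [LinearMap.add_apply, LinearMap.sub_apply, LinearMap.smul_apply,
        Module.End.mul_apply, Fin.mk_one, v2, v3, Prod.smul_mk, Prod.mk_add_mk, Prod.mk_sub_mk,
        LinearMap.zero_apply, Prod.mk_eq_zero, mul_add, mul_smul_comm]
      refine ⟨hx, ?_⟩
      linear_combination (norm := skip) (q ^ 6) • hy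
      simp only [s3, s2]
      match_scalars <;> field_simp <;> ring
  · refine LinearMap.ext fun ⟨x, y⟩ => ?_
    have hx := congrArg (· * x) h2
    have hy := congrArg (· * y) h2
    simp only [add_mul, sub_mul, smul_mul_assoc, mul_assoc, zero_mul] at hx hy
    fin_cases k
    · simp only [LinearMap.add_apply, LinearMap.sub_apply, LinearMap.smul_apply,
        Module.End.mul_apply, Fin.zero_eta, v0, v1, Prod.smul_mk, Prod.mk_add_mk, Prod.mk_sub_mk,
        LinearMap.zero_apply, Prod.mk_eq_zero, mul_add, mul_smul_comm]
      refine ⟨hx, ?_⟩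
      linear_combination (norm := skip) (q ^ 4) • hy
      simp only [s1]
      match_scalars <;> field_simp <;> ring
    · simp only [LinearMap.add_apply, LinearMap.sub_apply, LinearMap.smul_apply,
        Module.End.mul_apply, Fin.mk_one, v2, v3, Prod.smul_mk, Prod.mk_add_mk, Prod.mk_sub_mk,
        LinearMap.zero_apply, Prod.mk_eq_zero, mul_add, mul_smul_comm]
      refine ⟨hx, ?_⟩
      linear_combination (norm := skip) (q⁻¹ ^ 9) • hy
      simp only [s1]
      match_scalars <;> field_simp <;> ring

/-- Kashiwara's derivation `e'ₖ` of `U_q(𝔫)`, characterised by `e'ₖ(1) = 0` and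
`e'ₖ(eⱼ x) = δₖⱼ x + q^{-(αₖ, αⱼ)} eⱼ e'ₖ(x)`. -/
def eDer (k : Fin 2) : Un →ₗ[K] Un where
  toFun x := (Un.lift (derOp k) (derOp_serre k) x (1, 0)).2
  map_add' x y := by simp
  map_smul' c x := by simp

lemma eDer_one (k : Fin 2) : eDer k 1 = 0 := by simp [eDer]

lemma lift_derOp_fst (k : Fin 2) (x : Un) :
    ∀ v, (Un.lift (derOp k) (derOp_serre k) x v).1 = x * v.1 := by
  induction x using Un.induction with
  | h0 c => intro v; simp [Algebra.smul_def]
  | h1 i => intro v; rw [Un.lift_e]; rfl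
  | hm x y hx hy => intro v; rw [map_mul, Module.End.mul_apply, hx, hy, mul_assoc]
  | ha x y hx hy => intro v; simp [hx, hy, add_mul]

lemma eDer_e_mul (k j : Fin 2) (x : Un) :
    eDer k (e j * x) = (if k = j then (1 : K) else 0) • x + q ^ (-ip k j) • (e j * eDer k x) := by
  have h := lift_derOp_fst k x (1, 0)
  simp only [eDer, LinearMap.coe_mk, AddHom.coe_mk, map_mul, Un.lift_e, Module.End.mul_apply]
  rw [← Prod.mk.eta (p := Un.lift (derOp k) (derOp_serre k) x (1, 0)), derOp_apply, h]
  simp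

lemma eDer_vals (x : Un) :
    eDer 0 (e 0 * x) = x + (q ^ 2)⁻¹ • (e 0 * eDer 0 x) ∧
    eDer 0 (e 1 * x) = q ^ 3 • (e 1 * eDer 0 x) ∧
    eDer 1 (e 0 * x) = q ^ 3 • (e 0 * eDer 1 x) ∧
    eDer 1 (e 1 * x) = x + (q ^ 6)⁻¹ • (e 1 * eDer 1 x) := by
  obtain ⟨h1, h2, h3, h4⟩ := q_ip
  simp [eDer_e_mul, h1, h2, h3, h4]

/-- A linear endomorphism killing `1` and preserving the vanishing under left multiplication by
the generators is zero. -/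
lemma end_eq_zero (S : Module.End K Un) (h1 : S 1 = 0) (he : ∀ i y, S y = 0 → S (e i * y) = 0) :
    S = 0 := by
  have key : ∀ x : Un, ∀ y, S y = 0 → S (x * y) = 0 := by
    intro x
    induction x using Un.induction with
    | h0 c => intro y hy; rw [← Algebra.smul_def, map_smul, hy, smul_zero]
    | h1 i => exact he i
    | hm x y hx hy => intro z hz; rw [mul_assoc]; exact hx _ (hy _ hz)
    | ha x y hx hy => intro z hz; rw [add_mul, map_add, hx _ hz, hy _ hz, add_zero]
  ext x
  simpa using key x 1 h1

lemma eDer_serre : ∀ i j, i ≠ j → serre i j (eDer i : Module.End K Un) (eDer j) = 0 := by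
  have hq := q_ne_zero
  have v0 := fun x => (eDer_vals x).1
  have v1 := fun x => (eDer_vals x).2.1
  have v2 := fun x => (eDer_vals x).2.2.1
  have v3 := fun x => (eDer_vals x).2.2.2
  refine (serre_iff (fun i => (eDer i : Module.End K Un))).mpr ⟨?_, ?_⟩
  · refine end_eq_zero _ (by simp [eDer_one]) fun i y hy => ?_
    simp only [LinearMap.add_apply, LinearMap.sub_apply, LinearMap.smul_apply,
        Module.End.mul_apply] at hy ⊢
    have hy' := congrArg (e i * ·) hy
    fin_cases i
    · simp only [Fin.zero_eta, v0, v2, map_add, map_smul, mul_add, mul_sub, mul_smul_comm,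
        mul_zero] at hy' ⊢
      linear_combination (norm := skip) (q⁻¹ ^ 5) • hy'
      simp only [s3, s2]
      match_scalars <;> field_simp <;> ring
    · simp only [Fin.mk_one, v1, v3, map_add, map_smul, mul_add, mul_sub, mul_smul_comm,
        mul_zero] at hy' ⊢
      linear_combination (norm := skip) (q ^ 6) • hy'
      simp only [s3, s2]
      match_scalars <;> field_simp <;> ring
  · refine end_eq_zero _ (by simp [eDer_one]) fun i y hy => ?_
    simp only [LinearMap.add_apply, LinearMap.sub_apply, LinearMap.smul_apply,
        Module.End.mul_apply] at hy ⊢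
    have hy' := congrArg (e i * ·) hy
    fin_cases i
    · simp only [Fin.zero_eta, v0, v2, map_add, map_smul, mul_add, mul_sub, mul_smul_comm,
        mul_zero] at hy' ⊢
      linear_combination (norm := skip) (q ^ 4) • hy'
      simp only [s1]
      match_scalars <;> field_simp <;> ring
    · simp only [Fin.mk_one, v1, v3, map_add, map_smul, mul_add, mul_sub, mul_smul_comm,
        mul_zero] at hy' ⊢
      linear_combination (norm := skip) (q⁻¹ ^ 9) • hy'
      simp only [s1]
      match_scalars <;> field_simp <;> ring

lemma eDer_op_serre : ∀ i j, i ≠ j → serre i j (MulOpposite.op (eDer i : Module.End K Un))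
    (MulOpposite.op (eDer j)) = 0 := by
  obtain ⟨h1, h2⟩ := (serre_iff (fun i => (eDer i : Module.End K Un))).mp eDer_serre
  refine (serre_iff (fun i => MulOpposite.op (eDer i : Module.End K Un))).mpr ⟨?_, ?_⟩
  · apply MulOpposite.unop_injective
    simp only [MulOpposite.unop_add, MulOpposite.unop_sub, MulOpposite.unop_smul,
      MulOpposite.unop_mul, MulOpposite.unop_op, MulOpposite.unop_zero, ← mul_assoc]
    refine Eq.trans ?_ h1
    abel
  · apply MulOpposite.unop_injective
    simp only [MulOpposite.unop_add, MulOpposite.unop_sub, MulOpposite.unop_smul,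
      MulOpposite.unop_mul, MulOpposite.unop_op, MulOpposite.unop_zero, ← mul_assoc]
    refine Eq.trans ?_ h2
    abel

/-- The action of `U_q(𝔫)` (from the right) on itself through `eᵢ ↦ e'ᵢ`. -/
def derAct : Un →ₐ[K] (Module.End K Un)ᵐᵒᵖ :=
  Un.lift (fun i => MulOpposite.op (eDer i)) eDer_op_serre

/-- The augmentation `U_q(𝔫) → ℚ(q)`, `eᵢ ↦ 0`. -/
def counit : Un →ₐ[K] K :=
  Un.lift (fun _ => 0) ((serre_iff (fun _ : Fin 2 => (0 : K))).mpr (by simp))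

/-- The natural scalar product on `U_q(𝔫)`: the bilinear form with `(1, 1) = 1` and
`(eᵢ x, y) = (x, e'ᵢ(y))`. -/
def form : Un →ₗ[K] Un →ₗ[K] K :=
  LinearMap.mk₂ K (fun x y => counit ((derAct x).unop y))
    (by intros; simp) (by intros; simp) (by intros; simp) (by intros; simp)

lemma form_one_one : form 1 1 = 1 := by simp [form]

lemma form_e_mul (i : Fin 2) (x y : Un) : form (e i * x) y = form x (eDer i y) := by
  simp [form, derAct, Un.lift_e]

/-! ## The quantum shuffle realization -/

/-- `ℚ(q)`-linear combinations of words in the letters `w₁, w₂` (written `0, 1`). -/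
abbrev Words : Type := List (Fin 2) →₀ K

/-- The word `w[i₁, …, iₖ]`. -/
def word (l : List (Fin 2)) : Words := Finsupp.single l 1

/-- The linear map `w ↦ i w` on words. -/
def consL (i : Fin 2) : Words →ₗ[K] Words := Finsupp.lmapDomain K K (List.cons i)

/-- The quantum shuffle product of two words: the sum of all shuffles of `u` and `v`, each weighted
by `q^{-e}`, where `e` is the sum of `(αᵢ, αⱼ)` over all pairs consisting of a letter `i` of `u` and
a letter `j` of `v` such that `i` stands to the left of `j` in the shuffle. -/
def shuffleWord : List (Fin 2) → List (Fin 2) → Words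
  | [], v => word v
  | u, [] => word u
  | i :: u, j :: v =>
      q ^ (-((j :: v).map (ip i)).sum) • consL i (shuffleWord u (j :: v)) +
        consL j (shuffleWord (i :: u) v)
  termination_by u v => u.length + v.length

/-- The quantum shuffle product. -/
def shuffle : Words →ₗ[K] Words →ₗ[K] Words :=
  Finsupp.linearCombination K fun u => Finsupp.linearCombination K fun v => shuffleWord u v

/-- Shuffle multiplication by a letter on the left. -/
def letterMul (i : Fin 2) : Module.End K Words := shuffle (word [i])

/-- Deletion of the first letter `k` (words not starting with `k` are sent to `0`). -/
def delFirst (k : Fin 2) : Module.End K Words :=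
  Finsupp.lcomapDomain (List.cons k) (List.cons_injective)

/-- The operator `v ↦ q^{-(αₖ, |v|)} v` on words. -/
def wtOp (k : Fin 2) : Module.End K Words :=
  Finsupp.linearCombination K fun v => q ^ (-(v.map (ip k)).sum) • word v

lemma words_ext {f g : Module.End K Words} (h : ∀ v, f (word v) = g (word v)) : f = g := by
  refine Finsupp.lhom_ext' fun v => LinearMap.ext_ring ?_
  exact h v

lemma letterMul_nil (i : Fin 2) : letterMul i (word []) = word [i] := by
  simp [letterMul, shuffle, word, shuffleWord]

lemma letterMul_cons (i j : Fin 2) (v : List (Fin 2)) : letterMul i (word (j :: v)) =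
    q ^ (-((j :: v).map (ip i)).sum) • word (i :: j :: v) + consL j (letterMul i (word v)) := by
  simp [letterMul, shuffle, word, shuffleWord, consL, Finsupp.mapDomain_single]

lemma word_cons (i : Fin 2) (v : List (Fin 2)) : word (i :: v) = consL i (word v) := by
  simp [word, consL, Finsupp.mapDomain_single]

lemma delFirst_apply (k : Fin 2) (x : Words) (v : List (Fin 2)) : delFirst k x v = x (k :: v) := rfl

lemma delFirst_consL (k j : Fin 2) (x : Words) :
    delFirst k (consL j x) = (if k = j then (1 : K) else 0) • x := by
  have h : delFirst k * consL j = (if k = j then (1 : K) else 0) • (1 : Module.End K Words) := by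
    refine words_ext fun v => ?_
    ext l
    rw [Module.End.mul_apply, ← word_cons, delFirst_apply]
    by_cases hkj : k = j
    · simp [hkj, word, Finsupp.single_apply]
    · simp [hkj, word]
  exact LinearMap.congr_fun h x

lemma delFirst_nil (k : Fin 2) : delFirst k (word []) = 0 := by
  ext l
  rw [delFirst_apply]
  simp [word]

lemma wtOp_word (k : Fin 2) (v : List (Fin 2)) :
    wtOp k (word v) = q ^ (-(v.map (ip k)).sum) • word v := by
  simp [wtOp, word]

lemma wtOp_consL (k j : Fin 2) (x : Words) :
    wtOp k (consL j x) = q ^ (-ip k j) • consL j (wtOp k x) := by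
  have h : wtOp k * consL j = q ^ (-ip k j) • (consL j * wtOp k : Module.End K Words) := by
    refine words_ext fun v => ?_
    simp only [Module.End.mul_apply, LinearMap.smul_apply]
    rw [← word_cons, wtOp_word, wtOp_word, map_smul, ← word_cons, smul_smul,
      ← zpow_add₀ q_ne_zero]
    congr 2
    simp
    ring
  exact LinearMap.congr_fun h x

lemma wtOp_letterMul (k j : Fin 2) (x : Words) :
    wtOp k (letterMul j x) = q ^ (-ip k j) • letterMul j (wtOp k x) := by
  have h : wtOp k * letterMul j = q ^ (-ip k j) • (letterMul j * wtOp k) := by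
    refine words_ext fun v => ?_
    simp only [Module.End.mul_apply, LinearMap.smul_apply]
    induction v with
    | nil => simp [letterMul_nil, wtOp_word]
    | cons b v ih =>
      rw [letterMul_cons, map_add, map_smul, wtOp_consL, ih, word_cons b v, wtOp_consL, map_smul,
        wtOp_word k v, word_cons j (b :: v), wtOp_consL, wtOp_word k (b :: v), map_smul, map_smul,
        map_smul, map_smul, map_smul, map_smul, ← word_cons b v, letterMul_cons, ← word_cons j (b :: v)]
      simp only [List.map_cons, List.sum_cons, neg_add, zpow_add₀ q_ne_zero]
      module
  exact LinearMap.congr_fun h x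

lemma delFirst_letterMul (k j : Fin 2) (x : Words) : delFirst k (letterMul j x) =
    letterMul j (delFirst k x) + (if k = j then (1 : K) else 0) • wtOp k x := by
  have h : delFirst k * letterMul j =
      letterMul j * delFirst k + (if k = j then (1 : K) else 0) • wtOp k := by
    refine words_ext fun v => ?_
    simp only [Module.End.mul_apply, LinearMap.add_apply, LinearMap.smul_apply]
    cases v with
    | nil => simp [letterMul_nil, word_cons, delFirst_consL, delFirst_nil, wtOp_word]
    | cons b v =>
      rw [letterMul_cons, map_add, map_smul, word_cons j (b :: v), delFirst_consL, delFirst_consL,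
        wtOp_word, word_cons b v, delFirst_consL, map_smul]
      by_cases hkj : k = j
      · subst hkj
        simp [add_comm]
      · simp [hkj]
  exact LinearMap.congr_fun h x

lemma letterMul_apply_nil (j : Fin 2) (x : Words) : letterMul j x [] = 0 := by
  have h : Finsupp.lapply (R := K) [] ∘ₗ letterMul j = 0 := by
    refine Finsupp.lhom_ext' fun v => LinearMap.ext_ring ?_
    change (letterMul j (word v)) [] = 0
    cases v with
    | nil => rw [letterMul_nil]; simp [word]
    | cons b v =>
      rw [letterMul_cons, Finsupp.add_apply, Finsupp.smul_apply, consL, Finsupp.lmapDomain_apply,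
        Finsupp.mapDomain_of_notMem_range _ _ (by simp)]
      simp [word]
  exact LinearMap.congr_fun h x

lemma words_eq_zero (y : Words) (h : ∀ k, delFirst k y = 0) (h' : y [] = 0) : y = 0 := by
  ext l
  cases l with
  | nil => exact h'
  | cons k l => rw [← delFirst_apply, h]; rfl

lemma words_end_eq_zero (S : Module.End K Words) (h : ∀ k x, delFirst k (S x) = S (delFirst k x))
    (h' : ∀ x, S x [] = 0) : S = 0 := by
  refine words_ext fun v => ?_
  induction v with
  | nil =>
    refine words_eq_zero _ (fun k => ?_) (h' _)
    rw [h, delFirst_nil, map_zero]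
  | cons b v ih =>
    refine words_eq_zero _ (fun k => ?_) (h' _)
    rw [h, word_cons, delFirst_consL, map_smul, ih, LinearMap.zero_apply, smul_zero]

lemma letterMul_vals (x : Words) :
    (delFirst 0 (letterMul 0 x) = letterMul 0 (delFirst 0 x) + wtOp 0 x ∧
      delFirst 0 (letterMul 1 x) = letterMul 1 (delFirst 0 x) ∧
      delFirst 1 (letterMul 0 x) = letterMul 0 (delFirst 1 x) ∧
      delFirst 1 (letterMul 1 x) = letterMul 1 (delFirst 1 x) + wtOp 1 x) ∧
    wtOp 0 (letterMul 0 x) = (q ^ 2)⁻¹ • letterMul 0 (wtOp 0 x) ∧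
      wtOp 0 (letterMul 1 x) = q ^ 3 • letterMul 1 (wtOp 0 x) ∧
      wtOp 1 (letterMul 0 x) = q ^ 3 • letterMul 0 (wtOp 1 x) ∧
      wtOp 1 (letterMul 1 x) = (q ^ 6)⁻¹ • letterMul 1 (wtOp 1 x) := by
  obtain ⟨h1, h2, h3, h4⟩ := q_ip
  simp [delFirst_letterMul, wtOp_letterMul, h1, h2, h3, h4]

lemma letterMul_serre : ∀ i j, i ≠ j → serre i j (letterMul i) (letterMul j) = 0 := by
  have hq := q_ne_zero
  have v0 := fun x => (letterMul_vals x).1.1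
  have v1 := fun x => (letterMul_vals x).1.2.1
  have v2 := fun x => (letterMul_vals x).1.2.2.1
  have v3 := fun x => (letterMul_vals x).1.2.2.2
  have w0 := fun x => (letterMul_vals x).2.1
  have w1 := fun x => (letterMul_vals x).2.2.1
  have w2 := fun x => (letterMul_vals x).2.2.2.1
  have w3 := fun x => (letterMul_vals x).2.2.2.2
  refine (serre_iff letterMul).mpr ⟨?_, ?_⟩
  · refine words_end_eq_zero _ (fun k x => ?_) fun x => ?_
    · simp only [LinearMap.add_apply, LinearMap.sub_apply, LinearMap.smul_apply,
        Module.End.mul_apply]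
      fin_cases k
      · simp only [Fin.zero_eta, v0, v1, w0, w1, map_add, map_sub, map_smul]
        simp only [s3, s2]
        match_scalars <;> field_simp <;> ring
      · simp only [Fin.mk_one, v2, v3, w2, map_add, map_sub, map_smul]
        simp only [s3, s2]
        match_scalars <;> field_simp <;> ring
    · simp [letterMul_apply_nil]
  · refine words_end_eq_zero _ (fun k x => ?_) fun x => ?_
    · simp only [LinearMap.add_apply, LinearMap.sub_apply, LinearMap.smul_apply,
        Module.End.mul_apply]
      fin_cases k
      · simp only [Fin.zero_eta, v0, v1, w1, map_add, map_sub, map_smul]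
        simp only [s1]
        match_scalars <;> field_simp <;> ring
      · simp only [Fin.mk_one, v2, v3, w2, w3, map_add, map_sub, map_smul]
        simp only [s1]
        match_scalars <;> field_simp <;> ring
    · simp [letterMul_apply_nil]

/-- The realization `U_q(𝔫) → (Words, shuffle)`: the linear map with `1 ↦` the empty word and
`eᵢ x ↦ w[i] * Φ(x)`. -/
def Phi : Un →ₗ[K] Words where
  toFun x := Un.lift letterMul letterMul_serre x (word [])
  map_add' x y := by simp
  map_smul' c x := by simp

lemma Phi_one : Phi 1 = word [] := by simp [Phi]

lemma Phi_e_mul (i : Fin 2) (x : Un) : Phi (e i * x) = shuffle (word [i]) (Phi x) := by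
  simp [Phi, Un.lift_e, letterMul]

lemma shuffle_word (u v : List (Fin 2)) : shuffle (word u) (word v) = shuffleWord u v := by
  simp [shuffle, word]

lemma shuffle_nil_left (x : Words) : shuffle (word []) x = x := by
  have h : shuffle (word []) = LinearMap.id :=
    words_ext (f := shuffle (word [])) (g := LinearMap.id) fun v => by
      rw [shuffle_word]; simp [shuffleWord]
  rw [h]; rfl

lemma shuffle_nil_right (x : Words) : shuffle x (word []) = x := by
  have h : shuffle.flip (word []) = LinearMap.id :=
    words_ext (f := shuffle.flip (word [])) (g := LinearMap.id) fun v => by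
      rw [LinearMap.flip_apply, shuffle_word]
      cases v <;> simp [shuffleWord]
  exact LinearMap.congr_fun h x

lemma shuffle_cons (i j : Fin 2) (u v : List (Fin 2)) :
    shuffle (word (i :: u)) (word (j :: v)) =
      consL i (shuffle (word u) (wtOp i (word (j :: v)))) +
        consL j (shuffle (word (i :: u)) (word v)) := by
  rw [shuffle_word, shuffleWord, wtOp_word, map_smul, map_smul, shuffle_word, shuffle_word]

lemma wtOp_shuffle (k : Fin 2) (u v : List (Fin 2)) : wtOp k (shuffle (word u) (word v)) =
    (q ^ (-(u.map (ip k)).sum) * q ^ (-(v.map (ip k)).sum)) • shuffle (word u) (word v) := by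
  induction u generalizing v with
  | nil => simp [shuffle_nil_left, wtOp_word]
  | cons i u ihu =>
    induction v with
    | nil => simp [shuffle_nil_right, wtOp_word]
    | cons j v ihv =>
      rw [shuffle_cons, map_add, wtOp_consL, wtOp_consL, ihv, wtOp_word i, map_smul, map_smul,
        ihu]
      simp only [List.map_cons, List.sum_cons, neg_add, zpow_add₀ q_ne_zero, map_smul]
      module

lemma delFirst_shuffle (k : Fin 2) (u v : List (Fin 2)) : delFirst k (shuffle (word u) (word v)) =
    shuffle (delFirst k (word u)) (wtOp k (word v)) + shuffle (word u) (delFirst k (word v)) := by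
  cases u with
  | nil => simp [shuffle_nil_left, delFirst_nil]
  | cons i u =>
    cases v with
    | nil => simp [shuffle_nil_right, delFirst_nil, wtOp_word]
    | cons j v =>
      rw [shuffle_cons, map_add, delFirst_consL, delFirst_consL, word_cons i u, delFirst_consL,
        word_cons j v, delFirst_consL, map_smul, map_smul, LinearMap.smul_apply]
      by_cases hki : k = i
      · subst hki; simp
      · simp [hki]

lemma shuffle_apply_nil (u v : List (Fin 2)) (h : u ≠ [] ∨ v ≠ []) :
    shuffle (word u) (word v) [] = 0 := by
  have hc : ∀ (j : Fin 2) (x : Words), consL j x [] = 0 := fun j x => by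
    rw [consL, Finsupp.lmapDomain_apply, Finsupp.mapDomain_of_notMem_range _ _ (by simp)]
  cases u with
  | nil => rw [shuffle_nil_left]; simp_all [word]
  | cons i u =>
    cases v with
    | nil => rw [shuffle_nil_right]; simp [word]
    | cons j v => rw [shuffle_cons, Finsupp.add_apply, hc, hc, add_zero]

lemma bilin_words_ext {f g : Words →ₗ[K] Words →ₗ[K] Words}
    (h : ∀ u v, f (word u) (word v) = g (word u) (word v)) : f = g := by
  refine Finsupp.lhom_ext' fun u => LinearMap.ext_ring ?_
  exact words_ext (f := f (word u)) (g := g (word u)) fun v => h u v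

lemma wtOp_shuffle' (k : Fin 2) (x y : Words) :
    wtOp k (shuffle x y) = shuffle (wtOp k x) (wtOp k y) := by
  have h : shuffle.compr₂ (wtOp k) = shuffle.compl₁₂ (wtOp k) (wtOp k) :=
    bilin_words_ext fun u v => by
      simp only [LinearMap.compr₂_apply, LinearMap.compl₁₂_apply]
      rw [wtOp_shuffle, wtOp_word, wtOp_word, map_smul, map_smul, LinearMap.smul_apply, smul_smul,
        mul_comm]
  exact LinearMap.congr_fun₂ h x y

lemma delFirst_shuffle' (k : Fin 2) (x y : Words) : delFirst k (shuffle x y) =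
    shuffle (delFirst k x) (wtOp k y) + shuffle x (delFirst k y) := by
  have h : shuffle.compr₂ (delFirst k) =
      shuffle.compl₁₂ (delFirst k) (wtOp k) + shuffle.compl₁₂ LinearMap.id (delFirst k) :=
    bilin_words_ext fun u v => by
      simpa using delFirst_shuffle k u v
  exact LinearMap.congr_fun₂ h x y

lemma letterMul_shuffle_word (i : Fin 2) (n : ℕ) : ∀ u v : List (Fin 2), u.length + v.length = n →
    shuffle (letterMul i (word u)) (word v) - letterMul i (shuffle (word u) (word v)) = 0 := by
  induction n using Nat.strong_induction_on with
  | _ n ih =>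
    intro u v huv
    have h1 : ∀ k, shuffle (letterMul i (delFirst k (word u))) (word v) =
        letterMul i (shuffle (delFirst k (word u)) (word v)) := fun k => by
      cases u with
      | nil => simp [delFirst_nil]
      | cons a u =>
        have := sub_eq_zero.mp (ih (u.length + v.length) (by simp at huv; omega) u v rfl)
        rw [word_cons, delFirst_consL]
        split_ifs <;> simp [this]
    have h2 : ∀ k, shuffle (letterMul i (word u)) (delFirst k (word v)) =
        letterMul i (shuffle (word u) (delFirst k (word v))) := fun k => by
      cases v with
      | nil => simp [delFirst_nil]
      | cons a v =>
        have := sub_eq_zero.mp (ih (u.length + v.length) (by simp at huv; omega) u v rfl)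
        rw [word_cons, delFirst_consL]
        split_ifs <;> simp [this]
    refine words_eq_zero _ (fun k => ?_) ?_
    · rw [map_sub, delFirst_letterMul, delFirst_shuffle', delFirst_shuffle', delFirst_letterMul,
        map_add, map_smul, LinearMap.add_apply, LinearMap.smul_apply, h2, wtOp_shuffle',
        wtOp_word k v, map_smul, map_smul, map_smul, h1, map_add, map_smul]
      abel
    · rw [Finsupp.sub_apply, letterMul_apply_nil, sub_zero]
      have h : ∀ x : Words, x [] = 0 → shuffle x (word v) [] = 0 := fun x hx => by
        have hx' : x = x.sum fun w c => c • word w := by simp [word]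
        rw [hx', Finsupp.sum, map_sum, LinearMap.sum_apply, Finsupp.finsetSum_apply]
        refine Finset.sum_eq_zero fun w hw => ?_
        have hw' : w ≠ [] := by rintro rfl; simp [hx] at hw
        rw [map_smul, LinearMap.smul_apply, Finsupp.smul_apply, shuffle_apply_nil w v (Or.inl hw'),
          smul_zero]
      exact h _ (letterMul_apply_nil i _)

lemma letterMul_shuffle (i : Fin 2) (x y : Words) :
    letterMul i (shuffle x y) = shuffle (letterMul i x) y := by
  have h : shuffle.compr₂ (letterMul i) = shuffle.compl₁₂ (letterMul i) LinearMap.id :=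
    bilin_words_ext fun u v => (sub_eq_zero.mp (letterMul_shuffle_word i _ u v rfl)).symm
  exact LinearMap.congr_fun₂ h x y

/-- `Φ` turns the multiplication of `U_q(𝔫)` into the quantum shuffle product. -/
theorem Phi_mul (x y : Un) : Phi (x * y) = shuffle (Phi x) (Phi y) := by
  have key : ∀ z : Un, (∀ y, Phi (z * y) = shuffle (Phi z) (Phi y)) →
      ∀ y, Phi (x * z * y) = shuffle (Phi (x * z)) (Phi y) := by
    induction x using Un.induction with
    | h0 c =>
      intro z hz y
      rw [mul_assoc, ← Algebra.smul_def, ← Algebra.smul_def, map_smul, map_smul, hz, map_smul,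
        LinearMap.smul_apply]
    | h1 i =>
      intro z hz y
      rw [mul_assoc, Phi_e_mul, Phi_e_mul, hz]
      exact letterMul_shuffle i _ _
    | hm a b ha hb =>
      intro z hz y
      rw [mul_assoc a b z]
      exact ha _ (hb z hz) y
    | ha a b ha hb =>
      intro z hz y
      rw [add_mul, add_mul, map_add, map_add, ha z hz, hb z hz, map_add, LinearMap.add_apply]
  have := key 1 (fun y => by rw [one_mul, Phi_one, shuffle_nil_left]) y
  rwa [mul_one] at this

/-! ## The quantized enveloping algebra `U_q(𝔤)` and the braid group action -/

/-- Generators of `U_q(𝔤)`: `Eᵢ`, `Fᵢ`, `Kᵢ` and `Kᵢ⁻¹`. -/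
inductive Gen
  | E (i : Fin 2)
  | F (i : Fin 2)
  | K (i : Fin 2)
  | Kinv (i : Fin 2)

/-- Free generators. -/
abbrev fr (g : Gen) : FreeAlgebra K Gen := FreeAlgebra.ι K g

/-- The defining relations of `U_q(𝔤)`. -/
inductive UgRel : FreeAlgebra K Gen → FreeAlgebra K Gen → Prop
  | K_Kinv (i : Fin 2) : UgRel (fr (.K i) * fr (.Kinv i)) 1
  | Kinv_K (i : Fin 2) : UgRel (fr (.Kinv i) * fr (.K i)) 1
  | K_K (i j : Fin 2) : UgRel (fr (.K i) * fr (.K j)) (fr (.K j) * fr (.K i))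
  | K_E (i j : Fin 2) : UgRel (fr (.K i) * fr (.E j)) (q ^ ip i j • (fr (.E j) * fr (.K i)))
  | K_F (i j : Fin 2) : UgRel (fr (.K i) * fr (.F j)) (q ^ (-ip i j) • (fr (.F j) * fr (.K i)))
  | E_F (i : Fin 2) : UgRel (fr (.E i) * fr (.F i) - fr (.F i) * fr (.E i))
      ((qi i - (qi i)⁻¹)⁻¹ • (fr (.K i) - fr (.Kinv i)))
  | E_F_ne (i j : Fin 2) (h : i ≠ j) : UgRel (fr (.E i) * fr (.F j)) (fr (.F j) * fr (.E i))
  | serre_E (i j : Fin 2) (h : i ≠ j) : UgRel (serre i j (fr (.E i)) (fr (.E j))) 0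
  | serre_F (i j : Fin 2) (h : i ≠ j) : UgRel (serre i j (fr (.F i)) (fr (.F j))) 0

/-- `U_q(𝔤)` for `𝔤` of type `G₂`. -/
abbrev Ug : Type := RingQuot UgRel

/-- The generators of `U_q(𝔤)`. -/
def ug (g : Gen) : Ug := RingQuot.mkAlgHom K UgRel (fr g)

/-- The inclusion `U_q(𝔫) → U_q(𝔤)`, `eᵢ ↦ Eᵢ`. -/
def incl : Un →ₐ[K] Ug :=
  Un.lift (fun i => ug (.E i)) fun i j h => by
    have := RingQuot.mkAlgHom_rel K (UgRel.serre_E i j h)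
    rwa [map_serre, map_zero] at this

/-- The values on generators of Lusztig's automorphism `Tᵢ = T'_{i,1}` of `U_q(𝔤)`:
`Eᵢ ↦ -Kᵢ Fᵢ`, `Fᵢ ↦ -Eᵢ Kᵢ⁻¹`, `Kⱼ ↦ Kⱼ Kᵢ^{-aᵢⱼ}`, and for `j ≠ i`
`Eⱼ ↦ ∑_{r+s=-aᵢⱼ} (-1)ʳ qᵢʳ Eᵢ⁽ʳ⁾ Eⱼ Eᵢ⁽ˢ⁾`, `Fⱼ ↦ ∑_{r+s=-aᵢⱼ} (-1)ʳ qᵢ⁻ʳ Fᵢ⁽ˢ⁾ Fⱼ Fᵢ⁽ʳ⁾`. -/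
def braidGen (i : Fin 2) : Gen → Ug
  | .E j =>
      if j = i then -(ug (.K i) * ug (.F i))
      else ∑ r ∈ Finset.range ((-cartan i j).toNat + 1), ((-1) ^ r * qi i ^ r) •
        (divPow i (ug (.E i)) r * ug (.E j) * divPow i (ug (.E i)) ((-cartan i j).toNat - r))
  | .F j =>
      if j = i then -(ug (.E i) * ug (.Kinv i))
      else ∑ r ∈ Finset.range ((-cartan i j).toNat + 1), ((-1) ^ r * (qi i)⁻¹ ^ r) •
        (divPow i (ug (.F i)) ((-cartan i j).toNat - r) * ug (.F j) * divPow i (ug (.F i)) r)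
  | .K j =>
      if j = i then ug (.Kinv i) else ug (.K j) * ug (.K i) ^ (-cartan i j).toNat
  | .Kinv j =>
      if j = i then ug (.K i) else ug (.Kinv j) * ug (.Kinv i) ^ (-cartan i j).toNat

/-- The graph of `Tᵢ`: the subalgebra of `U_q(𝔤) × U_q(𝔤)` generated by the pairs `(g, Tᵢ g)`,
`g` a generator. Since `Tᵢ` is an algebra homomorphism, this is exactly `{(x, Tᵢ x)}`. -/
def braidGraph (i : Fin 2) : Subalgebra K (Ug × Ug) :=
  Algebra.adjoin K (Set.range fun g => (ug g, braidGen i g))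

/-- `IsBraidImage [i₁, …, iₖ] x y` says that `y = T_{i₁} ⋯ T_{iₖ} x`. -/
def IsBraidImage : List (Fin 2) → Ug → Ug → Prop
  | [], x, y => y = x
  | i :: l, x, y => ∃ z, IsBraidImage l x z ∧ (z, y) ∈ braidGraph i

/-! ## PBW basis, canonical basis, dual canonical basis -/

/-- The reduced word of `w₀ = s₁ s₂ s₁ s₂ s₁ s₂`. -/
def redWord : Fin 6 → Fin 2 := ![0, 1, 0, 1, 0, 1]

/-- `E k` (`k = 0, …, 5`) are the root vectors `E(β_{k+1}) = T_{i₁} ⋯ T_{iₖ}(e_{i_{k+1}})` of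
`U_q(𝔫)` attached to the reduced word; they belong to
`α₁ < 3α₁+α₂ < 2α₁+α₂ < 3α₁+2α₂ < α₁+α₂ < α₂`. As `U_q(𝔫) → U_q(𝔤)` is injective, this
determines `E`. -/
def IsRootVectors (E : Fin 6 → Un) : Prop :=
  ∀ k : Fin 6, IsBraidImage ((List.ofFn redWord).take k) (ug (.E (redWord k))) (incl (E k))

/-- The PBW vector `E(m) = E(β₁)^{(m₁)} ⋯ E(β₆)^{(m₆)}`. -/
def pbw (E : Fin 6 → Un) (m : Fin 6 → ℕ) : Un :=
  (List.ofFn fun k => divPow (redWord k) (E k) (m k)).prod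

/-- `q L` for `L` the `ℤ[q]`-lattice spanned by a set `S` of vectors: all finite sums of
`± qⁿ v` with `n ≥ 1` and `v ∈ S`. -/
def qLattice (S : Set Un) : AddSubgroup Un :=
  AddSubgroup.closure {x | ∃ n : ℕ, 1 ≤ n ∧ ∃ v ∈ S, x = q ^ n • v}

/-- The canonical basis `𝐁`: the bar-invariant vectors congruent to a PBW vector modulo `q` times
the `ℤ[q]`-lattice spanned by the PBW basis. -/
def canonicalBasis (E : Fin 6 → Un) : Set Un :=
  {x | bar x = x ∧ ∃ m, x - pbw E m ∈ qLattice (Set.range (pbw E))}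

/-- The weight space of `U_q(𝔫)` of weight `ν₀ α₁ + ν₁ α₂`. -/
def weightSpace (ν : Fin 2 → ℕ) : Submodule K Un :=
  Submodule.span K {x | ∃ l : List (Fin 2), (∀ i, l.count i = ν i) ∧ x = (l.map e).prod}

/-- Weight vectors. -/
def Homogeneous (x : Un) : Prop := ∃ ν, x ∈ weightSpace ν

/-- The dual canonical basis `𝐁*`: the basis of (the graded space) `U_q(𝔫)` dual to `𝐁` for the
scalar product. -/
def dualCanonicalBasis (E : Fin 6 → Un) : Set Un :=
  {y | Homogeneous y ∧ ∃ x ∈ canonicalBasis E, form y x = 1 ∧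
    ∀ x' ∈ canonicalBasis E, x' ≠ x → form y x' = 0}

/-- `x = E*(m)`, the vector of the dual PBW basis with label `m`. -/
def IsDualPBW (E : Fin 6 → Un) (m : Fin 6 → ℕ) (x : Un) : Prop :=
  Homogeneous x ∧ form x (pbw E m) = 1 ∧ ∀ m', m' ≠ m → form x (pbw E m') = 0

/-- `y = 𝐛(m)`: `y ∈ 𝐁*` and `y - E*(m) ∈ q L*`, where `L*` is the `ℤ[q]`-lattice spanned
by `𝐁*`. -/
def IsDualCanonical (E : Fin 6 → Un) (m : Fin 6 → ℕ) (y : Un) : Prop :=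
  y ∈ dualCanonicalBasis E ∧ ∃ x, IsDualPBW E m x ∧ y - x ∈ qLattice (dualCanonicalBasis E)

/-- `q^ℤ 𝐁*`. -/
def qPowersDual (E : Fin 6 → Un) : Set Un :=
  {x | ∃ n : ℤ, ∃ y ∈ dualCanonicalBasis E, x = q ^ n • y}

/-- An element `b` of `𝐁*` is imaginary if `b² ∉ q^ℤ 𝐁*`. -/
def IsImaginary (E : Fin 6 → Un) (b : Un) : Prop :=
  b ∈ dualCanonicalBasis E ∧ b * b ∉ qPowersDual E

/-- The assertion of the Berenstein-Zelevinsky conjecture for a pair `b₁, b₂`: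
`b₁ b₂ ∈ q^ℤ 𝐁*` if and only if `b₁` and `b₂` `q`-commute. -/
def BZ (E : Fin 6 → Un) (b₁ b₂ : Un) : Prop :=
  b₁ * b₂ ∈ qPowersDual E ↔ ∃ n : ℤ, b₂ * b₁ = q ^ n • (b₁ * b₂)

end QGroupG2

end

open QGroupG2

/-!
Everything is computed inside two weight spaces, `2α₁ + α₂` (dimension 3, containing `b`) and
`4α₁ + 2α₂` (dimension 9, containing `b²`). The identity `b² = q⁻¹ (b₂ + z)` exhibits `b²` as a
combination of two different dual canonical basis vectors, so that `b²` is not a multiple of one of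
them, although `b` commutes with itself. The work lies in knowing the dual canonical basis in these
two weight spaces, with its labels.

*Root vectors.* `rootVec` consists of iterated `q`-commutators of `e₁` and `e₂`. Lusztig's
automorphisms permute the root vectors and their counterparts with reversed multiplication, because
`Tᵢ` replaces `Eᵢ` by `-Kᵢ Fᵢ`, whose `q`-commutators lower root strings; this gives
`isRootVectors_rootVec`. The quantum Serre relations say that the ends of the root strings
`q`-commute with the generators (`serre_iff_rootVec`), and all straightening relations between root
vectors follow from this (`IsRootFamily`).

*PBW basis.* The straightening relations show that the ordered monomials span, and that the bar
involution is unitriangular on them for the lexicographic order (`IsConvexFamily`). They are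
linearly independent because `U_q(𝔫)` acts through a quantum torus in six variables, by
`e₁ ↦ t₀ + t₂ + t₄` and `e₂ ↦ t₁ + t₃ + t₅`, where the root vectors have linearly independent
leading exponents (`linearIndependent_ordMon`). Triangularity implies that a bar-invariant vector in
`q` times the PBW lattice vanishes (`eq_zero_of_bar_eq`).

*Scalar product.* The coefficients of the shuffle realization of `y` are the scalar products of `y`
with words in the generators (`form_wordProd`). Hence different weight spaces are orthogonal.

*The criterion.* Suppose that in a weight space there are bar-invariant vectors whose expansion in
the PBW basis is unitriangular with off-diagonal coefficients in `qℤ[q]`, and vectors `y i` of the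
same weight dual to them. Then the former are the canonical basis of the weight space, and `y i` is
the dual canonical basis vector with the label of the `i`-th PBW vector
(`IsDualPair.isDualCanonical_iff`).

*The computation.* The bar-invariant vectors are combinations of words with bar-invariant
coefficients; their PBW expansions come from the straightening relations
(`triComb42_eq_wordComb`). The dual vectors are built by `q`-commutators and products, and
recognized by their shuffle realizations, from which the pairings can be read off (`isDualPair42`).
-/

noncomputable section

namespace QGroupG2

/-! ### Commutation relations between root vectors -/

/-- Vectors `x₁, x₂, x₃, x₃₂` of weights `α + β`, `2α + β`, `3α + β`, `3α + 2β` obtained from `a`,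
`b` (of weights `α = α₁`, `β = α₂`) by iterated `q`-commutators. The last two fields are the quantum
Serre relations. -/
structure IsRootFamily {A : Type*} [Ring A] [Algebra K A] (a b x₁ x₂ x₃ x₃₂ : A) : Prop where
  ba : b * a = q ^ 3 • (a * b) + x₁
  x₁a : x₁ * a = q • (a * x₁) + (q + q⁻¹) • x₂
  x₂a : x₂ * a = q⁻¹ • (a * x₂) + (q ^ 2 + 1 + q⁻¹ ^ 2) • x₃
  x₁x₂ : x₁ * x₂ = q⁻¹ • (x₂ * x₁) + (q ^ 2 + 1 + q⁻¹ ^ 2) • x₃₂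
  x₃a : x₃ * a = q⁻¹ ^ 3 • (a * x₃)
  bx₁ : b * x₁ = q⁻¹ ^ 3 • (x₁ * b)

lemma mul_mul_of_mul_eq {A : Type*} [Semigroup A] {x y z : A} (h : x * y = z) (w : A) :
    x * (y * w) = z * w := by rw [← mul_assoc, h]

lemma qTwo_ne_zero : q + q⁻¹ ≠ 0 := by
  have hq := q_ne_zero
  intro h
  apply qPoly_ne_zero.2.1
  field_simp at h
  linear_combination h

lemma qThree_ne_zero : q ^ 2 + 1 + q⁻¹ ^ 2 ≠ 0 := by
  have hq := q_ne_zero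
  intro h
  apply qPoly_ne_zero.2.2.1
  field_simp at h
  linear_combination h

lemma eq_of_smul_sub_eq_zero {M : Type*} [AddCommGroup M] [Module K M] {c : K} (hc : c ≠ 0)
    {x y : M} (h : c • (x - y) = 0) : x = y :=
  sub_eq_zero.mp ((smul_eq_zero_iff_right hc).mp h)

namespace IsRootFamily

variable {A : Type*} [Ring A] [Algebra K A] {a b x₁ x₂ x₃ x₃₂ : A}

lemma bx₂ (h : IsRootFamily a b x₁ x₂ x₃ x₃₂) :
    b * x₂ = x₂ * b + (q⁻¹ ^ 2 - 1) • (x₁ * x₁) := by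
  have hq := q_ne_zero
  apply eq_of_smul_sub_eq_zero qTwo_ne_zero
  have e₁ := congrArg (b * ·) h.x₁a
  have e₂ := congrArg (· * b) h.x₁a
  linear_combination (norm := skip) (-1 : K) • e₁ + (1 : K) • e₂
  simp only [mul_add, add_mul, smul_mul_assoc, mul_smul_comm, mul_assoc, h.ba, h.bx₁,
    mul_mul_of_mul_eq h.ba, mul_mul_of_mul_eq h.bx₁, mul_mul_of_mul_eq h.x₁a]
  match_scalars <;> field_simp <;> ring

lemma bx₃ (h : IsRootFamily a b x₁ x₂ x₃ x₃₂) :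
    b * x₃ = q ^ 3 • (x₃ * b) + (q⁻¹ ^ 3 - q⁻¹ - q) • x₃₂ + (q⁻¹ ^ 2 - 1) • (x₂ * x₁) := by
  have hq := q_ne_zero
  apply eq_of_smul_sub_eq_zero qThree_ne_zero
  have e₁ := congrArg (b * ·) h.x₂a
  have e₂ := congrArg (· * b) h.x₂a
  linear_combination (norm := skip) (-1 : K) • e₁ + (q ^ 3) • e₂
  simp only [mul_add, add_mul, smul_mul_assoc, mul_smul_comm, mul_assoc, h.ba, h.bx₁, h.x₁a, h.bx₂,
    h.x₁x₂, mul_mul_of_mul_eq h.x₂a,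
    mul_mul_of_mul_eq h.ba, mul_mul_of_mul_eq h.bx₁, mul_mul_of_mul_eq h.x₁a,
      mul_mul_of_mul_eq h.bx₂]
  match_scalars <;> field_simp <;> ring

lemma x₁x₃_aux (h : IsRootFamily a b x₁ x₂ x₃ x₃₂) :
    x₁ * x₃ = x₃ * x₁ + x₃₂ * a - a * x₃₂ := by
  have hq := q_ne_zero
  apply eq_of_smul_sub_eq_zero qThree_ne_zero
  have e₁ := congrArg (x₁ * ·) h.x₂a
  have e₂ := congrArg (· * a) h.x₁x₂
  have e₃ := congrArg (a * ·) h.x₁x₂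
  have e₄ := congrArg (· * x₁) h.x₂a
  have e₅ := congrArg (x₂ * ·) h.x₁a
  have e₆ := congrArg (· * x₂) h.x₁a
  linear_combination (norm := skip) (-1 : K) • e₁ + (1 : K) • e₂ - (1 : K) • e₃ +
    (1 : K) • e₄ + q⁻¹ • e₅ - q⁻¹ • e₆
  simp only [mul_add, add_mul, smul_mul_assoc, mul_smul_comm, mul_assoc]
  match_scalars <;> field_simp <;> ring

lemma x₃₂a_x₁x₃ (h : IsRootFamily a b x₁ x₂ x₃ x₃₂) :
    x₃₂ * a = a * x₃₂ + (q⁻¹ ^ 2 - 1) • (x₂ * x₂) ∧ x₁ * x₃ = x₃ * x₁ + (q⁻¹ ^ 2 - 1) •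
      (x₂ * x₂) := by
  have hq := q_ne_zero
  have key : x₃₂ * a = a * x₃₂ + (q⁻¹ ^ 2 - 1) • (x₂ * x₂) := by
    apply eq_of_smul_sub_eq_zero qTwo_ne_zero
    have e₁ := congrArg (b * ·) h.x₃a
    linear_combination (norm := skip) (-1 : K) • e₁
    simp only [mul_add, add_mul, mul_sub, sub_mul, smul_mul_assoc, mul_smul_comm, mul_assoc, h.ba,
      h.x₁a, h.x₂a, h.bx₃, h.x₁x₃_aux, mul_mul_of_mul_eq h.ba, mul_mul_of_mul_eq h.bx₃,
      mul_mul_of_mul_eq h.x₂a, mul_mul_of_mul_eq h.x₃a]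
    match_scalars <;> field_simp <;> ring
  exact ⟨key, by rw [h.x₁x₃_aux, key]; abel⟩

lemma x₂x₃ (h : IsRootFamily a b x₁ x₂ x₃ x₃₂) : x₂ * x₃ = q⁻¹ ^ 3 • (x₃ * x₂) := by
  have hq := q_ne_zero
  have hc : q * (q ^ 4 + 1) ≠ 0 := mul_ne_zero hq qPoly_ne_zero.2.2.2.1
  apply eq_of_smul_sub_eq_zero hc
  have e₁ := congrArg (· * x₃) h.x₁a
  have e₂ := congrArg (x₁ * ·) h.x₃a
  simp only [mul_assoc] at e₁ e₂
  linear_combination (norm := skip) (-1 : K) • e₁ - q ^ 3 • e₂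
  simp only [mul_add, add_mul, smul_mul_assoc, mul_smul_comm, mul_assoc, h.x₁a, h.x₂a,
    h.x₃₂a_x₁x₃.2, mul_mul_of_mul_eq h.x₃₂a_x₁x₃.2, mul_mul_of_mul_eq h.x₂a,
      mul_mul_of_mul_eq h.x₃a]
  match_scalars <;> field_simp <;> ring

lemma x₁x₃₂ (h : IsRootFamily a b x₁ x₂ x₃ x₃₂) : x₁ * x₃₂ = q⁻¹ ^ 3 • (x₃₂ * x₁) := by
  have hq := q_ne_zero
  have hc : q ^ 2 - 1 + q⁻¹ ^ 2 ≠ 0 := by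
    intro h
    apply qPoly_ne_zero.2.2.2.2.2
    field_simp at h
    linear_combination (q ^ 2 + 1) * h
  apply eq_of_smul_sub_eq_zero hc
  have e₁ := congrArg (b * ·) h.x₃₂a_x₁x₃.2
  linear_combination (norm := skip) (-1 : K) • e₁
  simp only [mul_add, add_mul, smul_mul_assoc, mul_smul_comm, mul_assoc, h.bx₁, h.bx₂, h.bx₃,
    h.x₁x₂, mul_mul_of_mul_eq h.bx₁, mul_mul_of_mul_eq h.bx₃, mul_mul_of_mul_eq h.bx₂,
    mul_mul_of_mul_eq h.x₁x₂, mul_mul_of_mul_eq h.x₃₂a_x₁x₃.2]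
  match_scalars <;> field_simp <;> ring

lemma x₃₂x₂ (h : IsRootFamily a b x₁ x₂ x₃ x₃₂) : x₃₂ * x₂ = q⁻¹ ^ 3 • (x₂ * x₃₂) := by
  have hq := q_ne_zero
  have hc : q * (q ^ 4 + 1) ≠ 0 := mul_ne_zero hq qPoly_ne_zero.2.2.2.1
  apply eq_of_smul_sub_eq_zero hc
  have e₁ := congrArg (x₃₂ * ·) h.x₁a
  have e₂ := congrArg (· * a) h.x₁x₃₂
  simp only [mul_assoc] at e₁ e₂
  linear_combination (norm := skip) (-1 : K) • e₁ - q ^ 3 • e₂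
  simp only [mul_add, add_mul, smul_mul_assoc, mul_smul_comm, mul_assoc, h.x₁x₃₂, h.x₃₂a_x₁x₃.1,
    h.x₁x₂, mul_mul_of_mul_eq h.x₁x₂, mul_mul_of_mul_eq h.x₃₂a_x₁x₃.1, mul_mul_of_mul_eq h.x₁a]
  match_scalars <;> field_simp <;> ring

end IsRootFamily

/-! ### Root vectors as iterated `q`-commutators -/

section Vectors

variable {A : Type*} [Ring A] [Algebra K A]

/-- The root vector of weight `α + β` built from `a`, `b` of weights `α = α₁`, `β = α₂`. -/
def rootAB (a b : A) : A := b * a - q ^ 3 • (a * b)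

/-- The root vector of weight `2α + β`. -/
def rootAAB (a b : A) : A := (q + q⁻¹)⁻¹ • (rootAB a b * a - q • (a * rootAB a b))

/-- The root vector of weight `3α + β`. -/
def rootAAAB (a b : A) : A :=
  (q ^ 2 + 1 + q⁻¹ ^ 2)⁻¹ • (rootAAB a b * a - q⁻¹ • (a * rootAAB a b))

/-- The root vector of weight `3α + 2β`. -/
def rootAAABB (a b : A) : A :=
  (q ^ 2 + 1 + q⁻¹ ^ 2)⁻¹ • (rootAB a b * rootAAB a b - q⁻¹ • (rootAAB a b * rootAB a b))

lemma map_rootAB {B : Type*} [Ring B] [Algebra K B] (f : A →ₐ[K] B) (a b : A) :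
    f (rootAB a b) = rootAB (f a) (f b) := by simp [rootAB]

lemma map_rootAAB {B : Type*} [Ring B] [Algebra K B] (f : A →ₐ[K] B) (a b : A) :
    f (rootAAB a b) = rootAAB (f a) (f b) := by simp [rootAAB, map_rootAB]

lemma map_rootAAAB {B : Type*} [Ring B] [Algebra K B] (f : A →ₐ[K] B) (a b : A) :
    f (rootAAAB a b) = rootAAAB (f a) (f b) := by simp [rootAAAB, map_rootAAB]

lemma map_rootAAABB {B : Type*} [Ring B] [Algebra K B] (f : A →ₐ[K] B) (a b : A) :
    f (rootAAABB a b) = rootAAABB (f a) (f b) := by simp [rootAAABB, map_rootAAB, map_rootAB]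

/-- The quantum Serre relations in terms of root vectors: the ends of the `α`-string through `β` and
of the `β`-string through `α` `q`-commute with the vectors of weight `α` and `β`. -/
lemma serre_iff_rootVec (f : Fin 2 → A) :
    (∀ i j, i ≠ j → serre i j (f i) (f j) = 0) ↔
      rootAAAB (f 0) (f 1) * f 0 = q⁻¹ ^ 3 • (f 0 * rootAAAB (f 0) (f 1)) ∧
      f 1 * rootAB (f 0) (f 1) = q⁻¹ ^ 3 • (rootAB (f 0) (f 1) * f 1) := by
  have hq := q_ne_zero
  have h2 := qTwo_ne_zero
  have h3 := qThree_ne_zero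
  have hx₂ : (q + q⁻¹) • rootAAB (f 0) (f 1) = rootAB (f 0) (f 1) * f 0 -
      q • (f 0 * rootAB (f 0) (f 1)) := smul_inv_smul₀ h2 _
  have hx₃ : (q ^ 2 + 1 + q⁻¹ ^ 2) • rootAAAB (f 0) (f 1) = rootAAB (f 0) (f 1) * f 0 -
      q⁻¹ • (f 0 * rootAAB (f 0) (f 1)) := smul_inv_smul₀ h3 _
  generalize hy₃ : rootAAAB (f 0) (f 1) = x₃ at *
  generalize hy₂ : rootAAB (f 0) (f 1) = x₂ at *
  have key₁ : ((q + q⁻¹) * (q ^ 2 + 1 + q⁻¹ ^ 2) * q ^ 4) • (x₃ * f 0 - q⁻¹ ^ 3 • (f 0 * x₃)) =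
      q ^ 4 • (f 0 * f 0 * f 0 * f 0 * f 1) - s3 • (f 0 * f 0 * f 0 * f 1 * f 0)
        + s2 • (f 0 * f 0 * f 1 * f 0 * f 0) - s3 • (f 0 * f 1 * f 0 * f 0 * f 0)
        + q ^ 4 • (f 1 * f 0 * f 0 * f 0 * f 0) := by
    have e₁ := congrArg (· * f 0) hx₃
    have e₂ := congrArg (f 0 * ·) hx₃
    have e₃ := congrArg (· * f 0 * f 0) hx₂
    have e₄ := congrArg (f 0 * · * f 0) hx₂
    have e₅ := congrArg (f 0 * f 0 * ·) hx₂
    linear_combination (norm := skip) ((q + q⁻¹) * q ^ 4) • e₁ - ((q + q⁻¹) * q) • e₂ +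
      q ^ 4 • e₃ - (q ^ 3 + q) • e₄ + (1 : K) • e₅
    simp only [rootAB, s3, s2, mul_sub, sub_mul, smul_mul_assoc, mul_smul_comm, mul_assoc]
    match_scalars <;> field_simp <;> ring
  have key₂ : q ^ 3 • (f 1 * rootAB (f 0) (f 1) - q⁻¹ ^ 3 • (rootAB (f 0) (f 1) * f 1)) =
      q ^ 3 • (f 1 * f 1 * f 0) - s1 • (f 1 * f 0 * f 1) + q ^ 3 • (f 0 * f 1 * f 1) := by
    simp only [rootAB, mul_sub, sub_mul, smul_mul_assoc, mul_smul_comm, mul_assoc, s1]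
    match_scalars <;> field_simp <;> ring
  rw [serre_iff, ← key₁, ← key₂, smul_eq_zero_iff_right
    (mul_ne_zero (mul_ne_zero h2 h3) (pow_ne_zero 4 hq)),
    smul_eq_zero_iff_right (pow_ne_zero 3 hq), sub_eq_zero, sub_eq_zero]

lemma isRootFamily_of_serre {a b : A}
    (h₁ : rootAAAB a b * a = q⁻¹ ^ 3 • (a * rootAAAB a b))
    (h₂ : b * rootAB a b = q⁻¹ ^ 3 • (rootAB a b * b)) :
    IsRootFamily a b (rootAB a b) (rootAAB a b) (rootAAAB a b) (rootAAABB a b) where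
  ba := by rw [rootAB]; abel
  x₁a := by rw [rootAAB, smul_inv_smul₀ qTwo_ne_zero]; abel
  x₂a := by rw [rootAAAB, smul_inv_smul₀ qThree_ne_zero]; abel
  x₁x₂ := by rw [rootAAABB, smul_inv_smul₀ qThree_ne_zero]; abel
  x₃a := h₁
  bx₁ := h₂

end Vectors

/-- The root vectors of `U_q(𝔫)`, in the convex order
`α₁ < 3α₁ + α₂ < 2α₁ + α₂ < 3α₁ + 2α₂ < α₁ + α₂ < α₂`. -/
def rootVec : Fin 6 → Un :=
  ![e 0, rootAAAB (e 0) (e 1), rootAAB (e 0) (e 1), rootAAABB (e 0) (e 1), rootAB (e 0) (e 1), e 1]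

lemma isRootFamily_rootVec : IsRootFamily (e 0) (e 1) (rootAB (e 0) (e 1)) (rootAAB (e 0) (e 1))
    (rootAAAB (e 0) (e 1)) (rootAAABB (e 0) (e 1)) := by
  obtain ⟨h₁, h₂⟩ := (serre_iff_rootVec e).mp serre_e
  exact isRootFamily_of_serre h₁ h₂

/-! ### The root vectors as images under the braid group action -/

section Rel

lemma ug_K_Kinv (i : Fin 2) : ug (.K i) * ug (.Kinv i) = 1 := by
  simpa [ug] using RingQuot.mkAlgHom_rel K (UgRel.K_Kinv i)

lemma ug_Kinv_K (i : Fin 2) : ug (.Kinv i) * ug (.K i) = 1 := by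
  simpa [ug] using RingQuot.mkAlgHom_rel K (UgRel.Kinv_K i)

lemma ug_K_E (i j : Fin 2) : ug (.K i) * ug (.E j) = q ^ ip i j • (ug (.E j) * ug (.K i)) := by
  simpa [ug] using RingQuot.mkAlgHom_rel K (UgRel.K_E i j)

lemma ug_E_F (i : Fin 2) : ug (.E i) * ug (.F i) - ug (.F i) * ug (.E i) =
    (qi i - (qi i)⁻¹)⁻¹ • (ug (.K i) - ug (.Kinv i)) := by
  simpa [ug] using RingQuot.mkAlgHom_rel K (UgRel.E_F i)

lemma ug_E_F_ne (i j : Fin 2) (h : i ≠ j) : ug (.E i) * ug (.F j) = ug (.F j) * ug (.E i) := by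
  simpa [ug] using RingQuot.mkAlgHom_rel K (UgRel.E_F_ne i j h)

end Rel

lemma q_sub_inv_ne_zero : q - q⁻¹ ≠ 0 := by
  have hq := q_ne_zero
  intro h
  apply qPoly_ne_zero.1
  field_simp at h
  linear_combination h

lemma q_cube_sub_inv_ne_zero : q ^ 3 - q⁻¹ ^ 3 ≠ 0 := by
  have hq := q_ne_zero
  intro h
  apply qPoly_ne_zero.2.2.2.2.1
  field_simp at h
  linear_combination h

section

variable {A : Type*} [Ring A] [Algebra K A]

/-- The root vector of weight `α + β` with the order of multiplication reversed. -/
def coAB (a b : A) : A := a * b - q ^ 3 • (b * a)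

/-- The root vector of weight `2α + β` with the order of multiplication reversed. -/
def coAAB (a b : A) : A := (q + q⁻¹)⁻¹ • (a * coAB a b - q • (coAB a b * a))

/-- The root vector of weight `3α + β` with the order of multiplication reversed. -/
def coAAAB (a b : A) : A := (q ^ 2 + 1 + q⁻¹ ^ 2)⁻¹ • (a * coAAB a b - q⁻¹ • (coAAB a b * a))

/-- The root vector of weight `3α + 2β` with the order of multiplication reversed. -/
def coAAABB (a b : A) : A :=
  (q ^ 2 + 1 + q⁻¹ ^ 2)⁻¹ • (coAAB a b * coAB a b - q⁻¹ • (coAB a b * coAAB a b))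

lemma mul_eq_of_cartan {k k' x : A} {c : K} (hc : c ≠ 0) (h : k * k' = 1) (h' : k' * k = 1)
    (hx : k * x = c • (x * k)) : x * k' = c • (k' * x) := by
  have := congrArg (fun y => k' * y * k') hx
  simpa [mul_assoc, h, mul_mul_of_mul_eq h'] using this

lemma comm_of_comm_sub {x F z : A} (h : x * F - F * x = z) : x * F = F * x + z := by
  rw [← h]; abel

/-- Action of `F` on the `α`-string through `β`: up to a Cartan factor, `F` lowers the root vectors
of weight `jα + β`. -/
lemma lower_string {a b F k k' : A} (h : k * k' = 1) (h' : k' * k = 1)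
    (ha : k * a = q ^ 2 • (a * k)) (hb : k * b = q⁻¹ ^ 3 • (b * k))
    (haF : a * F - F * a = (q - q⁻¹)⁻¹ • (k - k')) (hbF : b * F = F * b) :
    (k * rootAB a b = q⁻¹ • (rootAB a b * k) ∧ k * rootAAB a b = q • (rootAAB a b * k) ∧
      k * rootAAAB a b = q ^ 3 • (rootAAAB a b * k)) ∧
    rootAB a b * F - F * rootAB a b = (q ^ 2 + 1 + q⁻¹ ^ 2) • (k' * b) ∧
      rootAAB a b * F - F * rootAAB a b = (q + q⁻¹) • (k' * rootAB a b) ∧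
      rootAAAB a b * F - F * rootAAAB a b = k' * rootAAB a b := by
  have hq := q_ne_zero
  have h1 := q_sub_inv_ne_zero
  have h2 := qTwo_ne_zero
  have h3 := qThree_ne_zero
  have ha' := mul_eq_of_cartan (pow_ne_zero 2 hq) h h' ha
  have hb' := mul_eq_of_cartan (pow_ne_zero 3 (inv_ne_zero hq)) h h' hb
  have haF' := comm_of_comm_sub haF
  have k1 : k * rootAB a b = q⁻¹ • (rootAB a b * k) := by
    simp only [rootAB, mul_sub, sub_mul, smul_mul_assoc, mul_smul_comm, mul_assoc, ha, hb,
      mul_mul_of_mul_eq ha, mul_mul_of_mul_eq hb]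
    match_scalars <;> field_simp
  have k2 : k * rootAAB a b = q • (rootAAB a b * k) := by
    simp only [rootAAB, mul_sub, sub_mul, smul_mul_assoc, mul_smul_comm, mul_assoc, ha, k1,
      mul_mul_of_mul_eq ha, mul_mul_of_mul_eq k1]
    match_scalars <;> field_simp
  have k3 : k * rootAAAB a b = q ^ 3 • (rootAAAB a b * k) := by
    simp only [rootAAAB, mul_sub, sub_mul, smul_mul_assoc, mul_smul_comm, mul_assoc, ha, k2,
      mul_mul_of_mul_eq ha, mul_mul_of_mul_eq k2]
    match_scalars <;> field_simp
  have k1' := mul_eq_of_cartan (inv_ne_zero hq) h h' k1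
  have k2' := mul_eq_of_cartan hq h h' k2
  have hF : (q - q⁻¹) • (a * F - F * a) = k - k' := by rw [haF, smul_inv_smul₀ h1]
  have F1 : rootAB a b * F - F * rootAB a b = (q ^ 2 + 1 + q⁻¹ ^ 2) • (k' * b) := by
    apply eq_of_smul_sub_eq_zero h1
    have e₁ := congrArg (b * ·) hF
    have e₂ := congrArg (· * b) hF
    linear_combination (norm := skip) e₁ - q ^ 3 • e₂
    simp only [rootAB, mul_sub, sub_mul, smul_mul_assoc, mul_smul_comm, mul_assoc, hbF, hb, hb',
      mul_mul_of_mul_eq hbF]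
    match_scalars <;> field_simp <;> ring
  have F2 : rootAAB a b * F - F * rootAAB a b = (q + q⁻¹) • (k' * rootAB a b) := by
    apply eq_of_smul_sub_eq_zero (mul_ne_zero h2 h1)
    have e₁ := congrArg (rootAB a b * ·) hF
    have e₂ := congrArg (· * rootAB a b) hF
    have e₃ := congrArg (· * a) F1
    have e₄ := congrArg (a * ·) F1
    have e₅ : (q + q⁻¹) • rootAAB a b = _ := smul_inv_smul₀ h2 _
    have e₆ := congrArg (· * F) e₅
    have e₇ := congrArg (F * ·) e₅
    linear_combination (norm := skip) (q - q⁻¹) • e₆ - (q - q⁻¹) • e₇ + e₁ - q • e₂ +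
      (q - q⁻¹) • e₃ - (q * (q - q⁻¹)) • e₄
    simp only [mul_sub, sub_mul, smul_mul_assoc, mul_smul_comm, mul_assoc, k1, k1', ha',
      mul_mul_of_mul_eq ha']
    have e₈ : rootAB a b = b * a - q ^ 3 • (a * b) := rfl
    have e₉ := congrArg (k' * ·) e₈
    linear_combination (norm := skip) (-(q - q⁻¹) * (q ^ 2 + 1 + q⁻¹ ^ 2)) • e₉
    simp only [mul_sub, mul_smul_comm]
    match_scalars <;> field_simp <;> ring
  have F3 : rootAAAB a b * F - F * rootAAAB a b = k' * rootAAB a b := by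
    apply eq_of_smul_sub_eq_zero (mul_ne_zero h3 h1)
    have e₁ := congrArg (rootAAB a b * ·) hF
    have e₂ := congrArg (· * rootAAB a b) hF
    have e₃ := congrArg (· * a) F2
    have e₄ := congrArg (a * ·) F2
    have e₅ : (q ^ 2 + 1 + q⁻¹ ^ 2) • rootAAAB a b = _ := smul_inv_smul₀ h3 _
    have e₆ := congrArg (· * F) e₅
    have e₇ := congrArg (F * ·) e₅
    linear_combination (norm := skip) (q - q⁻¹) • e₆ - (q - q⁻¹) • e₇ + e₁ - q⁻¹ • e₂ +
      (q - q⁻¹) • e₃ - (q⁻¹ * (q - q⁻¹)) • e₄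
    simp only [mul_sub, sub_mul, smul_mul_assoc, mul_smul_comm, mul_assoc, k2, k2', ha',
      mul_mul_of_mul_eq ha']
    have e₈ : (q + q⁻¹) • rootAAB a b = _ := smul_inv_smul₀ h2 _
    have e₉ := congrArg (k' * ·) e₈
    linear_combination (norm := skip) (-(q - q⁻¹) * (q + q⁻¹)) • e₉
    simp only [mul_sub, mul_smul_comm]
    match_scalars <;> field_simp <;> ring
  exact ⟨⟨k1, k2, k3⟩, F1, F2, F3⟩

/-- Action of `F` on the `β`-string through `α`. -/
lemma lower_coAB {a b F k k' : A} (h : k * k' = 1) (h' : k' * k = 1)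
    (ha : k * a = q⁻¹ ^ 3 • (a * k)) (hb : k * b = q ^ 6 • (b * k))
    (hbF : b * F - F * b = (q ^ 3 - q⁻¹ ^ 3)⁻¹ • (k - k')) (haF : a * F = F * a) :
    k * coAB a b = q ^ 3 • (coAB a b * k) ∧ coAB a b * F - F * coAB a b = k' * a := by
  have hq := q_ne_zero
  have h1 := q_cube_sub_inv_ne_zero
  have ha' := mul_eq_of_cartan (pow_ne_zero 3 (inv_ne_zero hq)) h h' ha
  have hF : (q ^ 3 - q⁻¹ ^ 3) • (b * F - F * b) = k - k' := by rw [hbF, smul_inv_smul₀ h1]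
  constructor
  · simp only [coAB, mul_sub, sub_mul, smul_mul_assoc, mul_smul_comm, mul_assoc, ha, hb,
      mul_mul_of_mul_eq ha, mul_mul_of_mul_eq hb]
    match_scalars <;> field_simp
  · apply eq_of_smul_sub_eq_zero h1
    have e₁ := congrArg (a * ·) hF
    have e₂ := congrArg (· * a) hF
    linear_combination (norm := skip) e₁ - q ^ 3 • e₂
    simp only [coAB, mul_sub, sub_mul, smul_mul_assoc, mul_smul_comm, mul_assoc, haF, ha, ha',
      mul_mul_of_mul_eq haF]
    match_scalars <;> field_simp <;> ring

end

lemma braidGen_zero : braidGen 0 (.E 0) = (-1 : K) • (ug (.K 0) * ug (.F 0)) ∧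
    braidGen 0 (.E 1) = rootAAAB (ug (.E 0)) (ug (.E 1)) := by
  obtain ⟨h2, h2', h3, h4, h6, h6'⟩ := qPoly_ne_zero
  obtain ⟨v1, v2, v3, v4, -, -⟩ := qInt_vals
  have hq := q_ne_zero
  have hn : (-cartan 0 1).toNat = 3 := by simp [cartan]
  have e0 : qi 0 = q := by simp [qi, dd]
  refine ⟨?_, ?_⟩
  · have h : braidGen 0 (.E 0) = -(ug (.K 0) * ug (.F 0)) := by simp [braidGen]
    exact h.trans (neg_one_smul K (ug (.K 0) * ug (.F 0))).symm
  have w2 : (q + q⁻¹)⁻¹ = q / (q ^ 2 + 1) := by field_simp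
  have w3 : (q ^ 2 + 1 + q⁻¹ ^ 2)⁻¹ = q ^ 2 / (q ^ 4 + q ^ 2 + 1) := by
    rw [← inv_div]
    congr 1
    field_simp
  have h3' : q ^ 2 * (q ^ 2 + 1) + 1 ≠ 0 := fun h => h3 (by linear_combination h)
  simp only [braidGen, hn, e0, Finset.sum_range_succ, Finset.sum_range_zero, divPow, qFact,
    Finset.prod_range_succ, Finset.prod_range_zero, v1, v2, v3, zero_add, one_mul, Nat.reduceAdd,
    Nat.reduceSub, pow_succ (_ : Ug), pow_zero, smul_mul_assoc, mul_smul_comm, mul_one, mul_assoc,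
    rootAAAB, rootAAB, rootAB, mul_sub, sub_mul, one_ne_zero, if_false, w2, w3]
  match_scalars <;> field_simp <;> ring

lemma braidGen_one : braidGen 1 (.E 1) = (-1 : K) • (ug (.K 1) * ug (.F 1)) ∧
    braidGen 1 (.E 0) = coAB (ug (.E 0)) (ug (.E 1)) := by
  have hn : (-cartan 1 0).toNat = 1 := by simp [cartan]
  have e1 : qi 1 = q ^ 3 := by simp [qi, dd]
  obtain ⟨-, -, -, -, v1, v2⟩ := qInt_vals
  refine ⟨?_, ?_⟩
  · have h : braidGen 1 (.E 1) = -(ug (.K 1) * ug (.F 1)) := by simp [braidGen]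
    exact h.trans (neg_one_smul K (ug (.K 1) * ug (.F 1))).symm
  simp only [braidGen, hn, e1, Finset.sum_range_succ, Finset.sum_range_zero, divPow, qFact,
    Finset.prod_range_succ, Finset.prod_range_zero, v1, zero_add, one_mul,
    Nat.sub_zero, Nat.sub_self, pow_zero, pow_one, smul_mul_assoc, mul_smul_comm, mul_one,
      mul_assoc,
    coAB, zero_ne_one, if_false, inv_one, one_smul]
  module

section Braid

lemma braidGen_mem (i : Fin 2) (g : Gen) : (ug g, braidGen i g) ∈ braidGraph i :=
  Algebra.subset_adjoin ⟨g, rfl⟩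

/-- A subalgebra of `Ug × Ug` is closed under scaled `q`-commutators, taken in both components. -/
lemma comm_mem {S : Subalgebra K (Ug × Ug)} {x y x' y' : Ug} (hx : (x, x') ∈ S) (hy : (y, y') ∈ S)
    (c d : K) : (c • (x * y - d • (y * x)), c • (x' * y' - d • (y' * x'))) ∈ S :=
  S.smul_mem (S.sub_mem (S.mul_mem hx hy) (S.smul_mem (S.mul_mem hy hx) d)) c

lemma comm_mem' {S : Subalgebra K (Ug × Ug)} {x y x' y' : Ug} (hx : (x, x') ∈ S) (hy : (y, y') ∈ S)
    (d : K) : (x * y - d • (y * x), x' * y' - d • (y' * x')) ∈ S := by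
  simpa using comm_mem hx hy 1 d

/-- The automorphism `T₁` (`braidGraph 0`) reverses the `α₁`-string through `α₂`: it sends the
vectors formed with the reversed multiplication to the root vectors of the reflected weights. Indeed
it replaces `E₁` by `-K₁ F₁`, and `F₁` lowers the root vectors. -/
lemma braidGraph_zero : (ug (.E 1), rootAAAB (ug (.E 0)) (ug (.E 1))) ∈ braidGraph 0 ∧
    (coAB (ug (.E 0)) (ug (.E 1)), rootAAB (ug (.E 0)) (ug (.E 1))) ∈ braidGraph 0 ∧
    (coAAB (ug (.E 0)) (ug (.E 1)), rootAB (ug (.E 0)) (ug (.E 1))) ∈ braidGraph 0 ∧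
    (coAAAB (ug (.E 0)) (ug (.E 1)), ug (.E 1)) ∈ braidGraph 0 ∧
    (coAAABB (ug (.E 0)) (ug (.E 1)), rootAAABB (ug (.E 0)) (ug (.E 1))) ∈ braidGraph 0 := by
  have hq := q_ne_zero
  obtain ⟨⟨k1, k2, k3⟩, F1, F2, F3⟩ := lower_string (ug_K_Kinv 0) (ug_Kinv_K 0)
    (by simpa [ip] using ug_K_E 0 0) (by simpa [ip] using ug_K_E 0 1)
    (by simpa [qi, dd] using ug_E_F 0) (ug_E_F_ne 1 0 (by decide))
  have hk := ug_K_Kinv 0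
  have h0 : (ug (.E 0), (-1 : K) • (ug (.K 0) * ug (.F 0))) ∈ braidGraph 0 := by
    rw [← braidGen_zero.1]; exact braidGen_mem 0 (.E 0)
  have h1 : (ug (.E 1), rootAAAB (ug (.E 0)) (ug (.E 1))) ∈ braidGraph 0 := by
    rw [← braidGen_zero.2]; exact braidGen_mem 0 (.E 1)
  have hstr : ∀ {x y : Ug} {c d : K}, ug (.K 0) * x = c • (x * ug (.K 0)) →
      x * ug (.F 0) - ug (.F 0) * x = d • (ug (.Kinv 0) * y) →
      ((-1 : K) • (ug (.K 0) * ug (.F 0))) * x -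
        c • (x * ((-1 : K) • (ug (.K 0) * ug (.F 0)))) = d • y := by
    intro x y c d hx hF
    have e₁ := congrArg (ug (.K 0) * ·) hF
    have e₂ := congrArg (· * ug (.F 0)) hx
    linear_combination (norm := skip) e₁ - e₂
    simp only [mul_sub, mul_smul_comm, smul_mul_assoc, mul_assoc, mul_mul_of_mul_eq hk, one_mul,
      mul_neg, neg_mul]
    module
  have h2 : (coAB (ug (.E 0)) (ug (.E 1)), rootAAB (ug (.E 0)) (ug (.E 1))) ∈ braidGraph 0 := by
    have := comm_mem' h0 h1 (q ^ 3)
    rwa [hstr k3 (by rw [F3, one_smul]), one_smul] at this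
  have h3 : (coAAB (ug (.E 0)) (ug (.E 1)), rootAB (ug (.E 0)) (ug (.E 1))) ∈ braidGraph 0 := by
    have := comm_mem h0 h2 (q + q⁻¹)⁻¹ q
    rwa [hstr k2 F2, inv_smul_smul₀ qTwo_ne_zero] at this
  have h4 : (coAAAB (ug (.E 0)) (ug (.E 1)), ug (.E 1)) ∈ braidGraph 0 := by
    have := comm_mem h0 h3 (q ^ 2 + 1 + q⁻¹ ^ 2)⁻¹ q⁻¹
    rwa [hstr k1 F1, inv_smul_smul₀ qThree_ne_zero] at this
  exact ⟨h1, h2, h3, h4, comm_mem h3 h2 _ _⟩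

/-- The automorphism `T₂` (`braidGraph 1`) sends the root vectors to the vectors formed with the
reversed multiplication, of the reflected weights. -/
lemma braidGraph_one : (ug (.E 0), coAB (ug (.E 0)) (ug (.E 1))) ∈ braidGraph 1 ∧
    (rootAB (ug (.E 0)) (ug (.E 1)), ug (.E 0)) ∈ braidGraph 1 ∧
    (rootAAB (ug (.E 0)) (ug (.E 1)), coAAB (ug (.E 0)) (ug (.E 1))) ∈ braidGraph 1 ∧
    (rootAAAB (ug (.E 0)) (ug (.E 1)), coAAABB (ug (.E 0)) (ug (.E 1))) ∈ braidGraph 1 ∧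
    (rootAAABB (ug (.E 0)) (ug (.E 1)), coAAAB (ug (.E 0)) (ug (.E 1))) ∈ braidGraph 1 := by
  obtain ⟨k1, F1⟩ := lower_coAB (ug_K_Kinv 1) (ug_Kinv_K 1)
    (by simpa [ip] using ug_K_E 1 0) (by simpa [ip] using ug_K_E 1 1)
    (by simpa [qi, dd] using ug_E_F 1) (ug_E_F_ne 0 1 (by decide))
  have hk := ug_K_Kinv 1
  have h1 : (ug (.E 1), (-1 : K) • (ug (.K 1) * ug (.F 1))) ∈ braidGraph 1 := by
    rw [← braidGen_one.1]; exact braidGen_mem 1 (.E 1)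
  have h0 : (ug (.E 0), coAB (ug (.E 0)) (ug (.E 1))) ∈ braidGraph 1 := by
    rw [← braidGen_one.2]; exact braidGen_mem 1 (.E 0)
  have h2 : (rootAB (ug (.E 0)) (ug (.E 1)), ug (.E 0)) ∈ braidGraph 1 := by
    have := comm_mem' h1 h0 (q ^ 3)
    have e₁ := congrArg (ug (.K 1) * ·) F1
    have e₂ := congrArg (· * ug (.F 1)) k1
    have e₃ : ((-1 : K) • (ug (.K 1) * ug (.F 1))) * coAB (ug (.E 0)) (ug (.E 1)) -
        q ^ 3 • (coAB (ug (.E 0)) (ug (.E 1)) * ((-1 : K) • (ug (.K 1) * ug (.F 1)))) =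
        ug (.E 0) := by
      linear_combination (norm := skip) e₁ - e₂
      simp only [mul_sub, mul_smul_comm, smul_mul_assoc, mul_assoc, mul_mul_of_mul_eq hk, one_mul]
      module
    rwa [e₃] at this
  have h3 := comm_mem h2 h0 (q + q⁻¹)⁻¹ q
  exact ⟨h0, h2, h3, comm_mem h3 h0 _ _, comm_mem h2 h3 _ _⟩

/-- The vectors `rootVec` are the images of the generators under the braid group action. -/
theorem isRootVectors_rootVec : IsRootVectors rootVec := by
  obtain ⟨z1, z2, z3, z4, z5⟩ := braidGraph_zero
  obtain ⟨o1, o2, o3, o4, o5⟩ := braidGraph_one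
  have i0 : incl (e 0) = ug (.E 0) := Un.lift_e _ _ 0
  have i1 : incl (e 1) = ug (.E 1) := Un.lift_e _ _ 1
  intro k
  fin_cases k
  · simpa [IsBraidImage, rootVec, redWord] using i0
  · simpa [IsBraidImage, rootVec, redWord, map_rootAAAB, i0, i1] using z1
  · simpa [IsBraidImage, rootVec, redWord, map_rootAAB, i0, i1] using ⟨_, o1, z2⟩
  · simpa [IsBraidImage, rootVec, redWord, map_rootAAABB, i0, i1] using ⟨_, ⟨_, z1, o4⟩, z5⟩
  · simpa [IsBraidImage, rootVec, redWord, map_rootAB, i0, i1] using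
      ⟨_, ⟨_, ⟨_, o1, z2⟩, o3⟩, z3⟩
  · simpa [IsBraidImage, rootVec, redWord, i0, i1] using
      ⟨_, ⟨_, ⟨_, ⟨_, z1, o4⟩, z5⟩, o5⟩, z4⟩

end Braid

/-! ### Ordered monomials: spanning and triangularity -/

section Monomial

variable {U : Type*} [Ring U] [Algebra K U]

/-- The ordered monomial `E₀^{m₀} ⋯ E_{k-1}^{m_{k-1}}`. -/
def ordMon (E : ℕ → U) (m : ℕ → ℕ) : ℕ → U
  | 0 => 1
  | k + 1 => ordMon E m k * E k ^ m k

lemma ordMon_congr (E : ℕ → U) {m m' : ℕ → ℕ} {k : ℕ} (h : ∀ i < k, m i = m' i) :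
    ordMon E m k = ordMon E m' k := by
  induction k with
  | zero => rfl
  | succ k ih => rw [ordMon, ordMon, ih fun i hi => h i (by omega), h k (by omega)]

lemma ordMon_eq_one (E : ℕ → U) {m : ℕ → ℕ} {k : ℕ} (h : ∀ i < k, m i = 0) : ordMon E m k = 1 := by
  induction k with
  | zero => rfl
  | succ k ih => rw [ordMon, ih fun i hi => h i (by omega), h k (by omega), pow_zero, mul_one]

/-- An ordered prefix, a power of `E k` and an ordered suffix multiply to an ordered monomial. -/
lemma ordMon_mul_ordMon (E : ℕ → U) (m₁ m₂ : ℕ → ℕ) (a k n : ℕ) (hk : k < n)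
    (h : ∀ i < k, m₂ i = 0) : ordMon E m₁ k * E k ^ a * ordMon E m₂ n =
      ordMon E (fun i => if i < k then m₁ i else if i = k then a + m₂ i else m₂ i) n := by
  induction n with
  | zero => omega
  | succ n ih =>
    rcases Nat.lt_succ_iff_lt_or_eq.mp hk with hk' | rfl
    · rw [ordMon, ordMon, ← mul_assoc, ih hk', if_neg (by omega), if_neg (by omega)]
    · rw [ordMon, ordMon, ordMon_eq_one E h, one_mul, if_neg (by omega), if_pos rfl, mul_assoc,
        ← pow_add]
      congr 1
      exact ordMon_congr E fun i hi => (if_pos hi).symm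

/-- The right ideal generated by `E₀, …, E_{k-1}`. -/
def rightIdeal (E : ℕ → U) (k : ℕ) : Submodule K U :=
  Submodule.span K {x | ∃ i < k, ∃ u, x = E i * u}

/-- The degree `n` part of `rightIdeal E k` for a grading `D` in which `E i` has degree `ℓ i`. -/
def rightIdealDeg (D : ℕ → Submodule K U) (E : ℕ → U) (ℓ : ℕ → ℕ) (k n : ℕ) : Submodule K U :=
  Submodule.span K {x | ∃ i < k, ∃ j, ∃ u ∈ D j, ℓ i + j = n ∧ x = E i * u}

/-- The span of the ordered monomials in `E_k, …, E_{n-1}`. -/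
def suffixSpan (E : ℕ → U) (n k : ℕ) : Submodule K U :=
  Submodule.span K {x | ∃ m : ℕ → ℕ, (∀ i < k, m i = 0) ∧ x = ordMon E m n}

/-- The span of the ordered monomials with exponent lexicographically larger than `m`. -/
def lexSpan (E : ℕ → U) (n : ℕ) (m : ℕ → ℕ) : Submodule K U :=
  Submodule.span K {x | ∃ m' : ℕ → ℕ, (∃ i < n, (∀ j < i, m' j = m j) ∧ m i < m' i) ∧
    x = ordMon E m' n}

/-- The right ideal `∑_{i < k} E₀^{m₀} ⋯ E_{i-1}^{m_{i-1}} E_i^{m_i + 1} U`. -/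
def lexIdeal (E : ℕ → U) (m : ℕ → ℕ) (k : ℕ) : Submodule K U :=
  Submodule.span K {x | ∃ i < k, ∃ u, x = ordMon E m i * E i ^ (m i + 1) * u}

lemma span_mul_mem {S : Set U} {N : Submodule K U} (y : U) (h : ∀ x ∈ S, x * y ∈ N) {x : U}
    (hx : x ∈ Submodule.span K S) : x * y ∈ N :=
  (Submodule.span_le (p := N.comap (LinearMap.mulRight K y))).mpr h hx

lemma mul_span_mem {S : Set U} {N : Submodule K U} (y : U) (h : ∀ x ∈ S, y * x ∈ N) {x : U}
    (hx : x ∈ Submodule.span K S) : y * x ∈ N :=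
  (Submodule.span_le (p := N.comap (LinearMap.mulLeft K y))).mpr h hx

variable {E : ℕ → U}

lemma mul_mem_rightIdeal {k i : ℕ} (hi : i < k) (u : U) : E i * u ∈ rightIdeal E k :=
  Submodule.subset_span ⟨i, hi, u, rfl⟩

lemma rightIdeal_mul_mem {k : ℕ} {x : U} (hx : x ∈ rightIdeal E k) (y : U) :
    x * y ∈ rightIdeal E k := by
  refine span_mul_mem y ?_ hx
  rintro _ ⟨i, hi, u, rfl⟩
  rw [mul_assoc]
  exact mul_mem_rightIdeal hi _

lemma lexIdeal_mul_mem {m : ℕ → ℕ} {k : ℕ} {x : U} (hx : x ∈ lexIdeal E m k) (y : U) :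
    x * y ∈ lexIdeal E m k := by
  refine span_mul_mem y ?_ hx
  rintro _ ⟨i, hi, u, rfl⟩
  rw [mul_assoc]
  exact Submodule.subset_span ⟨i, hi, _, rfl⟩

lemma lexIdeal_mono {m : ℕ → ℕ} {k k' : ℕ} (h : k ≤ k') : lexIdeal E m k ≤ lexIdeal E m k' :=
  Submodule.span_mono fun _ ⟨i, hi, hu⟩ => ⟨i, by omega, hu⟩

lemma suffixSpan_anti {n k k' : ℕ} (h : k ≤ k') : suffixSpan E n k' ≤ suffixSpan E n k :=
  Submodule.span_mono fun _ ⟨m, hm, hu⟩ => ⟨m, fun i hi => hm i (by omega), hu⟩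

lemma mul_suffixSpan_mem {n k : ℕ} (hk : k < n) {x : U} (hx : x ∈ suffixSpan E n k) :
    E k * x ∈ suffixSpan E n k := by
  refine mul_span_mem _ ?_ hx
  rintro _ ⟨m, hm, rfl⟩
  have := ordMon_mul_ordMon E 0 m 1 k n hk hm
  rw [ordMon_eq_one E (m := 0) (k := k) (fun _ _ => rfl), one_mul, pow_one] at this
  rw [this]
  refine Submodule.subset_span ⟨_, fun i hi => ?_, rfl⟩
  simp [hi]

/-- Data making the ordered monomials in `E₀, …, E_{n-1}` span `U`: a grading `D`, and the
condition that the right ideal of the first `k` vectors is stable under left multiplication by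
`E k`. -/
structure IsConvexFamily (D : ℕ → Submodule K U) (E : ℕ → U) (ℓ : ℕ → ℕ) (n : ℕ) : Prop where
  mul_mem : ∀ {i j x y}, x ∈ D i → y ∈ D j → x * y ∈ D (i + j)
  pos : ∀ k < n, 0 < ℓ k
  zero_le : D 0 ≤ 1
  succ_le : ∀ j, D (j + 1) ≤ rightIdealDeg D E ℓ n (j + 1)
  iSup_eq_top : ⨆ j, D j = ⊤
  mul_mem_rightIdealDeg : ∀ k < n, ∀ i < k, E k * E i ∈ rightIdealDeg D E ℓ k (ℓ k + ℓ i)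

lemma rightIdealDeg_le (D : ℕ → Submodule K U) (ℓ : ℕ → ℕ) (k n : ℕ) :
    rightIdealDeg D E ℓ k n ≤ rightIdeal E k :=
  Submodule.span_mono fun _ ⟨i, hi, _, u, _, _, hx⟩ => ⟨i, hi, u, hx⟩

lemma rightIdealDeg_mul_mem {D : ℕ → Submodule K U} {ℓ : ℕ → ℕ}
    (hD : ∀ {i j x y}, x ∈ D i → y ∈ D j → x * y ∈ D (i + j)) {k n j n' : ℕ} {x y : U}
    (hx : x ∈ rightIdealDeg D E ℓ k n) (hy : y ∈ D j) (hn : n + j = n') :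
    x * y ∈ rightIdealDeg D E ℓ k n' := by
  refine span_mul_mem y ?_ hx
  rintro _ ⟨i, hi, j', u, hu, rfl, rfl⟩
  rw [mul_assoc]
  exact Submodule.subset_span ⟨i, hi, _, _, hD hu hy, by rw [← hn]; ring, rfl⟩

namespace IsConvexFamily

variable {D : ℕ → Submodule K U} {ℓ : ℕ → ℕ} {n : ℕ}

lemma mul_rightIdealDeg_mem (h : IsConvexFamily D E ℓ n) {k j : ℕ} (hk : k < n) {x : U}
    (hx : x ∈ rightIdealDeg D E ℓ k j) : E k * x ∈ rightIdealDeg D E ℓ k (ℓ k + j) := by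
  refine mul_span_mem _ ?_ hx
  rintro _ ⟨i, hi, j', u, hu, rfl, rfl⟩
  rw [← mul_assoc, ← add_assoc]
  exact rightIdealDeg_mul_mem h.mul_mem (h.mul_mem_rightIdealDeg k hk i hi) hu rfl

lemma mul_rightIdeal_mem (h : IsConvexFamily D E ℓ n) {k : ℕ} (hk : k < n) {x : U}
    (hx : x ∈ rightIdeal E k) : E k * x ∈ rightIdeal E k := by
  refine mul_span_mem _ ?_ hx
  rintro _ ⟨i, hi, u, rfl⟩
  rw [← mul_assoc]
  exact rightIdeal_mul_mem (rightIdealDeg_le _ _ _ _ (h.mul_mem_rightIdealDeg k hk i hi)) u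

lemma pow_mul_rightIdeal_mem (h : IsConvexFamily D E ℓ n) {k : ℕ} (hk : k < n) (a : ℕ) {x : U}
    (hx : x ∈ rightIdeal E k) : E k ^ a * x ∈ rightIdeal E k := by
  induction a with
  | zero => simpa using hx
  | succ a ih => rw [pow_succ', mul_assoc]; exact h.mul_rightIdeal_mem hk ih

/-- Every element of degree `j` is a combination of ordered monomials in `E_k, …, E_{n-1}` modulo
the right ideal of `E₀, …, E_{k-1}`. -/
lemma le_sup (h : IsConvexFamily D E ℓ n) {k : ℕ} (hk : k ≤ n) :
    ∀ j, D j ≤ rightIdealDeg D E ℓ k j ⊔ suffixSpan E n k := by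
  induction hk using Nat.decreasingInduction with
  | self =>
    rintro (_ | j)
    · refine le_sup_of_le_right (h.zero_le.trans ?_)
      rw [Submodule.one_le]
      exact Submodule.subset_span ⟨0, fun _ _ => rfl, (ordMon_eq_one E fun _ _ => rfl).symm⟩
    · exact le_sup_of_le_left (h.succ_le j)
  | of_succ k hk ih =>
    intro j
    induction j using Nat.strong_induction_on with
    | _ j ihj =>
      refine (ih j).trans (sup_le (Submodule.span_le.mpr ?_)
        (le_sup_of_le_right (suffixSpan_anti (by omega))))
      rintro _ ⟨i, hi, j', u, hu, rfl, rfl⟩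
      rcases Nat.lt_succ_iff_lt_or_eq.mp hi with hi' | rfl
      · exact Submodule.mem_sup_left (Submodule.subset_span ⟨i, hi', j', u, hu, rfl, rfl⟩)
      · obtain ⟨y, hy, s, hs, rfl⟩ := Submodule.mem_sup.mp
          (ihj j' (by have := h.pos i hk; omega) hu)
        rw [mul_add]
        exact Submodule.add_mem_sup (h.mul_rightIdealDeg_mem hk hy) (mul_suffixSpan_mem hk hs)

lemma sup_eq_top (h : IsConvexFamily D E ℓ n) {k : ℕ} (hk : k ≤ n) :
    rightIdeal E k ⊔ suffixSpan E n k = ⊤ := by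
  rw [eq_top_iff, ← h.iSup_eq_top]
  exact iSup_le fun j => (h.le_sup hk j).trans (sup_le_sup_right (rightIdealDeg_le _ _ _ _) _)

/-- The ordered monomials span. -/
lemma span_ordMon (h : IsConvexFamily D E ℓ n) :
    Submodule.span K (Set.range fun m => ordMon E m n) = ⊤ := by
  have h0 : rightIdeal E 0 = ⊥ := by
    rw [rightIdeal, Submodule.span_eq_bot]
    rintro _ ⟨i, hi, -⟩
    omega
  rw [← h.sup_eq_top (Nat.zero_le n), h0, bot_sup_eq]
  congr 1
  ext x
  simp [eq_comm]

lemma ordMon_mul_mem_lexIdeal (h : IsConvexFamily D E ℓ n) (m : ℕ → ℕ) {k : ℕ} (hk : k ≤ n) {x : U}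
    (hx : x ∈ rightIdeal E k) : ordMon E m k * x ∈ lexIdeal E m k := by
  induction k generalizing x with
  | zero =>
    refine mul_span_mem _ ?_ hx
    rintro _ ⟨i, hi, -⟩
    omega
  | succ k ih =>
    refine mul_span_mem _ ?_ hx
    rintro _ ⟨i, hi, u, rfl⟩
    rw [ordMon, mul_assoc]
    rcases Nat.lt_succ_iff_lt_or_eq.mp hi with hi' | rfl
    · exact lexIdeal_mono (Nat.le_succ k) (ih (by omega)
        (h.pow_mul_rightIdeal_mem hk _ (mul_mem_rightIdeal hi' u)))
    · rw [← mul_assoc (E i ^ _), ← pow_succ, ← mul_assoc]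
      exact Submodule.subset_span ⟨i, hi, u, rfl⟩

lemma lexIdeal_le_lexSpan (h : IsConvexFamily D E ℓ n) (m : ℕ → ℕ) {k : ℕ} (hk : k ≤ n) :
    lexIdeal E m k ≤ lexSpan E n m := by
  induction k with
  | zero =>
    refine Submodule.span_le.mpr ?_
    rintro _ ⟨i, hi, -⟩
    omega
  | succ k ih =>
    refine Submodule.span_le.mpr ?_
    rintro _ ⟨i, hi, u, rfl⟩
    rcases Nat.lt_succ_iff_lt_or_eq.mp hi with hi' | rfl
    · exact ih (by omega) (Submodule.subset_span ⟨i, hi', u, rfl⟩)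
    · have hu : u ∈ rightIdeal E i ⊔ suffixSpan E n i := by
        rw [h.sup_eq_top (by omega : i ≤ n)]
        exact Submodule.mem_top
      obtain ⟨y, hy, s, hs, rfl⟩ := Submodule.mem_sup.mp hu
      rw [mul_add]
      refine Submodule.add_mem _ ?_ ?_
      · rw [mul_assoc]
        exact ih (by omega) (h.ordMon_mul_mem_lexIdeal m (by omega)
          (h.pow_mul_rightIdeal_mem hk _ hy))
      · refine mul_span_mem _ ?_ hs
        rintro _ ⟨m', hm', rfl⟩
        rw [ordMon_mul_ordMon E m m' _ i n hk hm']
        refine Submodule.subset_span ⟨_, ⟨i, hk, fun j hj => if_pos hj, ?_⟩, rfl⟩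
        simp
        omega

/-- A ring endomorphism `β` fixing every `E k` up to the right ideal of the previous ones is
triangular on ordered monomials, for the lexicographic order. -/
lemma map_ordMon_sub_mem (h : IsConvexFamily D E ℓ n) (β : U →+* U)
    (hβ : ∀ k < n, β (E k) - E k ∈ rightIdeal E k) (m : ℕ → ℕ) :
    β (ordMon E m n) - ordMon E m n ∈ lexSpan E n m := by
  have hpow : ∀ k < n, ∀ a : ℕ, β (E k) ^ a - E k ^ a ∈ rightIdeal E k := by
    intro k hk a
    induction a with
    | zero => simp
    | succ a ih =>
      have : β (E k) ^ (a + 1) - E k ^ (a + 1) =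
          (β (E k) ^ a - E k ^ a) * β (E k) + E k ^ a * (β (E k) - E k) := by
        rw [pow_succ, pow_succ]; noncomm_ring
      rw [this]
      exact Submodule.add_mem _ (rightIdeal_mul_mem ih _) (h.pow_mul_rightIdeal_mem hk _ (hβ k hk))
  refine h.lexIdeal_le_lexSpan m le_rfl ?_
  suffices H : ∀ k ≤ n, β (ordMon E m k) - ordMon E m k ∈ lexIdeal E m k from H n le_rfl
  intro k hk
  induction k with
  | zero => simp [ordMon]
  | succ k ih =>
    have : β (ordMon E m (k + 1)) - ordMon E m (k + 1) =
        (β (ordMon E m k) - ordMon E m k) * β (E k) ^ m k +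
          ordMon E m k * (β (E k) ^ m k - E k ^ m k) := by
      rw [ordMon, map_mul, map_pow]; noncomm_ring
    rw [this]
    exact lexIdeal_mono (Nat.le_succ k) (Submodule.add_mem _ (lexIdeal_mul_mem (ih (by omega)) _)
      (h.ordMon_mul_mem_lexIdeal m (by omega) (hpow k hk _)))

end IsConvexFamily

end Monomial

/-! ### The PBW vectors span, and the bar involution is triangular on them -/

/-- The root vectors, indexed by `ℕ` (with value `0` from `6` on). -/
def rootSeq (k : ℕ) : Un := if h : k < 6 then rootVec ⟨k, h⟩ else 0

/-- The number of simple roots in the `k`-th positive root. -/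
def rootLen (k : ℕ) : ℕ := if h : k < 6 then (![1, 4, 3, 5, 2, 1] : Fin 6 → ℕ) ⟨k, h⟩ else 1

lemma rootSeq_vals : rootSeq 0 = e 0 ∧ rootSeq 1 = rootAAAB (e 0) (e 1) ∧
    rootSeq 2 = rootAAB (e 0) (e 1) ∧ rootSeq 3 = rootAAABB (e 0) (e 1) ∧
    rootSeq 4 = rootAB (e 0) (e 1) ∧ rootSeq 5 = e 1 := ⟨rfl, rfl, rfl, rfl, rfl, rfl⟩

/-- The span of the words of length `n` in the generators. -/
def lengthSpan (n : ℕ) : Submodule K Un := Submodule.span K (Set.range e) ^ n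

lemma mul_mem_lengthSpan {i j : ℕ} {x y : Un} (hx : x ∈ lengthSpan i) (hy : y ∈ lengthSpan j) :
    x * y ∈ lengthSpan (i + j) := by
  rw [lengthSpan, pow_add]
  exact Submodule.mul_mem_mul hx hy

lemma one_mem_lengthSpan : (1 : Un) ∈ lengthSpan 0 := by
  rw [lengthSpan, pow_zero]
  exact Submodule.one_le.mp le_rfl

lemma e_mem_lengthSpan (i : Fin 2) : e i ∈ lengthSpan 1 := by
  rw [lengthSpan, pow_one]
  exact Submodule.subset_span ⟨i, rfl⟩

lemma iSup_lengthSpan : ⨆ n, lengthSpan n = ⊤ := by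
  have key : ∀ x : Un, ∀ y ∈ ⨆ n, lengthSpan n, x * y ∈ ⨆ n, lengthSpan n := by
    intro x
    induction x using Un.induction with
    | h0 c => intro y hy; rw [← Algebra.smul_def]; exact Submodule.smul_mem _ _ hy
    | h1 i =>
      intro y hy
      induction hy using Submodule.iSup_induction' with
      | mem n y hy => exact Submodule.mem_iSup_of_mem _ (mul_mem_lengthSpan (e_mem_lengthSpan i) hy)
      | zero => rw [mul_zero]; exact Submodule.zero_mem _
      | add y z _ _ hy hz => rw [mul_add]; exact Submodule.add_mem _ hy hz
    | hm x x' hx hx' => intro y hy; rw [mul_assoc]; exact hx _ (hx' _ hy)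
    | ha x x' hx hx' => intro y hy; rw [add_mul]; exact Submodule.add_mem _ (hx _ hy) (hx' _ hy)
  rw [eq_top_iff]
  intro x _
  rw [← mul_one x]
  exact key x 1 (Submodule.mem_iSup_of_mem 0 one_mem_lengthSpan)

lemma isRootFamily_rootSeq : IsRootFamily (rootSeq 0) (rootSeq 5) (rootSeq 4) (rootSeq 2) (rootSeq
    1)
    (rootSeq 3) := isRootFamily_rootVec

lemma rootSeq_mem_lengthSpan : (rootSeq 0 ∈ lengthSpan 1 ∧ rootSeq 5 ∈ lengthSpan 1) ∧
    rootSeq 4 ∈ lengthSpan 2 ∧ rootSeq 2 ∈ lengthSpan 3 ∧ rootSeq 1 ∈ lengthSpan 4 ∧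
    rootSeq 3 ∈ lengthSpan 5 := by
  have h₀ : rootSeq 0 ∈ lengthSpan 1 := e_mem_lengthSpan 0
  have h₅ : rootSeq 5 ∈ lengthSpan 1 := e_mem_lengthSpan 1
  have h₄ : rootSeq 4 ∈ lengthSpan 2 :=
    Submodule.sub_mem _ (mul_mem_lengthSpan h₅ h₀)
      (Submodule.smul_mem _ _ (mul_mem_lengthSpan h₀ h₅))
  have h₂ : rootSeq 2 ∈ lengthSpan 3 :=
    Submodule.smul_mem _ _ (Submodule.sub_mem _ (mul_mem_lengthSpan h₄ h₀)
      (Submodule.smul_mem _ _ (mul_mem_lengthSpan h₀ h₄)))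
  exact ⟨⟨h₀, h₅⟩, h₄, h₂, Submodule.smul_mem _ _ (Submodule.sub_mem _ (mul_mem_lengthSpan h₂ h₀)
      (Submodule.smul_mem _ _ (mul_mem_lengthSpan h₀ h₂))),
    Submodule.smul_mem _ _ (Submodule.sub_mem _ (mul_mem_lengthSpan h₄ h₂)
      (Submodule.smul_mem _ _ (mul_mem_lengthSpan h₂ h₄)))⟩

/-- The straightening relations preserve the filtration by the right ideals of the first root
vectors. -/
lemma IsRootFamily.mul_mem_rightIdealDeg {A : Type*} [Ring A] [Algebra K A] {E : ℕ → A}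
    (h : IsRootFamily (E 0) (E 5) (E 4) (E 2) (E 1) (E 3)) {D : ℕ → Submodule K A}
    (hD : ∀ {i j x y}, x ∈ D i → y ∈ D j → x * y ∈ D (i + j)) (ho : 1 ∈ D 0) (h₀ : E 0 ∈ D 1)
    (h₅ : E 5 ∈ D 1) (h₄ : E 4 ∈ D 2) (h₂ : E 2 ∈ D 3) (h₁ : E 1 ∈ D 4) (h₃ : E 3 ∈ D 5) :
    ∀ k < 6, ∀ i < k, E k * E i ∈ rightIdealDeg D E rootLen k (rootLen k + rootLen i) := by
  have mem : ∀ {k d n : ℕ} (i : ℕ) {u : A}, u ∈ D d → i < k → rootLen i + d = n →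
      E i * u ∈ rightIdealDeg D E rootLen k n :=
    fun i _ hu hi hn => Submodule.subset_span ⟨i, hi, _, _, hu, hn, rfl⟩
  have mem' : ∀ {k n : ℕ} (i : ℕ), i < k → rootLen i = n →
      E i ∈ rightIdealDeg D E rootLen k n :=
    fun i hi hn => by simpa using mem i ho hi hn
  have h₃₀ : E 3 * E 0 ∈ rightIdealDeg D E rootLen 3 6 := by
    rw [h.x₃₂a_x₁x₃.1]
    exact add_mem (mem 0 h₃ (by omega) rfl) (Submodule.smul_mem _ _ (mem 2 h₂ (by omega) rfl))
  have h₃₂ : E 3 * E 2 ∈ rightIdealDeg D E rootLen 3 8 := by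
    rw [h.x₃₂x₂]
    exact Submodule.smul_mem _ _ (mem 2 h₃ (by omega) rfl)
  have h₅₄ : E 5 * E 4 ∈ rightIdealDeg D E rootLen 5 3 := by
    rw [h.bx₁]
    exact Submodule.smul_mem _ _ (mem 4 h₅ (by omega) rfl)
  have h₅₂ : E 5 * E 2 ∈ rightIdealDeg D E rootLen 5 4 := by
    rw [h.bx₂]
    exact add_mem (mem 2 h₅ (by omega) rfl) (Submodule.smul_mem _ _ (mem 4 h₄ (by omega) rfl))
  -- The products `E₃E₁` and `E₅E₃` are straightened by writing `E₁` and `E₃` as `q`-commutators.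
  have h₃₁ : E 3 * E 1 ∈ rightIdealDeg D E rootLen 3 9 := by
    rw [← Submodule.smul_mem_iff _ qThree_ne_zero, ← mul_smul_comm, ← sub_eq_of_eq_add' h.x₂a,
      mul_sub, mul_smul_comm, ← mul_assoc, ← mul_assoc]
    exact sub_mem (rightIdealDeg_mul_mem hD h₃₂ h₀ rfl)
      (Submodule.smul_mem _ _ (rightIdealDeg_mul_mem hD h₃₀ h₂ rfl))
  have h₅₃ : E 5 * E 3 ∈ rightIdealDeg D E rootLen 5 6 := by
    rw [← Submodule.smul_mem_iff _ qThree_ne_zero, ← mul_smul_comm, ← sub_eq_of_eq_add' h.x₁x₂,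
      mul_sub, mul_smul_comm, ← mul_assoc, ← mul_assoc]
    exact sub_mem (rightIdealDeg_mul_mem hD h₅₄ h₂ rfl)
      (Submodule.smul_mem _ _ (rightIdealDeg_mul_mem hD h₅₂ h₄ rfl))
  intro k hk i hi
  interval_cases k <;> interval_cases i
  · rw [h.x₃a]
    exact Submodule.smul_mem _ _ (mem 0 h₁ (by omega) rfl)
  · rw [h.x₂a]
    exact add_mem (Submodule.smul_mem _ _ (mem 0 h₂ (by omega) rfl))
      (Submodule.smul_mem _ _ (mem' 1 (by omega) rfl))
  · rw [h.x₂x₃]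
    exact Submodule.smul_mem _ _ (mem 1 h₂ (by omega) rfl)
  · exact h₃₀
  · exact h₃₁
  · exact h₃₂
  · rw [h.x₁a]
    exact add_mem (Submodule.smul_mem _ _ (mem 0 h₄ (by omega) rfl))
      (Submodule.smul_mem _ _ (mem' 2 (by omega) rfl))
  · rw [h.x₃₂a_x₁x₃.2]
    exact add_mem (mem 1 h₄ (by omega) rfl) (Submodule.smul_mem _ _ (mem 2 h₂ (by omega) rfl))
  · rw [h.x₁x₂]
    exact add_mem (Submodule.smul_mem _ _ (mem 2 h₄ (by omega) rfl))
      (Submodule.smul_mem _ _ (mem' 3 (by omega) rfl))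
  · rw [h.x₁x₃₂]
    exact Submodule.smul_mem _ _ (mem 3 h₄ (by omega) rfl)
  · rw [h.ba]
    exact add_mem (Submodule.smul_mem _ _ (mem 0 h₅ (by omega) rfl)) (mem' 4 (by omega) rfl)
  · rw [h.bx₃]
    exact add_mem (add_mem (Submodule.smul_mem _ _ (mem 1 h₅ (by omega) rfl))
      (Submodule.smul_mem _ _ (mem' 3 (by omega) rfl)))
      (Submodule.smul_mem _ _ (mem 2 h₄ (by omega) rfl))
  · exact h₅₂
  · exact h₅₃
  · exact h₅₄

lemma isConvexFamily_rootSeq : IsConvexFamily lengthSpan rootSeq rootLen 6 where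
  mul_mem := mul_mem_lengthSpan
  pos k hk := by interval_cases k <;> decide
  zero_le := by rw [lengthSpan, pow_zero]
  succ_le j := by
    rw [lengthSpan, pow_succ']
    refine Submodule.mul_le.mpr fun x hx y hy => ?_
    refine span_mul_mem y ?_ hx
    rintro _ ⟨i, rfl⟩
    fin_cases i
    · exact Submodule.subset_span ⟨0, by omega, j, y, hy, add_comm _ _, rfl⟩
    · exact Submodule.subset_span ⟨5, by omega, j, y, hy, add_comm _ _, rfl⟩
  iSup_eq_top := iSup_lengthSpan
  mul_mem_rightIdealDeg := by
    obtain ⟨⟨h₀, h₅⟩, h₄, h₂, h₁, h₃⟩ := rootSeq_mem_lengthSpan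
    exact isRootFamily_rootSeq.mul_mem_rightIdealDeg mul_mem_lengthSpan one_mem_lengthSpan h₀ h₅ h₄
      h₂
      h₁ h₃

lemma barK_qTwo : barK (q + q⁻¹) = q + q⁻¹ := by
  rw [map_add, map_inv₀, barK_q, inv_inv, add_comm]

lemma barK_qThree : barK (q ^ 2 + 1 + q⁻¹ ^ 2) = q ^ 2 + 1 + q⁻¹ ^ 2 := by
  rw [map_add, map_add, map_pow, map_pow, map_inv₀, barK_q, inv_inv, map_one]; ring

/-- If `x a = c • a x + d • y`, then `d⁻¹ (X a - c' a X) ≡ y` modulo `aU` for every `X ≡ x`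
modulo `aU`. -/
lemma qComm_sub_mem {A : Type*} [Ring A] [Algebra K A] {E : ℕ → A} {x y X : A} {c c' d : K}
    (hd : d ≠ 0) (h : x * E 0 = c • (E 0 * x) + d • y) (hX : X - x ∈ rightIdeal E 1) :
    d⁻¹ • (X * E 0 - c' • (E 0 * X)) - y ∈ rightIdeal E 1 := by
  have : d⁻¹ • (X * E 0 - c' • (E 0 * X)) - y =
      d⁻¹ • ((X - x) * E 0 + c • (E 0 * x) - c' • (E 0 * X)) := by
    rw [sub_mul, h, ← sub_eq_zero]
    match_scalars <;> field_simp <;> ring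
  rw [this]
  exact Submodule.smul_mem _ _ (sub_mem (add_mem (rightIdeal_mul_mem hX _)
    (Submodule.smul_mem _ _ (mul_mem_rightIdeal one_pos _)))
    (Submodule.smul_mem _ _ (mul_mem_rightIdeal one_pos _)))

lemma rightIdeal_mono {A : Type*} [Ring A] [Algebra K A] {E : ℕ → A} {k k' : ℕ} (h : k ≤ k') :
    rightIdeal E k ≤ rightIdeal E k' :=
  Submodule.span_mono fun _ ⟨i, hi, hx⟩ => ⟨i, by omega, hx⟩

lemma IsRootFamily.qComm_sub_mem {A : Type*} [Ring A] [Algebra K A] {E : ℕ → A}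
    (h : IsRootFamily (E 0) (E 5) (E 4) (E 2) (E 1) (E 3)) {X Y : A} {c : K}
    (hX : X - E 4 ∈ rightIdeal E 1) (hY : Y - E 2 ∈ rightIdeal E 1) :
    (q ^ 2 + 1 + q⁻¹ ^ 2)⁻¹ • (X * Y - c • (Y * X)) - E 3 ∈ rightIdeal E 3 := by
  have hle := rightIdeal_mono (E := E) (k := 1) (k' := 3) (by omega)
  have hY' : E 4 * (Y - E 2) ∈ rightIdeal E 3 := by
    refine mul_span_mem _ ?_ hY
    rintro _ ⟨i, hi, u, rfl⟩
    obtain rfl : i = 0 := by omega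
    rw [← mul_assoc, h.x₁a, add_mul, smul_mul_assoc, smul_mul_assoc, mul_assoc]
    exact add_mem (Submodule.smul_mem _ _ (mul_mem_rightIdeal (by omega) _))
      (Submodule.smul_mem _ _ (mul_mem_rightIdeal (by omega) _))
  have : (q ^ 2 + 1 + q⁻¹ ^ 2)⁻¹ • (X * Y - c • (Y * X)) - E 3 = (q ^ 2 + 1 + q⁻¹ ^ 2)⁻¹ •
      ((X - E 4) * Y + E 4 * (Y - E 2) - c • ((Y - E 2) * X) + q⁻¹ • (E 2 * E 4) -
        c • (E 2 * X)) := by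
    rw [eq_inv_smul_iff₀ qThree_ne_zero, smul_sub, smul_inv_smul₀ qThree_ne_zero,
      ← sub_eq_of_eq_add' h.x₁x₂]
    simp only [sub_mul, mul_sub, smul_sub]
    abel
  rw [this]
  exact Submodule.smul_mem _ _ (sub_mem (add_mem (sub_mem (add_mem
    (rightIdeal_mul_mem (hle hX) _) hY') (Submodule.smul_mem _ _ (rightIdeal_mul_mem (hle hY) _)))
    (Submodule.smul_mem _ _ (mul_mem_rightIdeal (by omega) _)))
    (Submodule.smul_mem _ _ (mul_mem_rightIdeal (by omega) _)))

/-- The bar involution fixes each root vector up to the right ideal of the previous ones. -/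
lemma bar_rootSeq_sub_mem (k : ℕ) (hk : k < 6) : bar (rootSeq k) - rootSeq k ∈ rightIdeal rootSeq k
    := by
  obtain ⟨v₀, v₁, v₂, v₃, v₄, v₅⟩ := rootSeq_vals
  have h := isRootFamily_rootSeq
  have h₄ : bar (rootSeq 4) - rootSeq 4 ∈ rightIdeal rootSeq 1 := by
    have : bar (rootSeq 4) - rootSeq 4 = (q ^ 3 - q⁻¹ ^ 3) • (rootSeq 0 * e 1) := by
      rw [v₄, v₀, rootAB, map_sub, map_mul, bar_smul, map_mul, bar_e, bar_e, map_pow, barK_q]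
      module
    rw [this]
    exact Submodule.smul_mem _ _ (mul_mem_rightIdeal one_pos _)
  have h₂ : bar (rootSeq 2) - rootSeq 2 ∈ rightIdeal rootSeq 1 := by
    have : bar (rootSeq 2) = (q + q⁻¹)⁻¹ •
        (bar (rootSeq 4) * rootSeq 0 - q⁻¹ • (rootSeq 0 * bar (rootSeq 4))) := by
      rw [v₂, rootAAB, bar_smul, map_inv₀, barK_qTwo, map_sub, bar_smul, map_mul, map_mul, barK_q,
        bar_e, v₄, v₀]
    rw [this]
    exact qComm_sub_mem qTwo_ne_zero h.x₁a h₄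
  have h₁ : bar (rootSeq 1) - rootSeq 1 ∈ rightIdeal rootSeq 1 := by
    have : bar (rootSeq 1) = (q ^ 2 + 1 + q⁻¹ ^ 2)⁻¹ •
        (bar (rootSeq 2) * rootSeq 0 - q • (rootSeq 0 * bar (rootSeq 2))) := by
      rw [v₁, rootAAAB, bar_smul, map_inv₀, barK_qThree, map_sub, bar_smul, map_mul, map_mul,
        map_inv₀,
        barK_q, inv_inv, bar_e, v₂, v₀]
    rw [this]
    exact qComm_sub_mem qThree_ne_zero h.x₂a h₂
  interval_cases k
  · rw [v₀, bar_e, sub_self]; exact zero_mem _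
  · exact h₁
  · exact rightIdeal_mono (by omega) h₂
  · have : bar (rootSeq 3) = (q ^ 2 + 1 + q⁻¹ ^ 2)⁻¹ •
        (bar (rootSeq 4) * bar (rootSeq 2) - q • (bar (rootSeq 2) * bar (rootSeq 4))) := by
      rw [v₃, rootAAABB, bar_smul, map_inv₀, barK_qThree, map_sub, bar_smul, map_mul, map_mul,
        map_inv₀, barK_q, inv_inv, v₂, v₄]
    rw [this]
    exact h.qComm_sub_mem h₄ h₂
  · exact rightIdeal_mono (by omega) h₄
  · rw [v₅, bar_e, sub_self]; exact zero_mem _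

/-! ### A representation by quantum torus monomials -/

/-- Generators of a quantum torus attached to the reduced word: `t l * t k = q^{-(α_k, α_l)} t k * t
l` for `k < l`, where `α_k` is the simple root at position `k`. -/
def IsTorusFamily {A : Type*} [Ring A] [Algebra K A] (t : Fin 6 → A) : Prop :=
  ∀ k l, k < l → t l * t k = q ^ (-ip (redWord k) (redWord l)) • (t k * t l)

section Torus

variable {A : Type*} [Ring A] [Algebra K A] {t : Fin 6 → A}

lemma IsTorusFamily.vals (h : IsTorusFamily t) :
    (t 1 * t 0 = q ^ 3 • (t 0 * t 1) ∧ t 2 * t 0 = q⁻¹ ^ 2 • (t 0 * t 2) ∧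
      t 3 * t 0 = q ^ 3 • (t 0 * t 3) ∧ t 4 * t 0 = q⁻¹ ^ 2 • (t 0 * t 4) ∧
      t 5 * t 0 = q ^ 3 • (t 0 * t 5)) ∧
    (t 2 * t 1 = q ^ 3 • (t 1 * t 2) ∧ t 3 * t 1 = q⁻¹ ^ 6 • (t 1 * t 3) ∧
      t 4 * t 1 = q ^ 3 • (t 1 * t 4) ∧ t 5 * t 1 = q⁻¹ ^ 6 • (t 1 * t 5)) ∧
    (t 3 * t 2 = q ^ 3 • (t 2 * t 3) ∧ t 4 * t 2 = q⁻¹ ^ 2 • (t 2 * t 4) ∧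
      t 5 * t 2 = q ^ 3 • (t 2 * t 5)) ∧
    (t 4 * t 3 = q ^ 3 • (t 3 * t 4) ∧ t 5 * t 3 = q⁻¹ ^ 6 • (t 3 * t 5)) ∧
    t 5 * t 4 = q ^ 3 • (t 4 * t 5) := by
  obtain ⟨h1, h2, h3, h4⟩ := q_ip
  have e00 : (q ^ 2)⁻¹ = q⁻¹ ^ 2 := (inv_pow q 2).symm
  have e11 : (q ^ 6)⁻¹ = q⁻¹ ^ 6 := (inv_pow q 6).symm
  rw [e00] at h1
  rw [e11] at h4
  refine ⟨⟨?_, ?_, ?_, ?_, ?_⟩, ⟨?_, ?_, ?_, ?_⟩, ⟨?_, ?_, ?_⟩, ⟨?_, ?_⟩, ?_⟩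
  · rw [← h2]; exact h 0 1 (by decide)
  · rw [← h1]; exact h 0 2 (by decide)
  · rw [← h2]; exact h 0 3 (by decide)
  · rw [← h1]; exact h 0 4 (by decide)
  · rw [← h2]; exact h 0 5 (by decide)
  · rw [← h3]; exact h 1 2 (by decide)
  · rw [← h4]; exact h 1 3 (by decide)
  · rw [← h3]; exact h 1 4 (by decide)
  · rw [← h4]; exact h 1 5 (by decide)
  · rw [← h2]; exact h 2 3 (by decide)
  · rw [← h1]; exact h 2 4 (by decide)
  · rw [← h2]; exact h 2 5 (by decide)
  · rw [← h3]; exact h 3 4 (by decide)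
  · rw [← h4]; exact h 3 5 (by decide)
  · rw [← h2]; exact h 4 5 (by decide)

lemma IsTorusFamily.rootAB_eq (h : IsTorusFamily t) :
    rootAB (t 0 + t 2 + t 4) (t 1 + t 3 + t 5) =
      (1 - q ^ 6) • (t 1 * t 2 + t 1 * t 4 + t 3 * t 4) := by
  have hq := q_ne_zero
  obtain ⟨⟨h10, h20, h30, h40, h50⟩, ⟨h21, h31, h41, h51⟩, ⟨h32, h42, h52⟩, ⟨h43, h53⟩, h54⟩ :=
    h.vals
  simp only [rootAB, mul_add, add_mul, h10, h20, h30, h40, h50, h21, h31, h41, h51, h32, h42, h52,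
    h43, h53, h54]
  match_scalars <;> field_simp <;> ring

lemma IsTorusFamily.rootAAB_eq (h : IsTorusFamily t) :
    rootAAB (t 0 + t 2 + t 4) (t 1 + t 3 + t 5) = (q * (1 - q ^ 2) * (1 - q ^ 6)) •
      (t 1 * (t 2 * t 2) + (1 + q⁻¹ ^ 2) • (t 1 * (t 2 * t 4)) + t 1 * (t 4 * t 4)
        + t 3 * (t 4 * t 4)) := by
  have hq := q_ne_zero
  obtain ⟨⟨h10, h20, h30, h40, h50⟩, ⟨h21, h31, h41, h51⟩, ⟨h32, h42, h52⟩, ⟨h43, h53⟩, h54⟩ :=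
    h.vals
  rw [rootAAB, inv_smul_eq_iff₀ qTwo_ne_zero, h.rootAB_eq]
  simp only [mul_add, add_mul, smul_mul_assoc, mul_smul_comm, mul_assoc,
    h10, h20, h30, h40, h50, h21, h31, h41, h51, h32, h42, h52, h43, h53, h54,
    mul_mul_of_mul_eq h10, mul_mul_of_mul_eq h20, mul_mul_of_mul_eq h30, mul_mul_of_mul_eq h40,
    mul_mul_of_mul_eq h21, mul_mul_of_mul_eq h41, mul_mul_of_mul_eq h32, mul_mul_of_mul_eq h42,
    mul_mul_of_mul_eq h43]
  match_scalars <;> field_simp <;> ring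

lemma IsTorusFamily.rootAAAB_eq (h : IsTorusFamily t) :
    rootAAAB (t 0 + t 2 + t 4) (t 1 + t 3 + t 5) = (q ^ 3 * (1 - q ^ 2) ^ 3) •
      (t 1 * (t 2 * (t 2 * t 2)) + (1 + q⁻¹ ^ 2 + q⁻¹ ^ 4) • (t 1 * (t 2 * (t 2 * t 4)))
        + (1 + q⁻¹ ^ 2 + q⁻¹ ^ 4) • (t 1 * (t 2 * (t 4 * t 4))) + t 1 * (t 4 * (t 4 * t 4))
        + t 3 * (t 4 * (t 4 * t 4))) := by
  have hq := q_ne_zero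
  obtain ⟨⟨h10, h20, h30, h40, h50⟩, ⟨h21, h31, h41, h51⟩, ⟨h32, h42, h52⟩, ⟨h43, h53⟩, h54⟩ :=
    h.vals
  rw [rootAAAB, inv_smul_eq_iff₀ qThree_ne_zero, h.rootAAB_eq]
  simp only [mul_add, add_mul, smul_mul_assoc, mul_smul_comm, mul_assoc,
    h10, h20, h30, h40, h50, h21, h31, h41, h51, h32, h42, h52, h43, h53, h54,
    mul_mul_of_mul_eq h10, mul_mul_of_mul_eq h20, mul_mul_of_mul_eq h30, mul_mul_of_mul_eq h40,
    mul_mul_of_mul_eq h21, mul_mul_of_mul_eq h41, mul_mul_of_mul_eq h32, mul_mul_of_mul_eq h42,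
    mul_mul_of_mul_eq h43]
  match_scalars <;> field_simp <;> ring

lemma IsTorusFamily.rootAAABB_eq (h : IsTorusFamily t) :
    rootAAABB (t 0 + t 2 + t 4) (t 1 + t 3 + t 5) = (q ^ 6 * (1 - q ^ 2) ^ 3 * (1 - q ^ 6)) •
      (t 1 * (t 1 * (t 2 * (t 2 * t 2)))
        + (1 + q⁻¹ ^ 2 + q⁻¹ ^ 4) • (t 1 * (t 1 * (t 2 * (t 2 * t 4))))
        + (1 + q⁻¹ ^ 2 + q⁻¹ ^ 4) • (t 1 * (t 1 * (t 2 * (t 4 * t 4))))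
        + t 1 * (t 1 * (t 4 * (t 4 * t 4)))
        + (q⁻¹ ^ 3 * (1 + q⁻¹ ^ 2 + q⁻¹ ^ 4)) • (t 1 * (t 2 * (t 3 * (t 4 * t 4))))
        + (1 + q⁻¹ ^ 6) • (t 1 * (t 3 * (t 4 * (t 4 * t 4))))
        + t 3 * (t 3 * (t 4 * (t 4 * t 4)))) := by
  have hq := q_ne_zero
  obtain ⟨⟨h10, h20, h30, h40, h50⟩, ⟨h21, h31, h41, h51⟩, ⟨h32, h42, h52⟩, ⟨h43, h53⟩, h54⟩ :=
    h.vals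
  rw [rootAAABB, inv_smul_eq_iff₀ qThree_ne_zero, h.rootAAB_eq, h.rootAB_eq]
  simp only [mul_add, add_mul, smul_mul_assoc, mul_smul_comm, mul_assoc,
    h21, h31, h41, h32, h42, h43, mul_mul_of_mul_eq h31,
    mul_mul_of_mul_eq h21, mul_mul_of_mul_eq h41, mul_mul_of_mul_eq h32, mul_mul_of_mul_eq h42,
    mul_mul_of_mul_eq h43]
  match_scalars <;> field_simp <;> ring

/-- The substitution `e₀ ↦ t₀ + t₂ + t₄`, `e₁ ↦ t₁ + t₃ + t₅` respects the quantum Serre relations.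
-/
lemma IsTorusFamily.serre (h : IsTorusFamily t) : ∀ i j, i ≠ j →
    serre i j ((![t 0 + t 2 + t 4, t 1 + t 3 + t 5] : Fin 2 → A) i)
      ((![t 0 + t 2 + t 4, t 1 + t 3 + t 5] : Fin 2 → A) j) = 0 := by
  have hq := q_ne_zero
  obtain ⟨⟨h10, h20, h30, h40, h50⟩, ⟨h21, h31, h41, h51⟩, ⟨h32, h42, h52⟩, ⟨h43, h53⟩, h54⟩ :=
    h.vals
  rw [serre_iff_rootVec]
  simp only [Matrix.cons_val_zero, Matrix.cons_val_one]
  constructor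
  · rw [h.rootAAAB_eq]
    simp only [mul_add, add_mul, smul_mul_assoc, mul_smul_comm, mul_assoc, h10, h20, h30, h40,
      h21, h41, h32, h42, h43,
      mul_mul_of_mul_eq h10, mul_mul_of_mul_eq h20, mul_mul_of_mul_eq h30, mul_mul_of_mul_eq h40,
      mul_mul_of_mul_eq h21, mul_mul_of_mul_eq h41, mul_mul_of_mul_eq h32, mul_mul_of_mul_eq h42,
      mul_mul_of_mul_eq h43]
    match_scalars <;> field_simp <;> ring
  · rw [h.rootAB_eq]
    simp only [mul_add, add_mul, smul_mul_assoc, mul_smul_comm, mul_assoc, h21, h31, h41, h51, h32,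
      h42, h52, h43, h53, h54,
      mul_mul_of_mul_eq h21, mul_mul_of_mul_eq h31, mul_mul_of_mul_eq h41, mul_mul_of_mul_eq h51,
      mul_mul_of_mul_eq h32, mul_mul_of_mul_eq h52, mul_mul_of_mul_eq h53]
    match_scalars <;> field_simp

end Torus

/-- The quantum torus operators on the span of the monomials `v ∈ ℕ⁶`. -/
def torusOp (k : Fin 6) : Module.End K ((Fin 6 → ℕ) →₀ K) :=
  Finsupp.linearCombination K fun v =>
    Finsupp.single (v + Pi.single k 1) (q ^ (-∑ l ∈ Finset.Iio k, ip (redWord l) (redWord k) * v l))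

lemma torusOp_single (k : Fin 6) (v : Fin 6 → ℕ) (c : K) : torusOp k (Finsupp.single v c) =
    Finsupp.single (v + Pi.single k 1)
      (c * q ^ (-∑ l ∈ Finset.Iio k, ip (redWord l) (redWord k) * v l)) := by
  simp [torusOp]

lemma isTorusFamily_torusOp : IsTorusFamily torusOp := by
  intro k l hkl
  refine Finsupp.lhom_ext fun v c => ?_
  simp only [Module.End.mul_apply, LinearMap.smul_apply, torusOp_single, Finsupp.smul_single,
    smul_eq_mul]
  have e₁ : ∑ i ∈ Finset.Iio l, ip (redWord i) (redWord l) * ((v + Pi.single k 1 : Fin 6 →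
    ℕ) i : ℤ) =
      ∑ i ∈ Finset.Iio l, ip (redWord i) (redWord l) * (v i : ℤ) + ip (redWord k) (redWord l) := by
    simp only [Pi.add_apply, Nat.cast_add, mul_add, Finset.sum_add_distrib]
    congr 1
    rw [Finset.sum_eq_single_of_mem k (Finset.mem_Iio.mpr hkl) fun i _ hi => by simp [hi]]
    simp
  have e₂ : ∑ i ∈ Finset.Iio k, ip (redWord i) (redWord k) * ((v + Pi.single l 1 : Fin 6 →
    ℕ) i : ℤ) =
      ∑ i ∈ Finset.Iio k, ip (redWord i) (redWord k) * (v i : ℤ) := by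
    refine Finset.sum_congr rfl fun i hi => ?_
    have : i ≠ l := ((Finset.mem_Iio.mp hi).trans hkl).ne
    simp [this]
  rw [e₁, e₂, add_right_comm, neg_add, zpow_add₀ q_ne_zero]
  congr 1
  ring

/-! ### Leading terms and linear independence of the PBW vectors -/

section Lead

variable {W : Fin 6 → ℕ}

/-- The span of the monomials `u` of weighted degree `W · u < n`. -/
def lowSpan (W : Fin 6 → ℕ) (n : ℕ) : Submodule K ((Fin 6 → ℕ) →₀ K) :=
  Finsupp.supported K K {u | W ⬝ᵥ u < n}

lemma single_mem_lowSpan {n : ℕ} {u : Fin 6 → ℕ} (h : W ⬝ᵥ u < n) (c : K) :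
    Finsupp.single u c ∈ lowSpan W n :=
  Finsupp.single_mem_supported K c h

/-- The operator `A` shifts monomials by `p`, up to a nonzero scalar and terms of lower weighted
degree. -/
def IsLead (W : Fin 6 → ℕ) (A : Module.End K ((Fin 6 → ℕ) →₀ K)) (p : Fin 6 → ℕ) : Prop :=
  ∀ v, ∃ c : K, c ≠ 0 ∧
    A (Finsupp.single v 1) - Finsupp.single (v + p) c ∈ lowSpan W (W ⬝ᵥ (v + p))

/-- The operator `A` raises the weighted degree by less than `n`. -/
def IsLow (W : Fin 6 → ℕ) (A : Module.End K ((Fin 6 → ℕ) →₀ K)) (n : ℕ) : Prop :=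
  ∀ v, A (Finsupp.single v 1) ∈ lowSpan W (W ⬝ᵥ v + n)

lemma map_mem_of_single {A : Module.End K ((Fin 6 → ℕ) →₀ K)} {n : ℕ}
    {N : Submodule K ((Fin 6 → ℕ) →₀ K)}
    (h : ∀ v, W ⬝ᵥ v < n → A (Finsupp.single v 1) ∈ N) {x : (Fin 6 → ℕ) →₀ K}
    (hx : x ∈ lowSpan W n) : A x ∈ N := by
  rw [lowSpan, Finsupp.supported_eq_span_single] at hx
  refine (Submodule.span_le (p := N.comap A)).mpr ?_ hx
  rintro _ ⟨v, hv, rfl⟩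
  exact h v hv

lemma lowSpan_mono {n n' : ℕ} (h : n ≤ n') : lowSpan W n ≤ lowSpan W n' :=
  Finsupp.supported_mono fun _ hu => lt_of_lt_of_le hu h

lemma IsLead.map_mem {A : Module.End K ((Fin 6 → ℕ) →₀ K)} {p : Fin 6 → ℕ} (hA : IsLead W A p)
    {n : ℕ} {x : (Fin 6 → ℕ) →₀ K} (hx : x ∈ lowSpan W n) : A x ∈ lowSpan W (n + W ⬝ᵥ p) := by
  refine map_mem_of_single (fun v hv => ?_) hx
  obtain ⟨c, -, h⟩ := hA v
  rw [dotProduct_add] at h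
  rw [← sub_add_cancel (A (Finsupp.single v 1)) (Finsupp.single (v + p) c)]
  exact add_mem (lowSpan_mono (by omega) h) (single_mem_lowSpan (by rw [dotProduct_add]; omega) c)

lemma IsLead.one : IsLead W 1 0 := fun v =>
  ⟨1, one_ne_zero, by simp⟩

lemma IsLead.mul {A B : Module.End K ((Fin 6 → ℕ) →₀ K)} {p r : Fin 6 → ℕ} (hA : IsLead W A p)
    (hB : IsLead W B r) : IsLead W (A * B) (p + r) := by
  intro v
  obtain ⟨c, hc, h⟩ := hB v
  obtain ⟨d, hd, h'⟩ := hA (v + r)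
  refine ⟨c * d, mul_ne_zero hc hd, ?_⟩
  have e₁ : v + (p + r) = v + r + p := by rw [add_comm p r, add_assoc]
  have e₂ : (A * B) (Finsupp.single v 1) - Finsupp.single (v + (p + r)) (c * d) =
      A (B (Finsupp.single v 1) - Finsupp.single (v + r) c) +
        c • (A (Finsupp.single (v + r) 1) - Finsupp.single (v + r + p) d) := by
    have : Finsupp.single (v + r) c = c • Finsupp.single (v + r) (1 : K) := by simp
    rw [Module.End.mul_apply, e₁, map_sub, this, map_smul, smul_sub, Finsupp.smul_single,
      smul_eq_mul]
    abel
  rw [e₂, e₁]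
  refine add_mem ?_ (Submodule.smul_mem _ _ h')
  rw [dotProduct_add _ (v + r) p]
  exact hA.map_mem h

lemma IsLead.pow {A : Module.End K ((Fin 6 → ℕ) →₀ K)} {p : Fin 6 → ℕ} (hA : IsLead W A p) (n : ℕ) :
    IsLead W (A ^ n) (n • p) := by
  induction n with
  | zero => rw [pow_zero, zero_smul]; exact IsLead.one
  | succ n ih => rw [pow_succ, succ_nsmul]; exact ih.mul hA

lemma IsLead.smul {A : Module.End K ((Fin 6 → ℕ) →₀ K)} {p : Fin 6 → ℕ} (hA : IsLead W A p) {c : K}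
    (hc : c ≠ 0) : IsLead W (c • A) p := by
  intro v
  obtain ⟨d, hd, h⟩ := hA v
  refine ⟨c * d, mul_ne_zero hc hd, ?_⟩
  rw [LinearMap.smul_apply, ← smul_eq_mul, ← Finsupp.smul_single, ← smul_sub]
  exact Submodule.smul_mem _ _ h

lemma IsLead.isLow {A : Module.End K ((Fin 6 → ℕ) →₀ K)} {p : Fin 6 → ℕ} (hA : IsLead W A p) {n : ℕ}
    (hn : W ⬝ᵥ p < n) : IsLow W A n := by
  intro v
  refine lowSpan_mono (?_ : W ⬝ᵥ v + 1 + W ⬝ᵥ p ≤ _) (hA.map_mem (single_mem_lowSpan (by omega) 1))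
  omega

lemma IsLow.add {A B : Module.End K ((Fin 6 → ℕ) →₀ K)} {n : ℕ} (hA : IsLow W A n)
    (hB : IsLow W B n) : IsLow W (A + B) n := fun v => add_mem (hA v) (hB v)

lemma IsLow.smul {A : Module.End K ((Fin 6 → ℕ) →₀ K)} {n : ℕ} (hA : IsLow W A n) (c : K) :
    IsLow W (c • A) n := fun v => Submodule.smul_mem _ _ (hA v)

lemma IsLead.add_low {A B : Module.End K ((Fin 6 → ℕ) →₀ K)} {p : Fin 6 → ℕ} (hA : IsLead W A p)
    (hB : IsLow W B (W ⬝ᵥ p)) : IsLead W (A + B) p := by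
  intro v
  obtain ⟨c, hc, h⟩ := hA v
  refine ⟨c, hc, ?_⟩
  rw [LinearMap.add_apply, add_sub_right_comm]
  refine add_mem h ?_
  rw [dotProduct_add]
  exact hB v

lemma IsLead.low_add {A B : Module.End K ((Fin 6 → ℕ) →₀ K)} {p : Fin 6 → ℕ}
    (hB : IsLow W B (W ⬝ᵥ p)) (hA : IsLead W A p) : IsLead W (B + A) p :=
  add_comm A B ▸ hA.add_low hB

lemma isLead_ordMon {E : ℕ → Module.End K ((Fin 6 → ℕ) →₀ K)} {p : ℕ → Fin 6 → ℕ} {n : ℕ}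
    (h : ∀ k < n, IsLead W (E k) (p k)) (m : ℕ → ℕ) :
    IsLead W (ordMon E m n) (∑ k ∈ Finset.range n, m k • p k) := by
  induction n with
  | zero => exact IsLead.one
  | succ n ih =>
    rw [Finset.sum_range_succ]
    exact (ih fun k hk => h k (by omega)).mul ((h n (by omega)).pow _)

/-- Vectors with distinct leading monomials are linearly independent. -/
lemma linearIndependent_of_lead {ι : Type*} {w : ι → (Fin 6 → ℕ) →₀ K} {p : ι → Fin 6 → ℕ}
    (hp : Function.Injective p)
    (h : ∀ i, ∃ c : K, c ≠ 0 ∧ w i - Finsupp.single (p i) c ∈ lowSpan W (W ⬝ᵥ p i)) :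
    LinearIndependent K w := by
  rw [linearIndependent_iff]
  intro l hl
  by_contra hne
  obtain ⟨i, hi, hmax⟩ := l.support.exists_max_image (fun i => W ⬝ᵥ p i)
    (Finsupp.support_nonempty_iff.mpr hne)
  have hcoef : ∀ j ∈ l.support, j ≠ i → w j (p i) = 0 := by
    intro j hj hji
    obtain ⟨c, -, hw⟩ := h j
    by_contra h0
    have : p i ∈ (w j - Finsupp.single (p j) c).support := by
      rw [Finsupp.mem_support_iff, Finsupp.sub_apply, Finsupp.single_eq_of_ne fun h => hji (hp
        h).symm,
        sub_zero]
      exact h0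
    exact absurd (((Finsupp.mem_supported K _).mp hw) this) (not_lt.mpr (hmax j hj))
  have hcoef' : w i (p i) ≠ 0 := by
    obtain ⟨c, hc, hw⟩ := h i
    by_contra h0
    have : p i ∈ (w i - Finsupp.single (p i) c).support := by
      rw [Finsupp.mem_support_iff, Finsupp.sub_apply, Finsupp.single_eq_same, h0, zero_sub]
      exact neg_ne_zero.mpr hc
    exact absurd (((Finsupp.mem_supported K _).mp hw) this) (lt_irrefl (W ⬝ᵥ p i))
  have := DFunLike.congr_fun hl (p i)
  rw [Finsupp.linearCombination_apply, Finsupp.sum, Finsupp.finsetSum_apply,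
    Finset.sum_eq_single_of_mem i hi fun j hj hji => by simp [hcoef j hj hji]] at this
  simp only [Finsupp.smul_apply, smul_eq_mul, Finsupp.zero_apply, mul_eq_zero] at this
  exact this.elim (Finsupp.mem_support_iff.mp hi) hcoef'

lemma isLead_torusOp (W : Fin 6 → ℕ) (k : Fin 6) : IsLead W (torusOp k) (Pi.single k 1) := by
  intro v
  refine ⟨q ^ (-∑ l ∈ Finset.Iio k, ip (redWord l) (redWord k) * (v l : ℤ)),
    zpow_ne_zero _ q_ne_zero, ?_⟩
  rw [torusOp_single, one_mul, sub_self]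
  exact zero_mem _

end Lead

/-- The weights for which each root vector acts on the quantum torus module with a single leading
monomial. -/
def leadWt : Fin 6 → ℕ := ![5, 0, 4, 5, 1, 7]

/-- The leading monomials of the root vectors. -/
def leadExp (k : ℕ) : Fin 6 → ℕ :=
  match k with
  | 0 => ![1, 0, 0, 0, 0, 0]
  | 1 => ![0, 1, 3, 0, 0, 0]
  | 2 => ![0, 1, 2, 0, 0, 0]
  | 3 => ![0, 0, 0, 2, 3, 0]
  | 4 => ![0, 0, 0, 1, 1, 0]
  | _ => ![0, 0, 0, 0, 0, 1]

/-- The action of `U_q(𝔫)` on the quantum torus module. -/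
def torusRep : Un →ₐ[K] Module.End K ((Fin 6 → ℕ) →₀ K) :=
  Un.lift _ isTorusFamily_torusOp.serre

lemma torusRep_e : torusRep (e 0) = torusOp 0 + torusOp 2 + torusOp 4 ∧
    torusRep (e 1) = torusOp 1 + torusOp 3 + torusOp 5 :=
  ⟨Un.lift_e _ isTorusFamily_torusOp.serre 0, Un.lift_e _ isTorusFamily_torusOp.serre 1⟩

lemma isLead_torusRep (k : ℕ) (hk : k < 6) : IsLead leadWt (torusRep (rootSeq k)) (leadExp k) := by
  obtain ⟨hq, h6⟩ := And.intro q_ne_zero qPoly_ne_zero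
  have h2 : 1 - q ^ 2 ≠ 0 := fun h => h6.1 (by linear_combination -h)
  have h6' : 1 - q ^ 6 ≠ 0 := fun h => h6.2.2.2.2.1 (by linear_combination -h)
  obtain ⟨v₀, v₁, v₂, v₃, v₄, v₅⟩ := rootSeq_vals
  obtain ⟨r₀, r₁⟩ := torusRep_e
  have T := isLead_torusOp leadWt
  have hT := isTorusFamily_torusOp
  interval_cases k
  · rw [v₀, r₀]
    refine IsLead.add_low (IsLead.add_low ?_ ?_) ?_
    · convert T 0 using 1; decide
    · exact (T 2).isLow (by decide)
    · exact (T 4).isLow (by decide)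
  · rw [v₁, map_rootAAAB (B := Module.End K ((Fin 6 → ℕ) →₀ K)) torusRep,
      r₀, r₁, hT.rootAAAB_eq]
    refine IsLead.smul ?_ (mul_ne_zero (pow_ne_zero 3 hq) (pow_ne_zero 3 h2))
    refine IsLead.add_low (IsLead.add_low (IsLead.add_low (IsLead.add_low ?_ ?_) ?_) ?_) ?_
    · convert (T 1).mul ((T 2).mul ((T 2).mul (T 2))) using 1; decide
    · exact (((T 1).mul ((T 2).mul ((T 2).mul (T 4)))).isLow (by decide)).smul _
    · exact (((T 1).mul ((T 2).mul ((T 4).mul (T 4)))).isLow (by decide)).smul _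
    · exact ((T 1).mul ((T 4).mul ((T 4).mul (T 4)))).isLow (by decide)
    · exact ((T 3).mul ((T 4).mul ((T 4).mul (T 4)))).isLow (by decide)
  · rw [v₂, map_rootAAB (B := Module.End K ((Fin 6 → ℕ) →₀ K)) torusRep,
      r₀, r₁, hT.rootAAB_eq]
    refine IsLead.smul ?_ (mul_ne_zero (mul_ne_zero hq h2) h6')
    refine IsLead.add_low (IsLead.add_low (IsLead.add_low ?_ ?_) ?_) ?_
    · convert (T 1).mul ((T 2).mul (T 2)) using 1; decide
    · exact (((T 1).mul ((T 2).mul (T 4))).isLow (by decide)).smul _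
    · exact ((T 1).mul ((T 4).mul (T 4))).isLow (by decide)
    · exact ((T 3).mul ((T 4).mul (T 4))).isLow (by decide)
  · rw [v₃, map_rootAAABB (B := Module.End K ((Fin 6 → ℕ) →₀ K)) torusRep,
      r₀, r₁, hT.rootAAABB_eq]
    refine IsLead.smul ?_ (mul_ne_zero (mul_ne_zero (pow_ne_zero 6 hq) (pow_ne_zero 3 h2)) h6')
    refine IsLead.low_add (IsLow.add (IsLow.add (IsLow.add (IsLow.add (IsLow.add ?_ ?_) ?_) ?_) ?_)
      ?_) ?_
    · exact ((T 1).mul ((T 1).mul ((T 2).mul ((T 2).mul (T 2))))).isLow (by decide)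
    · exact (((T 1).mul ((T 1).mul ((T 2).mul ((T 2).mul (T 4))))).isLow (by decide)).smul _
    · exact (((T 1).mul ((T 1).mul ((T 2).mul ((T 4).mul (T 4))))).isLow (by decide)).smul _
    · exact ((T 1).mul ((T 1).mul ((T 4).mul ((T 4).mul (T 4))))).isLow (by decide)
    · exact (((T 1).mul ((T 2).mul ((T 3).mul ((T 4).mul (T 4))))).isLow (by decide)).smul _
    · exact (((T 1).mul ((T 3).mul ((T 4).mul ((T 4).mul (T 4))))).isLow (by decide)).smul _
    · convert (T 3).mul ((T 3).mul ((T 4).mul ((T 4).mul (T 4)))) using 1; decide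
  · rw [v₄, map_rootAB (B := Module.End K ((Fin 6 → ℕ) →₀ K)) torusRep,
      r₀, r₁, hT.rootAB_eq]
    refine IsLead.smul ?_ h6'
    refine IsLead.low_add (IsLow.add ?_ ?_) ?_
    · exact ((T 1).mul (T 2)).isLow (by decide)
    · exact ((T 1).mul (T 4)).isLow (by decide)
    · convert (T 3).mul (T 4) using 1; decide
  · rw [v₅, r₁]
    refine IsLead.low_add (IsLow.add ?_ ?_) ?_
    · exact (T 1).isLow (by decide)
    · exact (T 3).isLow (by decide)
    · convert T 5 using 1; decide

/-- The extension by zero of an exponent `m : Fin 6 → ℕ`. -/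
def extExp (m : Fin 6 → ℕ) (k : ℕ) : ℕ := if h : k < 6 then m ⟨k, h⟩ else 0

lemma extExp_vals (m : Fin 6 → ℕ) : extExp m 0 = m 0 ∧ extExp m 1 = m 1 ∧ extExp m 2 = m 2 ∧
    extExp m 3 = m 3 ∧ extExp m 4 = m 4 ∧ extExp m 5 = m 5 := ⟨rfl, rfl, rfl, rfl, rfl, rfl⟩

lemma map_ordMon {A B : Type*} [Ring A] [Algebra K A] [Ring B] [Algebra K B] (f : A →ₐ[K] B) (E : ℕ
    → A)
    (m : ℕ → ℕ) (n : ℕ) : f (ordMon E m n) = ordMon (fun k => f (E k)) m n := by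
  induction n with
  | zero => exact map_one f
  | succ n ih => rw [ordMon, ordMon, map_mul, map_pow, ih]

lemma leadExp_sum_injective : Function.Injective fun m : Fin 6 → ℕ =>
    ∑ k ∈ Finset.range 6, extExp m k • leadExp k := by
  intro m m' h
  obtain ⟨m0, m1, m2, m3, m4, m5⟩ := extExp_vals m
  obtain ⟨n0, n1, n2, n3, n4, n5⟩ := extExp_vals m'
  simp only [Finset.sum_range_succ, Finset.sum_range_zero, m0, m1, m2, m3, m4, m5, n0, n1, n2, n3,
    n4,
    n5] at h
  have h0 := congrFun h 0
  have h1 := congrFun h 1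
  have h2 := congrFun h 2
  have h3 := congrFun h 3
  have h4 := congrFun h 4
  have h5 := congrFun h 5
  simp [leadExp] at h0 h1 h2 h3 h4 h5
  ext k
  fin_cases k <;> simp <;> omega

lemma linearIndependent_ordMon :
    LinearIndependent K fun m : Fin 6 → ℕ => ordMon rootSeq (extExp m) 6 := by
  let f : Un →ₗ[K] (Fin 6 → ℕ) →₀ K :=
    (LinearMap.applyₗ (Finsupp.single 0 1)) ∘ₗ torusRep.toLinearMap
  refine LinearIndependent.of_comp f (linearIndependent_of_lead (W :=
    leadWt) leadExp_sum_injective ?_)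
  intro m
  obtain ⟨c, hc, h⟩ := isLead_ordMon (fun k hk => isLead_torusRep k hk) (extExp m) 0
  rw [zero_add] at h
  refine ⟨c, hc, ?_⟩
  have : (f ∘ fun m : Fin 6 → ℕ => ordMon rootSeq (extExp m) 6) m =
      (ordMon (fun k => torusRep (rootSeq k)) (extExp m) 6) (Finsupp.single 0 1) := by
    rw [← map_ordMon]; rfl
  rw [this]
  exact h

/-! ### Integrality: `ℤ[q]` and its ideal `qℤ[q]` -/

/-- The embedding `ℤ[X] → ℚ(q)`, `X ↦ q`. -/
def zPoly : Polynomial ℤ →+* K := Polynomial.eval₂RingHom (Int.castRingHom K) q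

/-- The ideal `qℤ[q]` of `ℤ[q]`, as an additive subgroup of `ℚ(q)`. -/
def qIdeal : AddSubgroup K := zPoly.range.toAddSubgroup.map (AddMonoidHom.mulLeft q)

lemma mem_qIdeal {c : K} : c ∈ qIdeal ↔ ∃ P, c = q * zPoly P := by
  constructor
  · rintro ⟨_, ⟨P, rfl⟩, rfl⟩
    exact ⟨P, rfl⟩
  · rintro ⟨P, rfl⟩
    exact ⟨_, ⟨P, rfl⟩, rfl⟩

lemma zPoly_X : zPoly Polynomial.X = q := by simp [zPoly]

lemma zPoly_injective : Function.Injective zPoly := by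
  have h : zPoly = (algebraMap (Polynomial ℚ) K).comp (Polynomial.mapRingHom (Int.castRingHom ℚ)) :=
    by
    refine Polynomial.ringHom_ext' (RingHom.ext_int _ _) ?_
    rw [zPoly_X]
    simp [q, RatFunc.algebraMap_X]
  rw [h, RingHom.coe_comp]
  exact (RatFunc.algebraMap_injective ℚ).comp (Polynomial.map_injective _ Int.cast_injective)

lemma q_pow_mem_qIdeal {n : ℕ} (hn : 1 ≤ n) : q ^ n ∈ qIdeal := by
  obtain ⟨k, rfl⟩ := Nat.exists_eq_add_of_le hn
  exact mem_qIdeal.mpr ⟨Polynomial.X ^ k, by rw [map_pow, zPoly_X, pow_add, pow_one]⟩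

lemma mul_mem_qIdeal {c d : K} (hc : c ∈ qIdeal) (hd : d ∈ zPoly.range) : c * d ∈ qIdeal := by
  obtain ⟨P, rfl⟩ := mem_qIdeal.mp hc
  obtain ⟨Q, rfl⟩ := hd
  exact mem_qIdeal.mpr ⟨P * Q, by rw [map_mul, mul_assoc]⟩

lemma mem_range_of_mem_qIdeal {c : K} (hc : c ∈ qIdeal) : c ∈ zPoly.range := by
  obtain ⟨P, rfl⟩ := mem_qIdeal.mp hc
  exact ⟨Polynomial.X * P, by rw [map_mul, zPoly_X]⟩

/-- A Laurent polynomial invariant under `q ↦ q⁻¹` is not a nonzero element of `qℤ[q]`. -/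
lemma eq_zero_of_barK_eq {c : K} (hc : c ∈ qIdeal) (hbar : barK c = c) : c = 0 := by
  obtain ⟨P, rfl⟩ := mem_qIdeal.mp hc
  rw [← zPoly_X, ← map_mul] at hbar ⊢
  generalize hR : Polynomial.X * P = R at hbar ⊢
  have hinv : Polynomial.eval₂ (Int.castRingHom K) q⁻¹ R.reverse * q ^ R.natDegree = zPoly R := by
    let : Invertible q := invertibleOfNonzero q_ne_zero
    have := Polynomial.eval₂_reverse_mul_pow (Int.castRingHom K) q R
    rwa [invOf_eq_inv] at this
  have hb : ∀ Q : Polynomial ℤ, barK (Polynomial.eval₂ (Int.castRingHom K) q⁻¹ Q) = zPoly Q := by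
    intro Q
    rw [Polynomial.hom_eval₂, map_inv₀, barK_q, inv_inv]
    congr 1
    exact RingHom.ext_int _ _
  have h := congrArg barK hinv
  rw [map_mul, map_pow, barK_q, hb, hbar] at h
  have h' : zPoly R.reverse = zPoly (Polynomial.X ^ R.natDegree * R) := by
    rw [map_mul, map_pow, zPoly_X, ← h]
    have := pow_ne_zero R.natDegree q_ne_zero
    rw [inv_pow]
    field_simp
  by_contra hne
  have hR0 : R ≠ 0 := fun h0 => hne (by rw [h0, map_zero])
  have hd := congrArg Polynomial.natDegree (zPoly_injective h')
  rw [Polynomial.natDegree_X_pow_mul _ hR0] at hd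
  have hle := R.reverse_natDegree_le
  have h0 : R.natDegree = 0 := by omega
  rw [← hR, Polynomial.natDegree_X_mul (fun hP => hR0 (by rw [← hR, hP, mul_zero]))] at h0
  omega

lemma one_notMem_qIdeal : (1 : K) ∉ qIdeal := fun h =>
  one_ne_zero (eq_zero_of_barK_eq h (map_one barK))

/-! ### The PBW basis and bar-invariant vectors -/

lemma qInt_ne_zero (i : Fin 2) {n : ℕ} (hn : n ≠ 0) : qInt i n ≠ 0 := by
  have key : ∀ n : ℕ, n ≠ 0 → qi i ^ n - (qi i)⁻¹ ^ n ≠ 0 := by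
    intro n hn h
    have hd : dd i ≠ 0 := by fin_cases i <;> simp [dd]
    have hz : qi i ≠ 0 := pow_ne_zero _ q_ne_zero
    apply q_pow_sub_one_ne_zero (n := dd i * (n * 2))
      (mul_ne_zero hd (mul_ne_zero hn two_ne_zero))
    rw [pow_mul, ← qi, pow_mul]
    rw [inv_pow] at h
    have := pow_ne_zero n hz
    field_simp at h
    simpa using h
  have h1 := key 1 one_ne_zero
  rw [pow_one, pow_one] at h1
  exact div_ne_zero (key n hn) h1

lemma barK_qInt (i : Fin 2) (n : ℕ) : barK (qInt i n) = qInt i n := by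
  have : barK (qi i) = (qi i)⁻¹ := by rw [qi, map_pow, barK_q, inv_pow]
  rw [qInt, map_div₀, map_sub, map_sub, map_pow, map_pow, map_inv₀, this, inv_inv,
    ← neg_sub (qi i ^ n), ← neg_sub (qi i), neg_div_neg_eq]

lemma qFact_ne_zero' (i : Fin 2) (n : ℕ) : qFact i n ≠ 0 :=
  Finset.prod_ne_zero_iff.mpr fun k _ => qInt_ne_zero i k.succ_ne_zero

lemma barK_qFact (i : Fin 2) (n : ℕ) : barK (qFact i n) = qFact i n := by
  rw [qFact, map_prod]
  exact Finset.prod_congr rfl fun k _ => barK_qInt i _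

/-- The product of the quantum factorials dividing the monomial in `pbw`. -/
def pbwFact (m : Fin 6 → ℕ) : K := ∏ k, qFact (redWord k) (m k)

lemma pbwFact_ne_zero (m : Fin 6 → ℕ) : pbwFact m ≠ 0 :=
  Finset.prod_ne_zero_iff.mpr fun _ _ => qFact_ne_zero' _ _

lemma barK_pbwFact (m : Fin 6 → ℕ) : barK (pbwFact m) = pbwFact m := by
  rw [pbwFact, map_prod]
  exact Finset.prod_congr rfl fun k _ => barK_qFact _ _

lemma pbw_eq (m : Fin 6 → ℕ) :
    pbw rootVec m = (pbwFact m)⁻¹ • ordMon rootSeq (extExp m) 6 := by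
  have h : ∀ (c : Fin 6 → K) (x : Fin 6 → Un),
      (List.ofFn fun k => c k • x k).prod = (∏ k, c k) • (List.ofFn x).prod := by
    intro c x
    simp only [List.ofFn_succ, List.ofFn_zero, List.prod_cons, List.prod_nil, Fin.prod_univ_succ,
      Fin.prod_univ_zero, smul_mul_assoc, mul_smul_comm, smul_smul, mul_one]
    congr 1
    ring
  rw [pbw]
  simp only [divPow]
  rw [h, pbwFact, Finset.prod_inv_distrib]
  congr 1
  simp only [List.ofFn_succ, List.ofFn_zero, List.prod_cons, List.prod_nil, ordMon, mul_one,
    one_mul,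
    mul_assoc]
  rfl

lemma linearIndependent_pbw : LinearIndependent K (pbw rootVec) := by
  have := linearIndependent_ordMon.units_smul fun m => (Units.mk0 _ (pbwFact_ne_zero m))⁻¹
  convert this using 1
  ext1 m
  rw [pbw_eq]
  rfl

lemma ordMon_mem_span_pbw (m : ℕ → ℕ) : ordMon rootSeq m 6 =
    pbwFact (fun k : Fin 6 => m k) • pbw rootVec (fun k : Fin 6 => m k) := by
  rw [pbw_eq, smul_inv_smul₀ (pbwFact_ne_zero _)]
  exact ordMon_congr _ fun i hi => (dif_pos (show i < 6 from hi) : extExp (fun k : Fin 6 => m k) i =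
    m i).symm

lemma span_pbw : ⊤ ≤ Submodule.span K (Set.range (pbw rootVec)) := by
  rw [← isConvexFamily_rootSeq.span_ordMon, Submodule.span_le]
  rintro _ ⟨m, rfl⟩
  change ordMon rootSeq m 6 ∈ _
  rw [ordMon_mem_span_pbw]
  exact Submodule.smul_mem _ _ (Submodule.subset_span ⟨_, rfl⟩)

/-- The PBW basis of `U_q(𝔫)`. -/
def pbwBasis : Module.Basis (Fin 6 → ℕ) K Un := Module.Basis.mk linearIndependent_pbw span_pbw

lemma pbwBasis_apply (m : Fin 6 → ℕ) : pbwBasis m = pbw rootVec m := Module.Basis.mk_apply _ _ m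

lemma Un.smul_sub (c : K) (x y : Un) : c • (x - y) = c • x - c • y := _root_.smul_sub c x y

/-- The bar involution is unitriangular on the PBW basis. -/
lemma bar_pbw_sub_mem (m : Fin 6 → ℕ) : bar (pbw rootVec m) - pbw rootVec m ∈
    Submodule.span K (pbwBasis '' {m' | toLex m < toLex m'}) := by
  have h := isConvexFamily_rootSeq.map_ordMon_sub_mem bar bar_rootSeq_sub_mem (extExp m)
  rw [pbw_eq, bar_smul, map_inv₀, barK_pbwFact, ← Un.smul_sub]
  refine Submodule.smul_mem _ _ ?_
  refine (Submodule.span_le.mpr ?_) h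
  rintro _ ⟨m', ⟨i, hi, hlt, hi'⟩, rfl⟩
  rw [ordMon_mem_span_pbw]
  refine Submodule.smul_mem _ _ (Submodule.subset_span ⟨_, ?_, pbwBasis_apply _⟩)
  refine ⟨⟨i, hi⟩, fun j hj => ?_, ?_⟩
  · have := hlt j hj
    simp only [extExp, j.isLt, dif_pos] at this
    exact this.symm
  · simpa [extExp, hi] using hi'

lemma bar_pbw_repr (m m' : Fin 6 → ℕ) (h : toLex m ≤ toLex m') :
    pbwBasis.repr (bar (pbw rootVec m')) m = if m = m' then 1 else 0 := by
  have h0 : pbwBasis.repr (bar (pbw rootVec m') - pbw rootVec m') m = 0 := by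
    have := pbwBasis.repr_support_subset_of_mem_span _ (bar_pbw_sub_mem m')
    by_contra hne
    exact absurd (this (Finsupp.mem_support_iff.mpr hne)) (not_lt.mpr h)
  rw [map_sub, Finsupp.sub_apply, sub_eq_zero, ← pbwBasis_apply, Module.Basis.repr_self] at h0
  rw [← pbwBasis_apply, h0, Finsupp.single_apply]
  simp [eq_comm]

lemma repr_mem_qIdeal {x : Un} (hx : x ∈ qLattice (Set.range (pbw rootVec))) (m : Fin 6 → ℕ) :
    pbwBasis.repr x m ∈ qIdeal := by
  induction hx using AddSubgroup.closure_induction with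
  | mem x hx =>
    obtain ⟨n, hn, _, ⟨m', rfl⟩, rfl⟩ := hx
    rw [map_smul, ← pbwBasis_apply, Module.Basis.repr_self, Finsupp.smul_single, smul_eq_mul,
      mul_one,
      Finsupp.single_apply]
    split_ifs
    exacts [q_pow_mem_qIdeal hn, zero_mem _]
  | zero => rw [map_zero]; exact zero_mem _
  | add x y _ _ hx hy => rw [map_add]; exact add_mem hx hy
  | neg x _ hx => rw [map_neg]; exact neg_mem hx

lemma bar_eq_sum (x : Un) : bar x =
    (pbwBasis.repr x).sum fun m c => barK c • bar (pbw rootVec m) := by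
  conv_lhs => rw [← pbwBasis.linearCombination_repr x, Finsupp.linearCombination_apply, Finsupp.sum,
    map_sum]
  exact Finset.sum_congr rfl fun m _ => by rw [bar_smul, pbwBasis_apply]

/-- The only bar-invariant vector in `q` times the `ℤ[q]`-lattice of the PBW basis is `0`. -/
lemma eq_zero_of_bar_eq {x : Un} (hx : bar x = x)
    (hq : x ∈ qLattice (Set.range (pbw rootVec))) : x = 0 := by
  by_contra hne
  have hs : (pbwBasis.repr x).support.Nonempty := by
    rw [Finsupp.support_nonempty_iff]
    exact fun h => hne ((LinearEquiv.map_eq_zero_iff _).mp h)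
  -- Compare the coefficients of `bar x = x` at the lexicographically smallest exponent of `x`.
  obtain ⟨m, hm, hmin⟩ := (pbwBasis.repr x).support.exists_min_image toLex hs
  refine Finsupp.mem_support_iff.mp hm (eq_zero_of_barK_eq (repr_mem_qIdeal hq m) ?_)
  have h := congrArg (fun y => pbwBasis.repr y m) (bar_eq_sum x)
  simp only [hx, Finsupp.sum, map_sum, Finsupp.finsetSum_apply, map_smul, Finsupp.smul_apply] at h
  rw [Finset.sum_eq_single_of_mem m hm fun m' hm' hne' => by
    rw [bar_pbw_repr m m' (hmin m' hm'), if_neg hne'.symm, smul_zero], bar_pbw_repr m m le_rfl,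
    if_pos rfl, smul_eq_mul, mul_one] at h
  exact h.symm

/-! ### The scalar product: symmetry and shuffle formula -/

/-- The product of generators along a list. -/
def wordProd (l : List (Fin 2)) : Un := (l.map e).prod

lemma wordProd_cons (i : Fin 2) (l : List (Fin 2)) : wordProd (i :: l) = e i * wordProd l := by
  simp [wordProd]

lemma span_wordProd : Submodule.span K (Set.range wordProd) = ⊤ := by
  have key : ∀ x y : Un, y ∈ Submodule.span K (Set.range wordProd) →
      x * y ∈ Submodule.span K (Set.range wordProd) := by
    intro x
    induction x using Un.induction with
    | h0 c => intro y hy; rw [← Algebra.smul_def]; exact Submodule.smul_mem _ _ hy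
    | h1 i =>
      intro y hy
      refine mul_span_mem _ ?_ hy
      rintro _ ⟨l, rfl⟩
      rw [← wordProd_cons]
      exact Submodule.subset_span ⟨_, rfl⟩
    | hm x x' hx hx' => intro y hy; rw [mul_assoc]; exact hx _ (hx' _ hy)
    | ha x x' hx hx' => intro y hy; rw [add_mul]; exact Submodule.add_mem _ (hx _ hy) (hx' _ hy)
  rw [eq_top_iff]
  intro x _
  rw [← mul_one x]
  exact key x 1 (Submodule.subset_span ⟨[], rfl⟩)

lemma ip_comm (i j : Fin 2) : ip i j = ip j i := by
  fin_cases i <;> fin_cases j <;> rfl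

lemma form_mul_e (i : Fin 2) (x y : Un) : form x (e i * y) = form (eDer i x) y := by
  have h : ∀ z : Un, (∀ i y, form z (e i * y) = form (eDer i z) y) →
      ∀ i y, form (x * z) (e i * y) = form (eDer i (x * z)) y := by
    induction x using Un.induction with
    | h0 c =>
      intro z hz i y
      rw [← Algebra.smul_def, map_smul, map_smul, map_smul, LinearMap.smul_apply,
        LinearMap.smul_apply,
        hz]
    | h1 j =>
      intro z hz i y
      rw [form_e_mul, eDer_e_mul, eDer_e_mul, map_add, map_add, LinearMap.add_apply, map_smul,
        map_smul,
        map_smul, map_smul, LinearMap.smul_apply, LinearMap.smul_apply, form_e_mul, hz, ip_comm]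
      by_cases hij : i = j
      · simp [hij]
      · simp [hij, Ne.symm hij]
    | hm a b ha hb =>
      intro z hz
      rw [mul_assoc]
      exact ha _ (hb z hz)
    | ha a b ha hb =>
      intro z hz i y
      rw [add_mul, map_add, map_add, map_add, LinearMap.add_apply, LinearMap.add_apply, ha z hz,
        hb z hz]
  have h1 : ∀ i y, form 1 (e i * y) = form (eDer i 1) y := by
    intro i y
    rw [eDer_one, map_zero, LinearMap.zero_apply]
    simp [form, counit, Un.lift_e]
  have := h 1 h1 i y
  rwa [mul_one] at this

lemma form_symm (x y : Un) : form x y = form y x := by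
  have h : ∀ z : Un, (∀ y, form z y = form y z) → ∀ y, form (x * z) y = form y (x * z) := by
    induction x using Un.induction with
    | h0 c =>
      intro z hz y
      rw [← Algebra.smul_def, map_smul, map_smul, LinearMap.smul_apply, hz]
    | h1 i => intro z hz y; rw [form_e_mul, form_mul_e, hz]
    | hm a b ha hb => intro z hz y; rw [mul_assoc]; exact ha _ (hb z hz) y
    | ha a b ha hb =>
      intro z hz y
      rw [add_mul, map_add, map_add, LinearMap.add_apply, ha z hz, hb z hz]
  have h1 : ∀ y, form 1 y = form y 1 := by
    intro y
    have hy : y ∈ Submodule.span K (Set.range wordProd) := span_wordProd ▸ Submodule.mem_top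
    refine LinearMap.eqOn_span (f := form 1) (g := form.flip 1) ?_ hy
    rintro _ ⟨l, rfl⟩
    cases l with
    | nil => rfl
    | cons i l =>
      rw [wordProd_cons, LinearMap.flip_apply, form_mul_e, form_e_mul, eDer_one, map_zero, map_zero,
        LinearMap.zero_apply]
  have := h 1 h1 y
  rwa [mul_one] at this

/-- Deletion of the last letter `k` (words not ending with `k` are sent to `0`). -/
def delLast (k : Fin 2) : Module.End K Words :=
  Finsupp.lcomapDomain (fun l => l ++ [k]) (List.append_left_injective [k])

lemma delLast_apply (k : Fin 2) (x : Words) (v : List (Fin 2)) : delLast k x v = x (v ++ [k]) := rfl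

lemma consL_apply_nil (i : Fin 2) (x : Words) : consL i x [] = 0 := by
  rw [consL, Finsupp.lmapDomain_apply, Finsupp.mapDomain_of_notMem_range _ _ (by simp)]

lemma consL_apply_cons (i j : Fin 2) (x : Words) (v : List (Fin 2)) :
    consL i x (j :: v) = (if i = j then x v else 0) := by
  split_ifs with h
  · subst h
    rw [consL, Finsupp.lmapDomain_apply, Finsupp.mapDomain_apply (List.cons_injective)]
  · rw [consL, Finsupp.lmapDomain_apply, Finsupp.mapDomain_of_notMem_range]
    rintro ⟨w, hw⟩
    exact h (List.cons.inj hw).1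

lemma delLast_consL (k j : Fin 2) (x : Words) :
    delLast k (consL j x) = consL j (delLast k x) + (if k = j then x [] else 0) • word [] := by
  ext v
  cases v with
  | nil =>
    rw [delLast_apply, List.nil_append, consL_apply_cons, Finsupp.add_apply, consL_apply_nil]
    by_cases h : k = j <;> simp [word, h, Ne.symm]
  | cons a v =>
    rw [delLast_apply, List.cons_append, consL_apply_cons, Finsupp.add_apply, consL_apply_cons,
      delLast_apply]
    split_ifs <;> simp_all [word]

lemma wtOp_apply (k : Fin 2) (x : Words) (v : List (Fin 2)) :
    wtOp k x v = q ^ (-(v.map (ip k)).sum) * x v := by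
  have h : Finsupp.lapply v ∘ₗ wtOp k = (q ^ (-(v.map (ip k)).sum)) • Finsupp.lapply (R :=
    K) v := by
    refine Finsupp.lhom_ext' fun u => LinearMap.ext_ring ?_
    change wtOp k (word u) v = q ^ (-(v.map (ip k)).sum) • (word u v)
    rw [wtOp_word, Finsupp.smul_apply]
    by_cases huv : u = v
    · rw [huv]
    · simp [word, Finsupp.single_apply, huv]
  exact LinearMap.congr_fun h x

lemma delLast_wtOp (k j : Fin 2) (x : Words) :
    delLast k (wtOp j x) = q ^ (-ip j k) • wtOp j (delLast k x) := by
  ext v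
  rw [delLast_apply, wtOp_apply, Finsupp.smul_apply, wtOp_apply, delLast_apply, smul_eq_mul,
    ← mul_assoc,
    ← zpow_add₀ q_ne_zero, List.map_append, List.sum_append]
  simp only [List.map_cons, List.map_nil, List.sum_cons, List.sum_nil]
  congr 2
  ring

lemma letterMul_consL (i j : Fin 2) (x : Words) :
    letterMul i (consL j x) = consL i (wtOp i (consL j x)) + consL j (letterMul i x) := by
  have h : letterMul i ∘ₗ consL j = consL i ∘ₗ wtOp i ∘ₗ consL j + consL j ∘ₗ letterMul i := by
    refine words_ext (f := letterMul i ∘ₗ consL j)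
      (g := consL i ∘ₗ wtOp i ∘ₗ consL j + consL j ∘ₗ letterMul i) fun v => ?_
    simp only [LinearMap.comp_apply, LinearMap.add_apply]
    rw [← word_cons, letterMul_cons, wtOp_word, map_smul, ← word_cons]
  exact LinearMap.congr_fun h x

lemma delLast_letterMul (k j : Fin 2) (x : Words) : delLast k (letterMul j x) =
    (if k = j then (1 : K) else 0) • x + q ^ (-ip k j) • letterMul j (delLast k x) := by
  have hnil : delLast k (word []) = 0 := by
    ext v
    rw [delLast_apply]
    simp [word]
  have h : delLast k * letterMul j =
      (if k = j then (1 : K) else 0) • 1 + q ^ (-ip k j) • (letterMul j * delLast k) := by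
    refine words_ext fun v => ?_
    simp only [Module.End.mul_apply, LinearMap.add_apply, LinearMap.smul_apply,
      Module.End.one_apply]
    induction v with
    | nil =>
      rw [letterMul_nil, word_cons, delLast_consL, hnil, map_zero, map_zero]
      simp [word]
    | cons b v ih =>
      have hw : (wtOp j (consL b (word v))) [] = 0 := by rw [wtOp_apply, consL_apply_nil, mul_zero]
      rw [word_cons, letterMul_consL, map_add, delLast_consL k j, delLast_consL k b, hw,
        letterMul_apply_nil, ih, delLast_wtOp, delLast_consL k b, map_add (letterMul j),
        letterMul_consL, map_smul (letterMul j), letterMul_nil, map_add (wtOp j), map_smul (wtOp j),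
        wtOp_word]
      simp only [map_add, map_smul, List.map_nil, List.sum_nil, neg_zero, zpow_zero, one_smul,
        ← word_cons, ip_comm j k, ite_self, zero_smul, add_zero]
      module
  exact LinearMap.congr_fun h x

lemma Phi_eDer (k : Fin 2) (x : Un) : Phi (eDer k x) = delLast k (Phi x) := by
  have hx : x ∈ Submodule.span K (Set.range wordProd) := span_wordProd ▸ Submodule.mem_top
  refine LinearMap.eqOn_span (f := Phi ∘ₗ eDer k) (g := delLast k ∘ₗ Phi) ?_ hx
  rintro _ ⟨l, rfl⟩
  simp only [LinearMap.comp_apply]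
  induction l with
  | nil =>
    rw [show wordProd [] = 1 from rfl, eDer_one, Phi_one, map_zero]
    ext v
    rw [delLast_apply]
    simp [word]
  | cons i l ih =>
    rw [wordProd_cons, eDer_e_mul, map_add, map_smul, map_smul, Phi_e_mul, Phi_e_mul, ih]
    exact (delLast_letterMul k i _).symm

lemma form_one_left (y : Un) : form 1 y = Phi y [] := by
  have hy : y ∈ Submodule.span K (Set.range wordProd) := span_wordProd ▸ Submodule.mem_top
  refine LinearMap.eqOn_span (f := form 1) (g := Finsupp.lapply (R := K) [] ∘ₗ Phi) ?_ hy
  rintro _ ⟨l, rfl⟩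
  change _ = Phi (wordProd l) []
  cases l with
  | nil => rw [show wordProd [] = 1 from rfl, form_one_one, Phi_one]; simp [word]
  | cons i l =>
    rw [wordProd_cons, form_mul_e, eDer_one, map_zero, LinearMap.zero_apply, Phi_e_mul]
    exact (letterMul_apply_nil i _).symm

/-- The scalar product with a word in the generators is a coefficient of the shuffle realization. -/
lemma form_wordProd (l : List (Fin 2)) (y : Un) : form (wordProd l) y = Phi y l.reverse := by
  induction l generalizing y with
  | nil => exact form_one_left y
  | cons i l ih =>
    rw [wordProd_cons, form_e_mul, ih, Phi_eDer, delLast_apply, List.reverse_cons]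

/-! ### Weight spaces -/

lemma wordProd_mem_weightSpace {l : List (Fin 2)} {ν : Fin 2 → ℕ} (h : ∀ i, l.count i = ν i) :
    wordProd l ∈ weightSpace ν := Submodule.subset_span ⟨l, h, rfl⟩

lemma weightSpace_le {ν : Fin 2 → ℕ} {N : Submodule K Un}
    (h : ∀ l : List (Fin 2), (∀ i, l.count i = ν i) → wordProd l ∈ N) : weightSpace ν ≤ N := by
  refine Submodule.span_le.mpr ?_
  rintro _ ⟨l, hl, rfl⟩
  exact h l hl

lemma mul_mem_weightSpace {ν ν' : Fin 2 → ℕ} {x y : Un} (hx : x ∈ weightSpace ν)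
    (hy : y ∈ weightSpace ν') : x * y ∈ weightSpace (ν + ν') := by
  refine span_mul_mem y ?_ hx
  rintro _ ⟨l, hl, rfl⟩
  refine mul_span_mem _ ?_ hy
  rintro _ ⟨l', hl', rfl⟩
  rw [← List.prod_append, ← List.map_append]
  exact wordProd_mem_weightSpace fun i => by rw [List.count_append, hl, hl', Pi.add_apply]

lemma one_mem_weightSpace : (1 : Un) ∈ weightSpace 0 :=
  wordProd_mem_weightSpace (l := []) fun _ => rfl

lemma pow_mem_weightSpace {ν : Fin 2 → ℕ} {x : Un} (hx : x ∈ weightSpace ν) (n : ℕ) :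
    x ^ n ∈ weightSpace (n • ν) := by
  induction n with
  | zero => rw [pow_zero, zero_smul]; exact one_mem_weightSpace
  | succ n ih => rw [pow_succ, succ_nsmul]; exact mul_mem_weightSpace ih hx

lemma sum_map_ip (k : Fin 2) (l : List (Fin 2)) :
    (l.map (ip k)).sum = ip k 0 * l.count 0 + ip k 1 * l.count 1 := by
  induction l with
  | nil => simp
  | cons i l ih =>
    rw [List.map_cons, List.sum_cons, ih]
    fin_cases i <;> simp <;> ring

lemma q_zpow_injective {a b : ℤ} (h : q ^ a = q ^ b) : a = b := by
  have key : ∀ n : ℕ, q ^ (n : ℤ) = 1 → n = 0 := fun n hn => by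
    by_contra h0
    exact q_pow_ne_one h0 (by rwa [zpow_natCast] at hn)
  have h1 : q ^ (a - b) = 1 := by rw [zpow_sub₀ q_ne_zero, h, div_self (zpow_ne_zero _ q_ne_zero)]
  obtain ⟨n, hn | hn⟩ := Int.eq_nat_or_neg (a - b)
  · rw [hn] at h1
    have := key n h1
    omega
  · rw [hn, zpow_neg, inv_eq_one] at h1
    have := key n h1
    omega

lemma wtOp_Phi_wordProd (k : Fin 2) (l : List (Fin 2)) :
    wtOp k (Phi (wordProd l)) = q ^ (-(l.map (ip k)).sum) • Phi (wordProd l) := by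
  induction l with
  | nil => rw [show wordProd [] = 1 from rfl, Phi_one, wtOp_word]
  | cons i l ih =>
    rw [wordProd_cons, Phi_e_mul]
    change wtOp k (letterMul i _) = _ • letterMul i _
    rw [wtOp_letterMul, ih, map_smul, smul_smul, ← zpow_add₀ q_ne_zero, List.map_cons,
      List.sum_cons,
      neg_add]

/-- Words in the generators of different weights are orthogonal: the weight is determined by the
scalars by which the operators `wtOp k` act, since the Cartan form is nondegenerate. -/
lemma form_wordProd_eq_zero {l l' : List (Fin 2)} (h : ¬ ∀ i, l.count i = l'.count i) :
    form (wordProd l) (wordProd l') = 0 := by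
  rw [form_wordProd]
  by_contra hne
  apply h
  have key : ∀ k, (l.map (ip k)).sum = (l'.map (ip k)).sum := by
    intro k
    have := DFunLike.congr_fun (wtOp_Phi_wordProd k l') l.reverse
    rw [wtOp_apply, Finsupp.smul_apply, smul_eq_mul, List.map_reverse, List.sum_reverse] at this
    exact neg_injective (q_zpow_injective (mul_right_cancel₀ hne this))
  have k0 := key 0
  have k1 := key 1
  rw [sum_map_ip, sum_map_ip] at k0 k1
  simp only [ip, Matrix.of_apply, Matrix.cons_val', Matrix.cons_val_zero, Matrix.cons_val_one,
    Matrix.cons_val_fin_one] at k0 k1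
  intro i
  fin_cases i <;> simp <;> omega

lemma form_eq_zero_of_weight_ne {ν ν' : Fin 2 → ℕ} (h : ν ≠ ν') {x y : Un} (hx : x ∈ weightSpace ν)
    (hy : y ∈ weightSpace ν') : form x y = 0 := by
  have h1 : weightSpace ν ≤ LinearMap.ker (form.flip y) := by
    refine weightSpace_le fun l hl => ?_
    have h2 : weightSpace ν' ≤ LinearMap.ker (form (wordProd l)) := by
      refine weightSpace_le fun l' hl' => ?_
      refine form_wordProd_eq_zero fun h3 => h ?_
      ext i
      rw [← hl, ← hl', h3]
    exact h2 hy
  exact h1 hx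

lemma bar_mem_weightSpace {ν : Fin 2 → ℕ} {x : Un} (hx : x ∈ weightSpace ν) :
    bar x ∈ weightSpace ν := by
  induction hx using Submodule.span_induction with
  | mem x hx =>
    obtain ⟨l, hl, rfl⟩ := hx
    have : bar (l.map e).prod = wordProd l := by
      rw [map_list_prod, List.map_map]
      congr 2
      ext1 i
      exact bar_e i
    rw [this]
    exact wordProd_mem_weightSpace hl
  | zero => rw [map_zero]; exact zero_mem _
  | add x y _ _ hx hy => rw [map_add]; exact add_mem hx hy
  | smul c x _ hx => rw [bar_smul]; exact Submodule.smul_mem _ _ hx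

/-- The positive roots in the convex order, in terms of the simple roots. -/
def rootWt (k : ℕ) : Fin 2 → ℕ :=
  match k with
  | 0 => ![1, 0]
  | 1 => ![3, 1]
  | 2 => ![2, 1]
  | 3 => ![3, 2]
  | 4 => ![1, 1]
  | _ => ![0, 1]

/-- The weight of `pbw rootVec m`. -/
def pbwWt (m : Fin 6 → ℕ) : Fin 2 → ℕ := ∑ k ∈ Finset.range 6, extExp m k • rootWt k

lemma e_mem_weightSpace (i : Fin 2) : e i ∈ weightSpace (Pi.single i 1) := by
  have := wordProd_mem_weightSpace (l := [i]) (ν := Pi.single i 1) fun j => by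
    by_cases h : i = j
    · simp [h]
    · simp [h, Ne.symm h]
  simpa [wordProd] using this

lemma rootSeq_mem_weightSpace (k : ℕ) (hk : k < 6) : rootSeq k ∈ weightSpace (rootWt k) := by
  have mul : ∀ {ν ν' ν'' : Fin 2 → ℕ} {x y : Un}, x ∈ weightSpace ν → y ∈ weightSpace ν' →
      ν + ν' = ν'' → x * y ∈ weightSpace ν'' := fun hx hy h => h ▸ mul_mem_weightSpace hx hy
  have h₀ : e 0 ∈ weightSpace (rootWt 0) := by
    convert e_mem_weightSpace 0 using 2; decide
  have h₅ : e 1 ∈ weightSpace (rootWt 5) := by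
    convert e_mem_weightSpace 1 using 2; decide
  have h₄ : rootAB (e 0) (e 1) ∈ weightSpace (rootWt 4) :=
    Submodule.sub_mem _ (mul h₅ h₀ (by decide)) (Submodule.smul_mem _ _ (mul h₀ h₅ (by decide)))
  have h₂ : rootAAB (e 0) (e 1) ∈ weightSpace (rootWt 2) :=
    Submodule.smul_mem _ _ (Submodule.sub_mem _ (mul h₄ h₀ (by decide))
      (Submodule.smul_mem _ _ (mul h₀ h₄ (by decide))))
  have h₁ : rootAAAB (e 0) (e 1) ∈ weightSpace (rootWt 1) :=
    Submodule.smul_mem _ _ (Submodule.sub_mem _ (mul h₂ h₀ (by decide))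
      (Submodule.smul_mem _ _ (mul h₀ h₂ (by decide))))
  have h₃ : rootAAABB (e 0) (e 1) ∈ weightSpace (rootWt 3) :=
    Submodule.smul_mem _ _ (Submodule.sub_mem _ (mul h₄ h₂ (by decide))
      (Submodule.smul_mem _ _ (mul h₂ h₄ (by decide))))
  interval_cases k
  exacts [h₀, h₁, h₂, h₃, h₄, h₅]

lemma pbw_mem_weightSpace (m : Fin 6 → ℕ) : pbw rootVec m ∈ weightSpace (pbwWt m) := by
  rw [pbw_eq]
  refine Submodule.smul_mem _ _ ?_
  rw [pbwWt]
  suffices H : ∀ n ≤ 6, ordMon rootSeq (extExp m) n ∈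
      weightSpace (∑ k ∈ Finset.range n, extExp m k • rootWt k) from H 6 le_rfl
  intro n hn
  induction n with
  | zero => exact one_mem_weightSpace
  | succ n ih =>
    rw [Finset.sum_range_succ]
    exact mul_mem_weightSpace (ih (by omega))
      (pow_mem_weightSpace (rootSeq_mem_weightSpace n (by omega)) _)

lemma serre_smul {A : Type*} [Ring A] [Algebra K A] {f : Fin 2 → A} (s : Fin 2 → K)
    (hf : ∀ i j, i ≠ j → serre i j (f i) (f j) = 0) :
    ∀ i j, i ≠ j → serre i j (s i • f i) (s j • f j) = 0 := by
  obtain ⟨h1, h2⟩ := (serre_iff f).mp hf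
  refine (serre_iff fun i => s i • f i).mpr ⟨?_, ?_⟩
  · simp only [smul_mul_assoc, mul_smul_comm]
    linear_combination (norm := skip) (s 0 ^ 4 * s 1) • h1
    match_scalars <;> ring
  · simp only [smul_mul_assoc, mul_smul_comm]
    linear_combination (norm := skip) (s 1 ^ 2 * s 0) • h2
    match_scalars <;> ring

/-- The algebra endomorphism of `U_q(𝔫)` rescaling the generators. -/
def rescale (s : Fin 2 → K) : Un →ₐ[K] Un := Un.lift (fun i => s i • e i) (serre_smul s serre_e)

lemma rescale_eq {ν : Fin 2 → ℕ} (s : Fin 2 → K) {x : Un} (hx : x ∈ weightSpace ν) :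
    rescale s x = (s 0 ^ ν 0 * s 1 ^ ν 1) • x := by
  have key : ∀ l : List (Fin 2), rescale s (wordProd l) =
      (s 0 ^ l.count 0 * s 1 ^ l.count 1) • wordProd l := by
    intro l
    induction l with
    | nil => simp [wordProd]
    | cons i l ih =>
      rw [wordProd_cons, map_mul, ih, rescale, Un.lift_e, smul_mul_smul_comm]
      congr 1
      fin_cases i <;> simp <;> ring
  refine LinearMap.eqOn_span (f := (rescale s).toLinearMap)
    (g := (s 0 ^ ν 0 * s 1 ^ ν 1) • LinearMap.id) ?_ hx
  rintro _ ⟨l, hl, rfl⟩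
  rw [← hl, ← hl]
  exact key l

/-- A weight vector only involves PBW vectors of its own weight. -/
lemma pbwWt_eq_of_repr_ne_zero {ν : Fin 2 → ℕ} {x : Un} (hx : x ∈ weightSpace ν) {m : Fin 6 → ℕ}
    (hm : pbwBasis.repr x m ≠ 0) : pbwWt m = ν := by
  have key : ∀ s : Fin 2 → K, s 0 ^ pbwWt m 0 * s 1 ^ pbwWt m 1 = s 0 ^ ν 0 * s 1 ^ ν 1 := by
    intro s
    have h1 : ∀ y : Un, pbwBasis.repr (rescale s y) m =
        s 0 ^ pbwWt m 0 * s 1 ^ pbwWt m 1 * pbwBasis.repr y m := by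
      intro y
      refine LinearMap.congr_fun (f := Finsupp.lapply m ∘ₗ pbwBasis.repr.toLinearMap ∘ₗ
        (rescale s).toLinearMap) (g := (s 0 ^ pbwWt m 0 * s 1 ^ pbwWt m 1) •
          (Finsupp.lapply m ∘ₗ pbwBasis.repr.toLinearMap)) (pbwBasis.ext fun m' => ?_) y
      change pbwBasis.repr (rescale s (pbwBasis m')) m = _ * pbwBasis.repr (pbwBasis m') m
      rw [pbwBasis_apply, rescale_eq s (pbw_mem_weightSpace m'), ← pbwBasis_apply, map_smul,
        Module.Basis.repr_self, Finsupp.smul_single, Finsupp.single_apply, Finsupp.single_apply]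
      split_ifs with h
      · rw [h, smul_eq_mul]
      · rw [mul_zero]
    have h2 := h1 x
    rw [rescale_eq s hx, map_smul, Finsupp.smul_apply, smul_eq_mul] at h2
    exact (mul_right_cancel₀ hm h2).symm
  have inj : ∀ a b : ℕ, q ^ a = q ^ b → a = b := fun a b h => by
    exact_mod_cast q_zpow_injective (a := a) (b := b) (by exact_mod_cast h)
  ext i
  fin_cases i
  · have := key ![q, 1]
    simp only [Matrix.cons_val_zero, Matrix.cons_val_one, one_pow, mul_one] at this
    exact inj _ _ this
  · have := key ![1, q]
    simp only [Matrix.cons_val_zero, Matrix.cons_val_one, one_pow, one_mul] at this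
    exact inj _ _ this

/-! ### Recognizing the canonical basis and its dual in one weight space -/

/-- The vector `pbw (p i) + ∑_{j > i} q P_{ij}(q) pbw (p j)`. -/
def triVec {n : ℕ} (p : Fin n → Fin 6 → ℕ) (P : Fin n → Fin n → Polynomial ℤ) (i : Fin n) : Un :=
  pbw rootVec (p i) + ∑ j ∈ Finset.Ioi i, (q * zPoly (P i j)) • pbw rootVec (p j)

/-- Data identifying the canonical basis of the weight space `ν` and its dual basis: the labels `p
i` of the PBW vectors of weight `ν`, the coefficients `P` of bar-invariant vectors in terms of the
PBW basis, and vectors `y i` dual to these. -/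
structure IsDualPair {n : ℕ} (ν : Fin 2 → ℕ) (p : Fin n → Fin 6 → ℕ)
    (P : Fin n → Fin n → Polynomial ℤ) (y : Fin n → Un) : Prop where
  inj : Function.Injective p
  wt_iff : ∀ m, pbwWt m = ν ↔ ∃ i, p i = m
  bar_triVec : ∀ i, bar (triVec p P i) = triVec p P i
  mem : ∀ i, y i ∈ weightSpace ν
  form_eq : ∀ i j, form (y i) (triVec p P j) = if i = j then 1 else 0

lemma mul_zPoly_smul_mem_qLattice {S : Set Un} {v : Un} (hv : v ∈ S) (P : Polynomial ℤ) :
    (q * zPoly P) • v ∈ qLattice S := by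
  induction P using Polynomial.induction_on' with
  | add P Q hP hQ => rw [map_add, mul_add, add_smul]; exact add_mem hP hQ
  | monomial n a =>
    have : (q * zPoly (Polynomial.monomial n a)) • v = a • (q ^ (n + 1) • v) := by
      rw [← Int.cast_smul_eq_zsmul K, smul_smul]
      congr 1
      simp [zPoly, pow_succ]
      ring
    rw [this]
    have h : q ^ (n + 1) • v ∈ qLattice S :=
      AddSubgroup.subset_closure ⟨n + 1, by omega, v, hv, rfl⟩
    exact AddSubgroup.zsmul_mem _ h a

lemma injective_of_finrank_le {V : Type*} [AddCommGroup V] [Module K V] [FiniteDimensional K V]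
    {n : ℕ} {f : V →ₗ[K] Fin n → K} (hn : Module.finrank K V ≤ n) (hf : Function.Surjective f) :
    Function.Injective f := by
  refine (LinearMap.injective_iff_surjective_of_finrank_eq_finrank ?_).mpr hf
  exact le_antisymm (by simpa using hn) (LinearMap.finrank_le_finrank_of_surjective hf)

namespace IsDualPair

variable {n : ℕ} {ν : Fin 2 → ℕ} {p : Fin n → Fin 6 → ℕ} {P : Fin n → Fin n → Polynomial ℤ}
  {y : Fin n → Un}

lemma triVec_mem_canonicalBasis (h : IsDualPair ν p P y) (i : Fin n) :
    triVec p P i ∈ canonicalBasis rootVec := by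
  refine ⟨h.bar_triVec i, p i, ?_⟩
  rw [triVec, add_sub_cancel_left]
  exact AddSubgroup.sum_mem _ fun j _ => mul_zPoly_smul_mem_qLattice (Set.mem_range_self (p j)) _

lemma pbw_eq_sub (i : Fin n) : pbw rootVec (p i) =
    triVec p P i - ∑ j ∈ Finset.Ioi i, (q * zPoly (P i j)) • pbw rootVec (p j) := by
  rw [triVec, add_sub_cancel_right]

/-- Downward induction: a property of the PBW vectors of the weight space follows from the same
property for the vectors `triVec`. -/
lemma pbw_induction {C : Fin n → Prop} (h : ∀ i, (∀ j, i < j → C j) → C i) (i : Fin n) : C i := by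
  induction i using WellFoundedGT.induction with
  | ind i ih => exact h i ih

lemma pbw_mem (h : IsDualPair ν p P y) (i : Fin n) : pbw rootVec (p i) ∈ weightSpace ν := by
  rw [← (h.wt_iff (p i)).mpr ⟨i, rfl⟩]
  exact pbw_mem_weightSpace _

lemma form_pbw_eq_zero (h : IsDualPair ν p P y) {x : Un} (hx : x ∈ weightSpace ν) {m : Fin 6 → ℕ}
    (hm : ∀ i, p i ≠ m) : form x (pbw rootVec m) = 0 :=
  form_eq_zero_of_weight_ne (fun hν => (not_exists.mpr hm) ((h.wt_iff m).mp hν.symm)) hx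
    (pbw_mem_weightSpace m)

/-- Modulo `qℤ[q]`, the vectors `y i` are dual to the PBW vectors. -/
lemma form_pbw_sub_mem (h : IsDualPair ν p P y) (i j : Fin n) :
    form (y i) (pbw rootVec (p j)) - (if i = j then 1 else 0) ∈ qIdeal := by
  induction j using pbw_induction with
  | h j ih =>
    rw [pbw_eq_sub (P := P) j, map_sub, h.form_eq, sub_sub_cancel_left, map_sum]
    refine neg_mem (sum_mem fun k hk => ?_)
    rw [map_smul, smul_eq_mul]
    refine mul_mem_qIdeal (mem_qIdeal.mpr ⟨_, rfl⟩) ?_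
    have := mem_range_of_mem_qIdeal (ih k (Finset.mem_Ioi.mp hk))
    rw [← sub_add_cancel (form (y i) (pbw rootVec (p k))) (if i = k then 1 else 0)]
    refine add_mem this ?_
    split_ifs
    exacts [one_mem _, zero_mem _]

lemma form_qLattice_mem (h : IsDualPair ν p P y) (i : Fin n) {x : Un}
    (hx : x ∈ qLattice (Set.range (pbw rootVec))) : form (y i) x ∈ qIdeal := by
  induction hx using AddSubgroup.closure_induction with
  | mem x hx =>
    obtain ⟨k, hk, _, ⟨m, rfl⟩, rfl⟩ := hx
    rw [map_smul, smul_eq_mul]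
    refine mul_mem_qIdeal (q_pow_mem_qIdeal hk) ?_
    by_cases hm : ∃ j, p j = m
    · obtain ⟨j, rfl⟩ := hm
      rw [← sub_add_cancel (form (y i) (pbw rootVec (p j))) (if i = j then 1 else 0)]
      refine add_mem (mem_range_of_mem_qIdeal (h.form_pbw_sub_mem i j)) ?_
      split_ifs
      exacts [one_mem _, zero_mem _]
    · rw [h.form_pbw_eq_zero (h.mem i) (not_exists.mp hm)]
      exact zero_mem _
  | zero => rw [map_zero]; exact zero_mem _
  | add x y _ _ hx hy => rw [map_add]; exact add_mem hx hy
  | neg x _ hx => rw [map_neg]; exact neg_mem hx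

/-- The functional `(y i, ·)` commutes with the bar involutions, as `y i` is dual to bar-invariant
vectors. -/
lemma form_bar (h : IsDualPair ν p P y) (i : Fin n) (x : Un) :
    form (y i) (bar x) = barK (form (y i) x) := by
  have hp : ∀ j, form (y i) (bar (pbw rootVec (p j))) = barK (form (y i) (pbw rootVec (p j))) := by
    intro j
    induction j using pbw_induction with
    | h j ih =>
      rw [pbw_eq_sub (P := P) j, map_sub, map_sub, map_sub, map_sub, h.bar_triVec, h.form_eq,
        map_sum,
        map_sum, map_sum, map_sum]
      congr 1
      · split_ifs <;> simp
      · refine Finset.sum_congr rfl fun k hk => ?_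
        rw [bar_smul, map_smul, map_smul, smul_eq_mul, smul_eq_mul, ih k (Finset.mem_Ioi.mp hk),
          ← map_mul]
  rw [← pbwBasis.linearCombination_repr x, Finsupp.linearCombination_apply, Finsupp.sum, map_sum,
    map_sum, map_sum, map_sum]
  refine Finset.sum_congr rfl fun m _ => ?_
  rw [bar_smul, map_smul, map_smul, smul_eq_mul, smul_eq_mul, map_mul, pbwBasis_apply]
  congr 1
  by_cases hm : ∃ j, p j = m
  · obtain ⟨j, rfl⟩ := hm
    exact hp j
  · have hν : ν ≠ pbwWt m := fun hν => hm ((h.wt_iff m).mp hν.symm)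
    rw [form_eq_zero_of_weight_ne hν (h.mem i) (pbw_mem_weightSpace m), map_zero,
      form_eq_zero_of_weight_ne hν (h.mem i) (bar_mem_weightSpace (pbw_mem_weightSpace m))]

/-- The vector `y i` is orthogonal to the canonical basis vectors other than `triVec p P i`: the
pairing is bar-invariant and lies in `qℤ[q]`. -/
lemma form_canonicalBasis (h : IsDualPair ν p P y) (i : Fin n) {x : Un}
    (hx : x ∈ canonicalBasis rootVec) (hne : x ≠ triVec p P i) : form (y i) x = 0 := by
  obtain ⟨hbar, m, hm⟩ := hx
  have hb : barK (form (y i) x) = form (y i) x := by rw [← h.form_bar, hbar]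
  have hl := h.form_qLattice_mem i hm
  rw [map_sub] at hl
  have hmi : m ≠ p i := by
    rintro rfl
    refine hne (sub_eq_zero.mp (eq_zero_of_bar_eq ?_ ?_))
    · rw [map_sub, hbar, h.bar_triVec]
    · have : x - triVec p P i = (x - pbw rootVec (p i)) -
          ∑ j ∈ Finset.Ioi i, (q * zPoly (P i j)) • pbw rootVec (p j) := by
        rw [triVec]; abel
      rw [this]
      exact sub_mem hm (AddSubgroup.sum_mem _ fun j _ => mul_zPoly_smul_mem_qLattice
        (Set.mem_range_self (p j)) _)
  have h0 : form (y i) (pbw rootVec m) ∈ qIdeal := by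
    by_cases hm' : ∃ j, p j = m
    · obtain ⟨j, rfl⟩ := hm'
      have := h.form_pbw_sub_mem i j
      rwa [if_neg (by rintro rfl; exact hmi rfl), sub_zero] at this
    · rw [h.form_pbw_eq_zero (h.mem i) (not_exists.mp hm')]
      exact zero_mem _
  exact eq_zero_of_barK_eq (by simpa using add_mem hl h0) hb

lemma mem_dualCanonicalBasis (h : IsDualPair ν p P y) (i : Fin n) :
    y i ∈ dualCanonicalBasis rootVec :=
  ⟨⟨ν, h.mem i⟩, triVec p P i, h.triVec_mem_canonicalBasis i, by rw [h.form_eq, if_pos rfl],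
    fun _ hx hne => h.form_canonicalBasis i hx hne⟩

/-- The dual PBW vector with label `p i`. -/
lemma isDualPBW (h : IsDualPair ν p P y) (i : Fin n) :
    IsDualPBW rootVec (p i) (y i + ∑ k ∈ Finset.Iio i, (q * zPoly (P k i)) • y k) := by
  set x := y i + ∑ k ∈ Finset.Iio i, (q * zPoly (P k i)) • y k with hx
  have hmem : x ∈ weightSpace ν :=
    add_mem (h.mem i) (sum_mem fun k _ => Submodule.smul_mem _ _ (h.mem k))
  have htri : ∀ j, form x (triVec p P j) =
      if i = j then 1 else if j < i then q * zPoly (P j i) else 0 := by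
    intro j
    simp only [hx, map_add, LinearMap.add_apply, map_sum, LinearMap.sum_apply, map_smul,
      LinearMap.smul_apply, h.form_eq, smul_eq_mul, mul_ite, mul_one, mul_zero, Finset.sum_ite_eq',
      Finset.mem_Iio]
    rcases lt_trichotomy j i with hji | rfl | hij
    · simp [hji, hji.ne']
    · simp
    · simp [hij.ne, not_lt_of_gt hij]
  have hpbw : ∀ j, form x (pbw rootVec (p j)) = if i = j then 1 else 0 := by
    intro j
    induction j using pbw_induction with
    | h j ih =>
      rw [pbw_eq_sub (P := P) j, map_sub, htri, map_sum]
      have : ∀ k ∈ Finset.Ioi j, form x ((q * zPoly (P j k)) • pbw rootVec (p k)) =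
          if i = k then q * zPoly (P j k) else 0 := by
        intro k hk
        rw [map_smul, ih k (Finset.mem_Ioi.mp hk), smul_eq_mul]
        split_ifs <;> simp
      rw [Finset.sum_congr rfl this, Finset.sum_ite_eq]
      rcases lt_trichotomy j i with hji | rfl | hij
      · simp [hji, hji.ne']
      · simp
      · simp [hij.ne, not_lt_of_gt hij]
  refine ⟨⟨ν, hmem⟩, by rw [hpbw, if_pos rfl], fun m hm => ?_⟩
  by_cases hm' : ∃ j, p j = m
  · obtain ⟨j, rfl⟩ := hm'
    rw [hpbw, if_neg (by rintro rfl; exact hm rfl)]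
  · exact h.form_pbw_eq_zero hmem (not_exists.mp hm')

/-- A vector of weight `ν` orthogonal to all `triVec p P j` vanishes: the weight space has dimension
at most `n`, being spanned by `n` PBW vectors, while the pairings with `triVec p P j` take all
values. -/
lemma eq_zero_of_form_eq_zero (h : IsDualPair ν p P y) {x : Un} (hx : x ∈ weightSpace ν)
    (h0 : ∀ j, form x (triVec p P j) = 0) : x = 0 := by
  have hspan : weightSpace ν ≤ Submodule.span K (Set.range fun i => pbw rootVec (p i)) := by
    intro z hz
    rw [← pbwBasis.linearCombination_repr z, Finsupp.linearCombination_apply]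
    refine sum_mem fun m hm => Submodule.smul_mem _ _ (Submodule.subset_span ?_)
    obtain ⟨i, rfl⟩ := (h.wt_iff m).mp (pbwWt_eq_of_repr_ne_zero hz (Finsupp.mem_support_iff.mp hm))
    exact ⟨i, (pbwBasis_apply _).symm⟩
  have hfin : FiniteDimensional K (Submodule.span K (Set.range fun i => pbw rootVec (p i))) :=
    FiniteDimensional.span_of_finite K (Set.finite_range _)
  have hdim : Module.finrank K (weightSpace ν) ≤ n :=
    (Submodule.finrank_mono hspan).trans ((finrank_range_le_card (R := K)
      fun i => pbw rootVec (p i)).trans_eq (Fintype.card_fin n))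
  have : FiniteDimensional K (weightSpace ν) := Submodule.finiteDimensional_of_le hspan
  let f : weightSpace ν →ₗ[K] (Fin n → K) :=
    LinearMap.pi fun j => (form.flip (triVec p P j)) ∘ₗ (weightSpace ν).subtype
  have hsurj : Function.Surjective f := by
    intro c
    refine ⟨∑ i, c i • ⟨y i, h.mem i⟩, ?_⟩
    ext j
    simp [f, h.form_eq]
  have hinj : Function.Injective f := injective_of_finrank_le (V := weightSpace ν) (f :=
    f) hdim hsurj
  have : (⟨x, hx⟩ : weightSpace ν) = 0 := hinj (by
    rw [map_zero]
    ext j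
    exact h0 j)
  exact congrArg Subtype.val this

/-- The dual canonical basis vector with label `p i` is `y i`. -/
lemma isDualCanonical_iff (h : IsDualPair ν p P y) (i : Fin n) (z : Un) :
    IsDualCanonical rootVec (p i) z ↔ z = y i := by
  constructor
  · rintro ⟨hz, x, hx, hzx⟩
    have hcan : ∀ {b c : Un}, b ∈ dualCanonicalBasis rootVec → c ∈ canonicalBasis rootVec →
        form b c = 0 ∨ form b c = 1 := by
      rintro b c ⟨-, c', -, h1, h0⟩ hc
      by_cases hcc : c = c'
      · right; rw [hcc, h1]
      · left; exact h0 c hc hcc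
    have hl : ∀ {w : Un}, w ∈ qLattice (dualCanonicalBasis rootVec) →
        form w (triVec p P i) ∈ qIdeal := by
      intro w hw
      induction hw using AddSubgroup.closure_induction with
      | mem w hw =>
        obtain ⟨k, hk, b, hb, rfl⟩ := hw
        rw [map_smul, LinearMap.smul_apply, smul_eq_mul]
        refine mul_mem_qIdeal (q_pow_mem_qIdeal hk) ?_
        rcases hcan hb (h.triVec_mem_canonicalBasis i) with h' | h' <;> rw [h']
        exacts [zero_mem _, one_mem _]
      | zero => rw [map_zero]; exact zero_mem _
      | add x y _ _ hx hy => rw [map_add, LinearMap.add_apply]; exact add_mem hx hy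
      | neg x _ hx => rw [map_neg, LinearMap.neg_apply]; exact neg_mem hx
    have hxi : form x (triVec p P i) = 1 := by
      rw [triVec, map_add, hx.2.1, map_sum, Finset.sum_eq_zero, add_zero]
      intro j hj
      rw [map_smul, hx.2.2 _ fun hji => (Finset.mem_Ioi.mp hj).ne' (h.inj hji), smul_zero]
    have hzi := hl hzx
    rw [map_sub, LinearMap.sub_apply, hxi] at hzi
    obtain ⟨⟨ν', hν'⟩, c, hc, h1, h0⟩ := hz
    have hci : triVec p P i = c := by
      by_contra hne
      rw [h0 _ (h.triVec_mem_canonicalBasis i) hne, zero_sub] at hzi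
      exact one_notMem_qIdeal (by simpa using neg_mem hzi)
    have htri : triVec p P i ∈ weightSpace ν :=
      add_mem (h.pbw_mem i) (sum_mem fun j _ => Submodule.smul_mem _ _ (h.pbw_mem j))
    have hνν : ν' = ν := by
      by_contra hne
      rw [← hci, form_eq_zero_of_weight_ne hne hν' htri] at h1
      exact zero_ne_one h1
    subst hνν
    refine sub_eq_zero.mp (h.eq_zero_of_form_eq_zero (sub_mem hν' (h.mem i)) fun j => ?_)
    rw [map_sub, LinearMap.sub_apply, h.form_eq]
    split_ifs with hij
    · rw [← hij, hci, h1, sub_self]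
    · rw [h0 _ (h.triVec_mem_canonicalBasis j), sub_zero]
      intro hjc
      have h2 := h.form_eq i j
      rw [hjc, ← hci, h.form_eq, if_pos rfl, if_neg hij] at h2
      exact one_ne_zero h2
  · rintro rfl
    refine ⟨h.mem_dualCanonicalBasis i, _, h.isDualPBW i, ?_⟩
    rw [sub_add_cancel_left]
    exact neg_mem (AddSubgroup.sum_mem _ fun k _ =>
      mul_zPoly_smul_mem_qLattice (h.mem_dualCanonicalBasis k) _)

/-- A vector with nonzero pairing with two canonical basis vectors is not a multiple of a dual
canonical basis vector. -/
lemma notMem_qPowersDual (h : IsDualPair ν p P y) {i j : Fin n} (hij : i ≠ j) {z : Un}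
    (hi : form z (triVec p P i) ≠ 0) (hj : form z (triVec p P j) ≠ 0) :
    z ∉ qPowersDual rootVec := by
  rintro ⟨k, b, ⟨-, c, -, -, h0⟩, rfl⟩
  have key : ∀ l, form (q ^ k • b) (triVec p P l) ≠ 0 → triVec p P l = c := by
    intro l hl
    by_contra hne
    rw [map_smul, LinearMap.smul_apply, h0 _ (h.triVec_mem_canonicalBasis l) hne, smul_zero] at hl
    exact hl rfl
  have h2 := h.form_eq i j
  rw [key j hj, ← key i hi, h.form_eq, if_pos rfl, if_neg hij] at h2
  exact one_ne_zero h2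

end IsDualPair

/-! ### Vectors with prescribed shuffle realization

The vectors below are obtained from the generators by `q`-commutators and products. The name of each
records a word occurring in its shuffle realization. -/

lemma ip_vals : ip 0 0 = 2 ∧ ip 0 1 = -3 ∧ ip 1 0 = -3 ∧ ip 1 1 = 6 := ⟨rfl, rfl, rfl, rfl⟩

lemma shuffle_word_cons (i j : Fin 2) (u v : List (Fin 2)) :
    shuffle (word (i :: u)) (word (j :: v)) =
      q ^ (-((j :: v).map (ip i)).sum) • consL i (shuffle (word u) (word (j :: v))) +
        consL j (shuffle (word (i :: u)) (word v)) := by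
  rw [shuffle_cons, wtOp_word, map_smul, map_smul]

lemma consL_word (i : Fin 2) (v : List (Fin 2)) : consL i (word v) = word (i :: v) :=
  (word_cons i v).symm

lemma Phi_e (i : Fin 2) : Phi (e i) = word [i] := by
  have := Phi_e_mul i 1
  rwa [mul_one, Phi_one, shuffle_nil_right] at this

lemma one_sub_q_pow_ne_zero {n : ℕ} (hn : n ≠ 0) : 1 - q ^ n ≠ 0 :=
  fun h => q_pow_sub_one_ne_zero hn (by linear_combination -h)

lemma one_sub_inv_pow_ne_zero {n : ℕ} (hn : n ≠ 0) : 1 - q⁻¹ ^ n ≠ 0 := by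
  intro h
  apply q_pow_sub_one_ne_zero hn
  have := pow_ne_zero n q_ne_zero
  rw [inv_pow] at h
  field_simp at h
  linear_combination h

lemma q_pow_sub_inv_pow_ne_zero {n : ℕ} (hn : n ≠ 0) : q ^ n - q⁻¹ ^ n ≠ 0 := by
  intro h
  apply q_pow_sub_one_ne_zero (n := n * 2) (by omega)
  have := pow_ne_zero n q_ne_zero
  rw [inv_pow] at h
  field_simp at h
  rw [pow_mul]
  linear_combination h

/-- The vector with shuffle realization `w[0, 1]`. -/
def dual01 : Un :=
  (1 - q ^ 6)⁻¹ • (e 1 * e 0 - q ^ 3 • (e 0 * e 1))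

lemma Phi_dual01 : Phi dual01 =
    word [0, 1] := by
  have hq := q_ne_zero
  obtain ⟨i00, i01, i10, i11⟩ := ip_vals
  rw [dual01, map_smul, inv_smul_eq_iff₀ (one_sub_q_pow_ne_zero (n := 6) (by norm_num))]
  simp [Phi_mul, Phi_e, shuffle_word_cons, shuffle_nil_left, shuffle_nil_right, consL_word, i00,
    i01, i10, i11]
  match_scalars <;> field_simp <;> ring

/-- The vector with shuffle realization `w[1, 0]`. -/
def dual10 : Un :=
  e 0 * e 1 - q ^ 3 • dual01

lemma Phi_dual10 : Phi dual10 =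
    word [1, 0] := by
  have hq := q_ne_zero
  obtain ⟨i00, i01, i10, i11⟩ := ip_vals
  rw [dual10]
  simp [Phi_dual01, Phi_mul, Phi_e, shuffle_word_cons, shuffle_nil_left, shuffle_nil_right,
    consL_word, i00, i01, i10, i11]

/-- The vector with shuffle realization `(q + q⁻¹) w[0, 0, 1]`. -/
def dual001 : Un :=
  (q ^ 2 - q⁻¹ ^ 2)⁻¹ • (e 0 * dual01 - q⁻¹ • (dual01 * e 0))

lemma Phi_dual001 : Phi dual001 =
    (q + q⁻¹) • word [0, 0, 1] := by
  have hq := q_ne_zero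
  obtain ⟨i00, i01, i10, i11⟩ := ip_vals
  rw [dual001, map_smul, inv_smul_eq_iff₀ (q_pow_sub_inv_pow_ne_zero (n := 2) (by norm_num))]
  simp [Phi_dual01, Phi_mul, Phi_e, shuffle_word_cons, shuffle_nil_left, shuffle_nil_right,
    consL_word, i00, i01, i10, i11]
  match_scalars <;> field_simp <;> ring

/-- The vector with shuffle realization `w[0, 1, 0]`. -/
def dual010 : Un :=
  e 0 * dual01 - q ^ 2 • dual001

lemma Phi_dual010 : Phi dual010 =
    word [0, 1, 0] := by
  have hq := q_ne_zero
  obtain ⟨i00, i01, i10, i11⟩ := ip_vals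
  rw [dual010]
  simp [Phi_dual01, Phi_dual001, Phi_mul, Phi_e, shuffle_word_cons, shuffle_nil_left,
    shuffle_nil_right, consL_word, i00, i01, i10, i11]
  match_scalars <;> field_simp <;> ring

/-- The vector with shuffle realization `(q + q⁻¹) w[1, 0, 0]`. -/
def dual100 : Un :=
  q • (e 0 * dual10) - q ^ 2 • dual010

lemma Phi_dual100 : Phi dual100 =
    (q + q⁻¹) • word [1, 0, 0] := by
  have hq := q_ne_zero
  obtain ⟨i00, i01, i10, i11⟩ := ip_vals
  rw [dual100]
  simp [Phi_dual10, Phi_dual010, Phi_mul, Phi_e, shuffle_word_cons, shuffle_nil_left,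
    shuffle_nil_right, consL_word, i00, i01, i10, i11]
  match_scalars <;> field_simp <;> ring

/-- The vector with shuffle realization `(q + q⁻¹) w[1, 0, 0, 1]`. -/
def dual1001 : Un :=
  (1 - q⁻¹ ^ 6)⁻¹ • (dual100 * e 1 - q⁻¹ ^ 6 • (e 1 * dual100))

lemma Phi_dual1001 : Phi dual1001 =
    (q + q⁻¹) • word [1, 0, 0, 1] := by
  have hq := q_ne_zero
  obtain ⟨i00, i01, i10, i11⟩ := ip_vals
  rw [dual1001, map_smul, inv_smul_eq_iff₀ (one_sub_inv_pow_ne_zero (n := 6) (by norm_num))]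
  simp [Phi_dual100, Phi_mul, Phi_e, shuffle_word_cons, shuffle_nil_left, shuffle_nil_right,
    consL_word, i00, i01, i10, i11]
  match_scalars <;> field_simp <;> ring

/-- The vector with shuffle realization `(q + q⁻¹) w[0, 1, 0, 0, 1]`. -/
def dual01001 : Un :=
  (1 - q⁻¹ ^ 2)⁻¹ • (dual010 * dual01 - q⁻¹ • (dual01 * dual010))

lemma Phi_dual01001 : Phi dual01001 =
    (q + q⁻¹) • word [0, 1, 0, 0, 1] := by
  have hq := q_ne_zero
  obtain ⟨i00, i01, i10, i11⟩ := ip_vals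
  rw [dual01001, map_smul, inv_smul_eq_iff₀ (one_sub_inv_pow_ne_zero (n := 2) (by norm_num))]
  simp [Phi_dual010, Phi_dual01, Phi_mul, Phi_e, shuffle_word_cons, shuffle_nil_left,
    shuffle_nil_right, consL_word, i00, i01, i10, i11]
  match_scalars <;> field_simp <;> ring

/-- The vector with shuffle realization `(q + q⁻¹) w[1, 0, 0, 1, 0]`. -/
def dual10010 : Un :=
  (1 - q⁻¹ ^ 2)⁻¹ • (dual10 * dual010 - q⁻¹ • (dual010 * dual10))

lemma Phi_dual10010 : Phi dual10010 =
    (q + q⁻¹) • word [1, 0, 0, 1, 0] := by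
  have hq := q_ne_zero
  obtain ⟨i00, i01, i10, i11⟩ := ip_vals
  rw [dual10010, map_smul, inv_smul_eq_iff₀ (one_sub_inv_pow_ne_zero (n := 2) (by norm_num))]
  simp [Phi_dual010, Phi_dual10, Phi_mul, Phi_e, shuffle_word_cons, shuffle_nil_left,
    shuffle_nil_right, consL_word, i00, i01, i10, i11]
  match_scalars <;> field_simp <;> ring

/-- A vector whose shuffle realization involves only `w[0, 0, 0, 1, 1]` and `w[0, 0, 1, 0, 1]`. -/
def dual00101 : Un :=
  q⁻¹ • (dual001 * dual01) - q⁻¹ • dual01001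

lemma Phi_dual00101 : Phi dual00101 =
    (q⁻¹ ^ 6 + 2 * q⁻¹ ^ 4 + 2 * q⁻¹ ^ 2 + 2 + 2 * q ^ 2 + 2 * q ^ 4 + q ^ 6) •
        word [0, 0, 0, 1, 1] +
      (q⁻¹ ^ 3 + 2 * q⁻¹ + 2 * q + q ^ 3) • word [0, 0, 1, 0, 1] := by
  have hq := q_ne_zero
  obtain ⟨i00, i01, i10, i11⟩ := ip_vals
  rw [dual00101]
  simp [Phi_dual001, Phi_dual01, Phi_dual01001, Phi_mul, Phi_e, shuffle_word_cons,
    shuffle_nil_left, shuffle_nil_right, consL_word, i00, i01, i10, i11]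
  match_scalars <;> field_simp <;> ring

/-- A vector whose shuffle realization is a multiple of `w[1, 0, 0, 0, 1]`. -/
def dual10001 : Un :=
  q⁻¹ • (e 0 * dual1001) - q • dual01001 - q⁻¹ • dual10010

lemma Phi_dual10001 : Phi dual10001 =
    (q⁻¹ ^ 3 + 2 * q⁻¹ + 2 * q + q ^ 3) • word [1, 0, 0, 0, 1] := by
  have hq := q_ne_zero
  obtain ⟨i00, i01, i10, i11⟩ := ip_vals
  rw [dual10001]
  simp [Phi_dual1001, Phi_dual01001, Phi_dual10010, Phi_mul, Phi_e, shuffle_word_cons,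
    shuffle_nil_left, shuffle_nil_right, consL_word, i00, i01, i10, i11]
  match_scalars <;> field_simp <;> ring

/-- A vector whose shuffle realization involves only `w[1, 0, 1, 0, 0]` and `w[1, 1, 0, 0, 0]`. -/
def dual11000 : Un :=
  q⁻¹ • (dual10 * dual100) - q⁻¹ • dual10010

lemma Phi_dual11000 : Phi dual11000 =
    (q⁻¹ ^ 3 + 2 * q⁻¹ + 2 * q + q ^ 3) • word [1, 0, 1, 0, 0] +
      (q⁻¹ ^ 6 + 2 * q⁻¹ ^ 4 + 2 * q⁻¹ ^ 2 + 2 + 2 * q ^ 2 + 2 * q ^ 4 + q ^ 6) •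
        word [1, 1, 0, 0, 0] := by
  have hq := q_ne_zero
  obtain ⟨i00, i01, i10, i11⟩ := ip_vals
  rw [dual11000]
  simp [Phi_dual10, Phi_dual100, Phi_dual10010, Phi_mul, Phi_e, shuffle_word_cons,
    shuffle_nil_left, shuffle_nil_right, consL_word, i00, i01, i10, i11]
  match_scalars <;> field_simp <;> ring

/-! ### The dual canonical basis in weight `4α₁ + 2α₂` -/

/-- The dual canonical basis vector `𝐛(0, 0, 2, 0, 0, 0)`. -/
def dual001001 : Un :=
  (q ^ 3 - q⁻¹ ^ 3)⁻¹ • (e 0 * dual00101 - dual00101 * e 0)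

lemma Phi_dual001001 : Phi dual001001 =
      (q⁻¹ ^ 9 + 3 * q⁻¹ ^ 7 + 5 * q⁻¹ ^ 5 + 7 * q⁻¹ ^ 3 + 8 * q⁻¹ + 8 * q + 7 * q ^ 3 + 5 * q ^ 5 +
        3 * q ^ 7 + q ^ 9) • word [0, 0, 0, 0, 1, 1] +
      (q⁻¹ ^ 6 + 3 * q⁻¹ ^ 4 + 5 * q⁻¹ ^ 2 + 6 + 5 * q ^ 2 + 3 * q ^ 4 + q ^ 6) •
        word [0, 0, 0, 1, 0, 1] +
      (q⁻¹ ^ 3 + 3 * q⁻¹ + 3 * q + q ^ 3) • word [0, 0, 1, 0, 0, 1] := by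
  have hq := q_ne_zero
  obtain ⟨i00, i01, i10, i11⟩ := ip_vals
  rw [dual001001, map_smul, inv_smul_eq_iff₀ (q_pow_sub_inv_pow_ne_zero (n := 3) (by norm_num))]
  simp [Phi_dual00101, Phi_mul, Phi_e, shuffle_word_cons, shuffle_nil_left, shuffle_nil_right,
    consL_word, i00, i01, i10, i11]
  match_scalars <;> field_simp <;> ring

/-- The dual canonical basis vector `𝐛(0, 1, 0, 0, 1, 0)`. -/
def dual010001 : Un :=
  (q - q⁻¹)⁻¹ • (e 0 * dual01001 - dual01001 * e 0)

lemma Phi_dual010001 : Phi dual010001 =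
      (q ^ 2 + 2 + q⁻¹ ^ 2) • word [0, 0, 1, 0, 0, 1] +
      (q⁻¹ ^ 3 + 2 * q⁻¹ + 2 * q + q ^ 3) • word [0, 1, 0, 0, 0, 1] := by
  have hq := q_ne_zero
  obtain ⟨i00, i01, i10, i11⟩ := ip_vals
  rw [dual010001, map_smul, inv_smul_eq_iff₀ (q_sub_inv_ne_zero)]
  simp [Phi_dual01001, Phi_mul, Phi_e, shuffle_word_cons, shuffle_nil_left, shuffle_nil_right,
    consL_word, i00, i01, i10, i11]
  match_scalars <;> field_simp <;> ring

/-- The dual canonical basis vector `𝐛(1, 0, 0, 1, 0, 0)`. -/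
def dual001010 : Un :=
  e 0 * dual00101 - q ^ 3 • dual001001

lemma Phi_dual001010 : Phi dual001010 =
      (q⁻¹ ^ 3 + 2 * q⁻¹ + 2 * q + q ^ 3) • word [0, 0, 0, 1, 0, 1] +
      (q⁻¹ ^ 6 + 2 * q⁻¹ ^ 4 + 2 * q⁻¹ ^ 2 + 2 + 2 * q ^ 2 + 2 * q ^ 4 + q ^ 6) •
        word [0, 0, 0, 1, 1, 0] +
      (q ^ 2 + 2 + q⁻¹ ^ 2) • word [0, 0, 1, 0, 0, 1] +
      (q⁻¹ ^ 3 + 2 * q⁻¹ + 2 * q + q ^ 3) • word [0, 0, 1, 0, 1, 0] := by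
  have hq := q_ne_zero
  obtain ⟨i00, i01, i10, i11⟩ := ip_vals
  rw [dual001010]
  simp [Phi_dual00101, Phi_dual001001, Phi_mul, Phi_e, shuffle_word_cons, shuffle_nil_left,
    shuffle_nil_right, consL_word, i00, i01, i10, i11]
  match_scalars <;> field_simp <;> ring

/-- The dual canonical basis vector `𝐛(1, 0, 1, 0, 1, 0)`. -/
def dual010010 : Un :=
  e 0 * dual01001 - q • dual010001

lemma Phi_dual010010 : Phi dual010010 =
      (q + q⁻¹) • word [0, 1, 0, 0, 1, 0] := by
  have hq := q_ne_zero
  obtain ⟨i00, i01, i10, i11⟩ := ip_vals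
  rw [dual010010]
  simp [Phi_dual01001, Phi_dual010001, Phi_mul, Phi_e, shuffle_word_cons, shuffle_nil_left,
    shuffle_nil_right, consL_word, i00, i01, i10, i11]
  match_scalars <;> field_simp <;> ring

/-- The dual canonical basis vector `𝐛(1, 1, 0, 0, 0, 1)`. -/
def dual100001 : Un :=
  e 0 * dual10001

lemma Phi_dual100001 : Phi dual100001 =
      (q⁻¹ ^ 3 + 2 * q⁻¹ + 2 * q + q ^ 3) • word [0, 1, 0, 0, 0, 1] +
      (q⁻¹ ^ 6 + 3 * q⁻¹ ^ 4 + 5 * q⁻¹ ^ 2 + 6 + 5 * q ^ 2 + 3 * q ^ 4 + q ^ 6) •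
        word [1, 0, 0, 0, 0, 1] +
      (q⁻¹ ^ 3 + 2 * q⁻¹ + 2 * q + q ^ 3) • word [1, 0, 0, 0, 1, 0] := by
  have hq := q_ne_zero
  obtain ⟨i00, i01, i10, i11⟩ := ip_vals
  rw [dual100001]
  simp [Phi_dual10001, Phi_mul, Phi_e, shuffle_word_cons, shuffle_nil_left, shuffle_nil_right,
    consL_word, i00, i01, i10, i11]
  match_scalars <;> field_simp <;> ring

/-- The dual canonical basis vector `𝐛(2, 0, 0, 0, 2, 0)`. -/
def dual010100 : Un :=
  q • (dual010 * dual010) - dual010010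

lemma Phi_dual010100 : Phi dual010100 =
      (q + q⁻¹) • word [0, 1, 0, 0, 1, 0] +
      (q ^ 5 + 2 * q ^ 3 + q + q⁻¹ + 2 * q⁻¹ ^ 3 + q⁻¹ ^ 5) • word [0, 0, 1, 1, 0, 0] +
      (q ^ 2 + 2 + q⁻¹ ^ 2) • word [0, 1, 0, 1, 0, 0] +
      (q ^ 2 + 2 + q⁻¹ ^ 2) • word [0, 0, 1, 0, 1, 0] := by
  have hq := q_ne_zero
  obtain ⟨i00, i01, i10, i11⟩ := ip_vals
  rw [dual010100]
  simp [Phi_dual010, Phi_dual010010, Phi_mul, Phi_e, shuffle_word_cons, shuffle_nil_left,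
    shuffle_nil_right, consL_word, i00, i01, i10, i11]
  match_scalars <;> field_simp <;> ring

/-- The dual canonical basis vector `𝐛(2, 0, 1, 0, 0, 1)`. -/
def dual100010 : Un :=
  q • (e 0 * dual10010 - dual010010)

lemma Phi_dual100010 : Phi dual100010 =
      (q⁻¹ ^ 3 + 2 * q⁻¹ + 2 * q + q ^ 3) • word [1, 0, 0, 0, 1, 0] +
      (q ^ 2 + 2 + q⁻¹ ^ 2) • word [1, 0, 0, 1, 0, 0] := by
  have hq := q_ne_zero
  obtain ⟨i00, i01, i10, i11⟩ := ip_vals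
  rw [dual100010]
  simp [Phi_dual10010, Phi_dual010010, Phi_mul, Phi_e, shuffle_word_cons, shuffle_nil_left,
    shuffle_nil_right, consL_word, i00, i01, i10, i11]
  match_scalars <;> field_simp <;> ring

/-- The dual canonical basis vector `𝐛(4, 0, 0, 0, 0, 2)`. -/
def dual101000 : Un :=
  (q ^ 3 - q⁻¹ ^ 3)⁻¹ • (dual11000 * e 0 - e 0 * dual11000)

lemma Phi_dual101000 : Phi dual101000 =
      (q⁻¹ ^ 3 + 3 * q⁻¹ + 3 * q + q ^ 3) • word [1, 0, 0, 1, 0, 0] +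
      (q⁻¹ ^ 6 + 3 * q⁻¹ ^ 4 + 5 * q⁻¹ ^ 2 + 6 + 5 * q ^ 2 + 3 * q ^ 4 + q ^ 6) •
        word [1, 0, 1, 0, 0, 0] +
      (q⁻¹ ^ 9 + 3 * q⁻¹ ^ 7 + 5 * q⁻¹ ^ 5 + 7 * q⁻¹ ^ 3 + 8 * q⁻¹ + 8 * q + 7 * q ^ 3 + 5 * q ^ 5 +
        3 * q ^ 7 + q ^ 9) • word [1, 1, 0, 0, 0, 0] := by
  have hq := q_ne_zero
  obtain ⟨i00, i01, i10, i11⟩ := ip_vals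
  rw [dual101000, map_smul, inv_smul_eq_iff₀ (q_pow_sub_inv_pow_ne_zero (n := 3) (by norm_num))]
  simp [Phi_dual11000, Phi_mul, Phi_e, shuffle_word_cons, shuffle_nil_left, shuffle_nil_right,
    consL_word, i00, i01, i10, i11]
  match_scalars <;> field_simp <;> ring

/-- The dual canonical basis vector `𝐛(3, 0, 0, 0, 1, 1)`. -/
def dual100100 : Un :=
  e 0 * dual11000 - q⁻¹ ^ 3 • dual101000

lemma Phi_dual100100 : Phi dual100100 =
      (q⁻¹ ^ 3 + 2 * q⁻¹ + 2 * q + q ^ 3) • word [0, 1, 0, 1, 0, 0] +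
      (q⁻¹ ^ 6 + 2 * q⁻¹ ^ 4 + 2 * q⁻¹ ^ 2 + 2 + 2 * q ^ 2 + 2 * q ^ 4 + q ^ 6) •
        word [0, 1, 1, 0, 0, 0] +
      (q ^ 2 + 2 + q⁻¹ ^ 2) • word [1, 0, 0, 1, 0, 0] +
      (q⁻¹ ^ 3 + 2 * q⁻¹ + 2 * q + q ^ 3) • word [1, 0, 1, 0, 0, 0] := by
  have hq := q_ne_zero
  obtain ⟨i00, i01, i10, i11⟩ := ip_vals
  rw [dual100100]
  simp [Phi_dual11000, Phi_dual101000, Phi_mul, Phi_e, shuffle_word_cons, shuffle_nil_left,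
    shuffle_nil_right, consL_word, i00, i01, i10, i11]
  match_scalars <;> field_simp <;> ring

/-- The vectors with prescribed shuffle realization are weight vectors. -/
lemma dual_mem_weightSpace :
    (dual001 ∈ weightSpace ![2, 1] ∧ dual010 ∈ weightSpace ![2, 1] ∧
      dual100 ∈ weightSpace ![2, 1]) ∧
    dual001001 ∈ weightSpace ![4, 2] ∧
      dual010001 ∈ weightSpace ![4, 2] ∧
      dual001010 ∈ weightSpace ![4, 2] ∧
      dual010010 ∈ weightSpace ![4, 2] ∧
      dual100001 ∈ weightSpace ![4, 2] ∧
      dual010100 ∈ weightSpace ![4, 2] ∧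
      dual100010 ∈ weightSpace ![4, 2] ∧
      dual100100 ∈ weightSpace ![4, 2] ∧
      dual101000 ∈ weightSpace ![4, 2] := by
  have mul : ∀ {a b c d a' b' : ℕ} {x y : Un}, x ∈ weightSpace ![a, b] → y ∈ weightSpace ![c, d] →
      a + c = a' → b + d = b' → x * y ∈ weightSpace ![a', b'] := by
    rintro a b c d _ _ x y hx hy rfl rfl
    convert mul_mem_weightSpace hx hy using 2
    simp
  have smul : ∀ {ν} {c : K} {x : Un}, x ∈ weightSpace ν → c • x ∈ weightSpace ν :=
    fun hx => Submodule.smul_mem _ _ hx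
  have sub : ∀ {ν} {x y : Un}, x ∈ weightSpace ν → y ∈ weightSpace ν → x - y ∈ weightSpace ν :=
    fun hx hy => Submodule.sub_mem _ hx hy
  have he0 : e 0 ∈ weightSpace ![1, 0] := by
    convert e_mem_weightSpace 0 using 2; decide
  have he1 : e 1 ∈ weightSpace ![0, 1] := by
    convert e_mem_weightSpace 1 using 2; decide
  have h01 : dual01 ∈ weightSpace ![1, 1] :=
    smul (sub (mul he1 he0 rfl rfl) (smul (mul he0 he1 rfl rfl)))
  have h10 : dual10 ∈ weightSpace ![1, 1] := sub (mul he0 he1 rfl rfl) (smul h01)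
  have h001 : dual001 ∈ weightSpace ![2, 1] :=
    smul (sub (mul he0 h01 rfl rfl) (smul (mul h01 he0 rfl rfl)))
  have h010 : dual010 ∈ weightSpace ![2, 1] := sub (mul he0 h01 rfl rfl) (smul h001)
  have h100 : dual100 ∈ weightSpace ![2, 1] := sub (smul (mul he0 h10 rfl rfl)) (smul h010)
  have h1001 : dual1001 ∈ weightSpace ![2, 2] :=
    smul (sub (mul h100 he1 rfl rfl) (smul (mul he1 h100 rfl rfl)))
  have h01001 : dual01001 ∈ weightSpace ![3, 2] :=
    smul (sub (mul h010 h01 rfl rfl) (smul (mul h01 h010 rfl rfl)))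
  have h10010 : dual10010 ∈ weightSpace ![3, 2] :=
    smul (sub (mul h10 h010 rfl rfl) (smul (mul h010 h10 rfl rfl)))
  have h00101 : dual00101 ∈ weightSpace ![3, 2] := sub (smul (mul h001 h01 rfl rfl)) (smul h01001)
  have h10001 : dual10001 ∈ weightSpace ![3, 2] :=
    sub (sub (smul (mul he0 h1001 rfl rfl)) (smul h01001)) (smul h10010)
  have h11000 : dual11000 ∈ weightSpace ![3, 2] := sub (smul (mul h10 h100 rfl rfl)) (smul h10010)
  have h001001 : dual001001 ∈ weightSpace ![4, 2] :=
    smul (sub (mul he0 h00101 rfl rfl) (mul h00101 he0 rfl rfl))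
  have h010001 : dual010001 ∈ weightSpace ![4, 2] :=
    smul (sub (mul he0 h01001 rfl rfl) (mul h01001 he0 rfl rfl))
  have h001010 : dual001010 ∈ weightSpace ![4, 2] := sub (mul he0 h00101 rfl rfl) (smul h001001)
  have h010010 : dual010010 ∈ weightSpace ![4, 2] := sub (mul he0 h01001 rfl rfl) (smul h010001)
  have h100001 : dual100001 ∈ weightSpace ![4, 2] := mul he0 h10001 rfl rfl
  have h010100 : dual010100 ∈ weightSpace ![4, 2] := sub (smul (mul h010 h010 rfl rfl)) h010010
  have h100010 : dual100010 ∈ weightSpace ![4, 2] := smul (sub (mul he0 h10010 rfl rfl) h010010)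
  have h101000 : dual101000 ∈ weightSpace ![4, 2] :=
    smul (sub (mul h11000 he0 rfl rfl) (mul he0 h11000 rfl rfl))
  have h100100 : dual100100 ∈ weightSpace ![4, 2] := sub (mul he0 h11000 rfl rfl) (smul h101000)
  exact ⟨⟨h001, h010, h100⟩, h001001, h010001, h001010, h010010, h100001, h010100, h100010,
    h100100, h101000⟩

/-! ### Expansion of bar-invariant vectors in the PBW basis -/

lemma pbwFact_six (m : Fin 6 → ℕ) : pbwFact m = qFact 0 (m 0) * qFact 1 (m 1) * qFact 0 (m 2) *
    qFact 1 (m 3) * qFact 0 (m 4) * qFact 1 (m 5) := by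
  rw [pbwFact, Fin.prod_univ_six]
  rfl

lemma qFact_vals : qFact 0 0 = 1 ∧ qFact 0 1 = 1 ∧ qFact 0 2 = (q ^ 2 + 1) / q ∧
    qFact 0 3 = (q ^ 2 + 1) / q * ((q ^ 4 + q ^ 2 + 1) / q ^ 2) ∧
    qFact 0 4 = (q ^ 2 + 1) / q * ((q ^ 4 + q ^ 2 + 1) / q ^ 2) *
      ((q ^ 2 + 1) * (q ^ 4 + 1) / q ^ 3) ∧
    qFact 1 0 = 1 ∧ qFact 1 1 = 1 ∧ qFact 1 2 = (q ^ 6 + 1) / q ^ 3 := by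
  obtain ⟨v1, v2, v3, v4, w1, w2⟩ := qInt_vals
  simp only [qFact, Finset.prod_range_succ, Finset.prod_range_zero, zero_add, Nat.reduceAdd, v1, v2,
    v3, v4, w1, w2, one_mul, and_self]

section Words

variable {A : Type*} [Ring A] [Algebra K A]

lemma ordMon_six (E : ℕ → A) (m : Fin 6 → ℕ) : ordMon E (extExp m) 6 =
    E 0 ^ m 0 * (E 1 ^ m 1 * (E 2 ^ m 2 * (E 3 ^ m 3 * (E 4 ^ m 4 * E 5 ^ m 5)))) := by
  obtain ⟨m0, m1, m2, m3, m4, m5⟩ := extExp_vals m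
  simp only [ordMon, one_mul, mul_assoc, m0, m1, m2, m3, m4, m5]

/-- The analogue of `triVec` for an arbitrary sequence `E` in place of the root vectors. -/
def triComb (E : ℕ → A) {n : ℕ} (p : Fin n → Fin 6 → ℕ) (P : Fin n → Fin n → Polynomial ℤ)
    (i : Fin n) : A :=
  (pbwFact (p i))⁻¹ • ordMon E (extExp (p i)) 6 +
    ∑ j ∈ Finset.Ioi i, (q * zPoly (P i j)) • (pbwFact (p j))⁻¹ • ordMon E (extExp (p j)) 6

/-- A linear combination of words in `x`. -/
def wordComb (x : Fin 2 → A) (L : List (K × List (Fin 2))) : A :=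
  (L.map fun t => t.1 • (t.2.map x).prod).sum

lemma triVec_eq_triComb {n : ℕ} (p : Fin n → Fin 6 → ℕ) (P : Fin n → Fin n → Polynomial ℤ)
    (i : Fin n) : triVec p P i = triComb rootSeq p P i := by
  simp only [triVec, triComb, pbw_eq]

/-- The labels of the PBW vectors of weight `2α₁ + α₂`. -/
def label21 : Fin 3 → Fin 6 → ℕ := ![![0, 0, 1, 0, 0, 0], ![1, 0, 0, 0, 1, 0], ![2, 0, 0, 0, 0, 1]]

open Polynomial in
/-- The coefficients above the diagonal, divided by `q`, of the canonical basis of weight `2α₁ + α₂`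
in the PBW basis. -/
def coeff21 : Fin 3 → Fin 3 → ℤ[X] :=
  ![![0, X, X ^ 5],
    ![0, 0, X + X ^ 3],
    ![0, 0, 0]]

/-- The canonical basis of weight `2α₁ + α₂` in terms of words in the generators. -/
def canonWords21 : Fin 3 → List (K × List (Fin 2)) :=
  ![[((qFact 0 2)⁻¹, [1, 0, 0])], [(1, [0, 1, 0])], [((qFact 0 2)⁻¹, [0, 0, 1])]]

/-- The labels of the PBW vectors of weight `4α₁ + 2α₂`. -/
def label42 : Fin 9 → Fin 6 → ℕ :=
  ![![0, 0, 2, 0, 0, 0], ![0, 1, 0, 0, 1, 0], ![1, 0, 0, 1, 0, 0], ![1, 0, 1, 0, 1, 0],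
    ![1, 1, 0, 0, 0, 1], ![2, 0, 0, 0, 2, 0], ![2, 0, 1, 0, 0, 1], ![3, 0, 0, 0, 1, 1],
    ![4, 0, 0, 0, 0, 2]]

open Polynomial in
/-- The coefficients above the diagonal, divided by `q`, of the canonical basis of weight `4α₁ +
2α₂` in the PBW basis. -/
def coeff42 : Fin 9 → Fin 9 → ℤ[X] :=
  ![![0, X ^ 2, X ^ 2, X ^ 3, X ^ 8, X ^ 7, X ^ 10, X ^ 14, X ^ 23],
    ![0, 0, 0, 1, X + X ^ 3 + X ^ 5, X ^ 2 + X ^ 4, X ^ 3 + X ^ 5 + X ^ 7,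
      X ^ 5 + X ^ 7 + X ^ 9 + X ^ 11, X ^ 10 + X ^ 12 + X ^ 14 + X ^ 16 + X ^ 18 + X ^ 20],
    ![0, 0, 0, 1, X ^ 5, X ^ 2 + X ^ 4, X ^ 5 + X ^ 7, X ^ 7 + X ^ 9 + X ^ 11,
      X ^ 14 + X ^ 16 + X ^ 18 + X ^ 20],
    ![0, 0, 0, 0, 1 + X ^ 2 + X ^ 4, 2 * X + X ^ 3, 1 + X ^ 2 + 2 * X ^ 4 + X ^ 6,
      1 + X ^ 2 + 2 * X ^ 4 + 2 * X ^ 6 + 2 * X ^ 8 + X ^ 10,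
      X ^ 3 + 2 * X ^ 5 + 2 * X ^ 7 + 3 * X ^ 9 + 2 * X ^ 11 + 3 * X ^ 13 + 2 * X ^ 15 +
        2 * X ^ 17 + X ^ 19],
    ![0, 0, 0, 0, 0, 0, X, X ^ 5, X ^ 8 + X ^ 14],
    ![0, 0, 0, 0, 0, 0, X ^ 2, X ^ 2 + X ^ 4 + X ^ 6, X ^ 7 + X ^ 9 + 2 * X ^ 11 + X ^ 13 + X ^ 15],
    ![0, 0, 0, 0, 0, 0, 0, X + X ^ 3, X ^ 2 + X ^ 4 + X ^ 6 + X ^ 8 + X ^ 10 + X ^ 12],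
    ![0, 0, 0, 0, 0, 0, 0, 0, X ^ 2 + X ^ 4 + X ^ 6 + X ^ 8],
    ![0, 0, 0, 0, 0, 0, 0, 0, 0]]

/-- The canonical basis of weight `4α₁ + 2α₂` in terms of words in the generators: monomials in the
divided powers, corrected where the PBW expansion of the monomial has more than one coefficient
outside `qℤ[q]`. -/
def canonWords42 : Fin 9 → List (K × List (Fin 2)) :=
  ![[((qFact 1 2 * qFact 0 4)⁻¹, [1, 1, 0, 0, 0, 0])],
    [((qFact 0 3)⁻¹, [1, 0, 0, 0, 1, 0]), (-(qFact 0 4)⁻¹, [1, 0, 0, 0, 0, 1])],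
    [((qFact 1 2 * qFact 0 3)⁻¹, [0, 1, 1, 0, 0, 0])],
    [((qFact 0 2)⁻¹, [0, 1, 0, 0, 1, 0]),
      (-(qFact 0 2 * qFact 1 2 * qFact 0 2)⁻¹, [0, 0, 1, 1, 0, 0])],
    [((qFact 0 4)⁻¹, [1, 0, 0, 0, 0, 1])],
    [((qFact 0 2 * qFact 1 2 * qFact 0 2)⁻¹, [0, 0, 1, 1, 0, 0])],
    [((qFact 0 3)⁻¹, [0, 1, 0, 0, 0, 1]), (-(qFact 0 4)⁻¹, [1, 0, 0, 0, 0, 1])],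
    [((qFact 0 3 * qFact 1 2)⁻¹, [0, 0, 0, 1, 1, 0])],
    [((qFact 0 4 * qFact 1 2)⁻¹, [0, 0, 0, 0, 1, 1])]]

lemma triComb21_eq_wordComb {E : ℕ → A}
    (h : IsRootFamily (E 0) (E 5) (E 4) (E 2) (E 1) (E 3)) (i : Fin 3) :
    triComb E label21 coeff21 i = wordComb ![E 0, E 5] (canonWords21 i) := by
  have hq := q_ne_zero
  obtain ⟨-, h2, h3, h4, -, h6⟩ := qPoly_ne_zero
  have h3' : q ^ 2 * (q ^ 2 + 1) + 1 ≠ 0 := fun h => h3 (by linear_combination h)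
  obtain ⟨v1, v2, v3, v4, v5, w0, w1, w2⟩ := qFact_vals
  obtain ⟨s0, s1, s2⟩ :
      Finset.Ioi (0 : Fin 3) = {1, 2} ∧ Finset.Ioi (1 : Fin 3) = {2} ∧ Finset.Ioi (2 : Fin 3) =
      ∅ := by
    decide
  obtain rfl | rfl | rfl : i = 0 ∨ i = 1 ∨ i = 2 := by
    revert i; decide
  all_goals simp (discharger := decide) only [triComb, s0, s1, s2,
    Finset.sum_insert, Finset.sum_singleton, Finset.sum_empty, wordComb, canonWords21, label21,
      coeff21,
    Matrix.cons_val, Matrix.cons_val_zero, Matrix.cons_val_one, List.map_cons, List.map_nil,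
    List.sum_cons, List.sum_nil, List.prod_cons, List.prod_nil, ordMon_six, pbwFact_six, v1, v2, v3,
    v4, v5, w0, w1, w2, map_add, map_mul, map_pow, map_zero, map_one, map_ofNat, zPoly_X, pow_succ',
    pow_zero, mul_one, one_mul, mul_zero, zero_smul, one_smul, add_zero]
  -- Bring all words to normal order, with `E 0` on the left and `E 5` on the right.
  all_goals simp only [mul_add, add_mul, smul_mul_assoc, mul_smul_comm, mul_assoc, h.ba, h.bx₁,
    h.bx₂, h.bx₃, h.x₁a, h.x₂a, h.x₃a, h.x₁x₂, h.x₃₂a_x₁x₃.1, h.x₃₂a_x₁x₃.2, mul_mul_of_mul_eq h.ba,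
    mul_mul_of_mul_eq h.bx₁, mul_mul_of_mul_eq h.bx₂, mul_mul_of_mul_eq h.bx₃,
    mul_mul_of_mul_eq h.x₁a, mul_mul_of_mul_eq h.x₂a, mul_mul_of_mul_eq h.x₃a,
    mul_mul_of_mul_eq h.x₁x₂, mul_mul_of_mul_eq h.x₃₂a_x₁x₃.1, mul_mul_of_mul_eq h.x₃₂a_x₁x₃.2]
  all_goals match_scalars <;> field_simp <;> ring

set_option maxHeartbeats 4000000 in
/-- The straightening relations express the words in PBW monomials. -/
lemma triComb42_eq_wordComb {E : ℕ → A}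
    (h : IsRootFamily (E 0) (E 5) (E 4) (E 2) (E 1) (E 3)) (i : Fin 9) :
    triComb E label42 coeff42 i = wordComb ![E 0, E 5] (canonWords42 i) := by
  have hq := q_ne_zero
  obtain ⟨-, h2, h3, h4, -, h6⟩ := qPoly_ne_zero
  have h3' : q ^ 2 * (q ^ 2 + 1) + 1 ≠ 0 := fun h => h3 (by linear_combination h)
  obtain ⟨v1, v2, v3, v4, v5, w0, w1, w2⟩ := qFact_vals
  obtain ⟨s0, s1, s2, s3, s4, s5, s6, s7, s8⟩ :
      Finset.Ioi (0 : Fin 9) = {1, 2, 3, 4, 5, 6, 7, 8} ∧ Finset.Ioi (1 : Fin 9) = {2, 3, 4, 5,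
      6, 7, 8} ∧ Finset.Ioi (2 : Fin 9) = {3, 4, 5, 6, 7, 8} ∧ Finset.Ioi (3 : Fin 9) = {4, 5,
      6, 7, 8} ∧ Finset.Ioi (4 : Fin 9) = {5, 6, 7, 8} ∧ Finset.Ioi (5 : Fin 9) = {6, 7, 8} ∧
      Finset.Ioi (6 : Fin 9) = {7, 8} ∧ Finset.Ioi (7 : Fin 9) = {8} ∧ Finset.Ioi (8 : Fin 9) =
      ∅ := by
    decide
  obtain rfl | rfl | rfl | rfl | rfl | rfl | rfl | rfl | rfl : i = 0 ∨ i = 1 ∨ i = 2 ∨ i = 3 ∨ i = 4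
    ∨ i = 5 ∨ i = 6 ∨ i = 7 ∨ i = 8 := by
    revert i; decide
  all_goals simp (discharger := decide) only [triComb, s0, s1, s2, s3, s4, s5, s6, s7, s8,
    Finset.sum_insert, Finset.sum_singleton, Finset.sum_empty, wordComb, canonWords42, label42,
      coeff42,
    Matrix.cons_val, Matrix.cons_val_zero, Matrix.cons_val_one, List.map_cons, List.map_nil,
    List.sum_cons, List.sum_nil, List.prod_cons, List.prod_nil, ordMon_six, pbwFact_six, v1, v2, v3,
    v4, v5, w0, w1, w2, map_add, map_mul, map_pow, map_zero, map_one, map_ofNat, zPoly_X, pow_succ',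
    pow_zero, mul_one, one_mul, mul_zero, zero_smul, one_smul, add_zero]
  -- Bring all words to normal order, with `E 0` on the left and `E 5` on the right.
  all_goals simp only [mul_add, add_mul, smul_mul_assoc, mul_smul_comm, mul_assoc, h.ba, h.bx₁,
    h.bx₂, h.bx₃, h.x₁a, h.x₂a, h.x₃a, h.x₁x₂, h.x₃₂a_x₁x₃.1, h.x₃₂a_x₁x₃.2, mul_mul_of_mul_eq h.ba,
    mul_mul_of_mul_eq h.bx₁, mul_mul_of_mul_eq h.bx₂, mul_mul_of_mul_eq h.bx₃,
    mul_mul_of_mul_eq h.x₁a, mul_mul_of_mul_eq h.x₂a, mul_mul_of_mul_eq h.x₃a,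
    mul_mul_of_mul_eq h.x₁x₂, mul_mul_of_mul_eq h.x₃₂a_x₁x₃.1, mul_mul_of_mul_eq h.x₃₂a_x₁x₃.2]
  all_goals match_scalars <;> field_simp <;> ring

end Words

/-! ### The dual bases in weights `2α₁ + α₂` and `4α₁ + 2α₂` -/

lemma pbwWt_eq_iff (m : Fin 6 → ℕ) (a b : ℕ) : pbwWt m = ![a, b] ↔
    m 0 + 3 * m 1 + 2 * m 2 + 3 * m 3 + m 4 = a ∧ m 1 + m 2 + 2 * m 3 + m 4 + m 5 = b := by
  obtain ⟨m0, m1, m2, m3, m4, m5⟩ := extExp_vals m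
  simp only [pbwWt, Finset.sum_range_succ, Finset.sum_range_zero, m0, m1, m2, m3, m4, m5, rootWt,
    funext_iff, Fin.forall_fin_two, Pi.add_apply, Pi.smul_apply, Matrix.cons_val_zero,
    Matrix.cons_val_one, Pi.zero_apply, smul_eq_mul]
  omega

lemma exists_label_iff {n : ℕ} (p : Fin n → Fin 6 → ℕ) (m : Fin 6 → ℕ) : (∃ i, p i = m) ↔
    ∃ i, p i 0 = m 0 ∧ p i 1 = m 1 ∧ p i 2 = m 2 ∧ p i 3 = m 3 ∧ p i 4 = m 4 ∧ p i 5 = m 5 := by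
  simp only [funext_iff, Fin.forall_fin_succ, Fin.isEmpty, IsEmpty.forall_iff, and_true]
  rfl

lemma label21_iff (m : Fin 6 → ℕ) : pbwWt m = ![2, 1] ↔ ∃ i, label21 i = m := by
  rw [pbwWt_eq_iff, exists_label_iff]
  simp only [Fin.exists_fin_succ, IsEmpty.exists_iff, or_false, label21]
  simp
  omega

lemma label42_iff (m : Fin 6 → ℕ) : pbwWt m = ![4, 2] ↔ ∃ i, label42 i = m := by
  constructor
  · rw [pbwWt_eq_iff, exists_label_iff]
    rintro ⟨h0, h1⟩
    have b0 : m 0 ≤ 4 := by omega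
    have b1 : m 1 ≤ 1 := by omega
    have b2 : m 2 ≤ 2 := by omega
    have b3 : m 3 ≤ 1 := by omega
    have b4 : m 4 ≤ 2 := by omega
    have b5 : m 5 ≤ 2 := by omega
    generalize m 0 = m0, m 1 = m1, m 2 = m2, m 3 = m3, m 4 = m4, m 5 = m5 at *
    interval_cases m1 <;> interval_cases m3 <;> interval_cases m2 <;> interval_cases m4 <;>
      first
      | omega
      | (interval_cases m0 <;> first | omega | (interval_cases m5 <;> first | omega | decide))
  · rintro ⟨i, rfl⟩
    rw [pbwWt_eq_iff]
    revert i
    decide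

lemma bar_wordComb {L : List (K × List (Fin 2))} (hL : ∀ t ∈ L, barK t.1 = t.1) :
    bar (wordComb e L) = wordComb e L := by
  rw [wordComb, map_list_sum, List.map_map]
  congr 1
  refine List.map_congr_left fun t ht => ?_
  rw [Function.comp_apply, bar_smul, hL t ht, map_list_prod, List.map_map]
  congr 3
  ext1 i
  exact bar_e i

lemma form_wordComb (x : Un) (L : List (K × List (Fin 2))) :
    form x (wordComb e L) = (L.map fun t => t.1 * Phi x t.2.reverse).sum := by
  rw [wordComb, map_list_sum, List.map_map]
  congr 2
  ext1 t
  rw [Function.comp_apply, map_smul, smul_eq_mul, form_symm]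
  congr 1
  exact form_wordProd _ _

lemma triVec21 (i : Fin 3) : triVec label21 coeff21 i = wordComb e (canonWords21 i) := by
  rw [triVec_eq_triComb, triComb21_eq_wordComb isRootFamily_rootSeq]
  congr 1
  ext1 j
  fin_cases j <;> rfl

lemma triVec42 (i : Fin 9) : triVec label42 coeff42 i = wordComb e (canonWords42 i) := by
  rw [triVec_eq_triComb, triComb42_eq_wordComb isRootFamily_rootSeq]
  congr 1
  ext1 j
  fin_cases j <;> rfl

/-- The dual canonical basis in weight `2α₁ + α₂`. -/
def dualVec21 : Fin 3 → Un := ![dual001, dual010, dual100]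

/-- The dual canonical basis in weight `4α₁ + 2α₂`. -/
def dualVec42 : Fin 9 → Un := ![dual001001, dual010001, dual001010, dual010010, dual100001,
    dual010100,
  dual100010, dual100100, dual101000]

lemma isDualPair21 : IsDualPair ![2, 1] label21 coeff21 dualVec21 where
  inj := by decide
  wt_iff := label21_iff
  bar_triVec i := by
    rw [triVec21]
    refine bar_wordComb ?_
    fin_cases i <;> simp [canonWords21, barK_qFact]
  mem i := by
    obtain ⟨⟨h0, h1, h2⟩, -⟩ := dual_mem_weightSpace
    fin_cases i <;> assumption
  form_eq i j := by
    have hq := q_ne_zero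
    obtain ⟨-, h2, h3, h4, -, h6⟩ := qPoly_ne_zero
    have h3' : q ^ 2 * (q ^ 2 + 1) + 1 ≠ 0 := fun h => h3 (by linear_combination h)
    obtain ⟨v1, v2, v3, v4, v5, w0, w1, w2⟩ := qFact_vals
    rw [triVec21, form_wordComb]
    fin_cases i <;> fin_cases j <;>
      simp [dualVec21, canonWords21, Phi_dual001, Phi_dual010, Phi_dual100, word,
        Finsupp.single_apply, v1, v2, v3, v4, v5, w0, w1, w2] <;> field_simp

set_option maxHeartbeats 2000000 in
lemma isDualPair42 : IsDualPair ![4, 2] label42 coeff42 dualVec42 where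
  inj := by decide
  wt_iff := label42_iff
  bar_triVec i := by
    rw [triVec42]
    refine bar_wordComb ?_
    fin_cases i <;> simp [canonWords42, barK_qFact]
  mem i := by
    obtain ⟨-, h0, h1, h2, h3, h4, h5, h6, h7, h8⟩ := dual_mem_weightSpace
    fin_cases i <;> assumption
  form_eq i j := by
    have hq := q_ne_zero
    obtain ⟨-, h2, h3, h4, -, h6⟩ := qPoly_ne_zero
    have h3' : q ^ 2 * (q ^ 2 + 1) + 1 ≠ 0 := fun h => h3 (by linear_combination h)
    obtain ⟨v1, v2, v3, v4, v5, w0, w1, w2⟩ := qFact_vals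
    rw [triVec42, form_wordComb]
    fin_cases i <;> fin_cases j <;>
      simp [dualVec42, canonWords42, Phi_dual001001, Phi_dual010001, Phi_dual001010, Phi_dual010010,
        Phi_dual100001, Phi_dual010100, Phi_dual100010, Phi_dual100100, Phi_dual101000, word,
        Finsupp.single_apply, v1, v2, v3, v4, v5, w0, w1, w2]
    all_goals field_simp
    all_goals ring

/-! ### The imaginary vector -/

lemma dual010_mul_self : dual010 * dual010 = q⁻¹ • (dual010100 + dual010010) := by
  rw [dual010100, sub_add_cancel, smul_smul, inv_mul_cancel₀ q_ne_zero, one_smul]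

/-- The square of `dual010` pairs nontrivially with two canonical basis vectors. -/
lemma dual010_mul_self_notMem : dual010 * dual010 ∉ qPowersDual rootVec := by
  have hq := inv_ne_zero q_ne_zero
  refine isDualPair42.notMem_qPowersDual (i := 3) (j := 5) (by decide) ?_ ?_
  all_goals
    rw [dual010_mul_self, map_smul, map_add, LinearMap.smul_apply, LinearMap.add_apply]
  · have h1 := isDualPair42.form_eq 3 3
    have h2 := isDualPair42.form_eq 5 3
    change form dual010010 _ = _ at h1
    change form dual010100 _ = _ at h2
    rw [h1, h2]
    simpa using hq
  · have h1 := isDualPair42.form_eq 3 5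
    have h2 := isDualPair42.form_eq 5 5
    change form dual010010 _ = _ at h1
    change form dual010100 _ = _ at h2
    rw [h1, h2]
    simpa using hq

end QGroupG2

end

theorem mainTheorem1 :
    ∃ E : Fin 6 → Un, IsRootVectors E ∧ ∃ b b₂ z : Un,
      (∀ y, IsDualCanonical E ![1, 0, 0, 0, 1, 0] y ↔ y = b) ∧
      (∀ y, IsDualCanonical E (2 • ![1, 0, 0, 0, 1, 0]) y ↔ y = b₂) ∧
      (∀ y, IsDualCanonical E ![1, 0, 1, 0, 1, 0] y ↔ y = z) ∧
      Phi b = word [0, 1, 0] ∧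
      Phi b₂ = (q + q⁻¹) • word [0, 1, 0, 0, 1, 0] +
        (q ^ 5 + 2 * q ^ 3 + q + q⁻¹ + 2 * q⁻¹ ^ 3 + q⁻¹ ^ 5) • word [0, 0, 1, 1, 0, 0] +
        (q ^ 2 + 2 + q⁻¹ ^ 2) • word [0, 1, 0, 1, 0, 0] +
        (q ^ 2 + 2 + q⁻¹ ^ 2) • word [0, 0, 1, 0, 1, 0] ∧
      Phi z = (q + q⁻¹) • word [0, 1, 0, 0, 1, 0] ∧
      b * b = q⁻¹ • (b₂ + z) ∧
      IsImaginary E b ∧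
      ¬ BZ E b b := by
  refine ⟨rootVec, isRootVectors_rootVec, dual010, dual010100, dual010010,
    fun y => isDualPair21.isDualCanonical_iff 1 y, fun y => ?_,
    fun y => isDualPair42.isDualCanonical_iff 3 y, Phi_dual010, Phi_dual010100, Phi_dual010010,
    dual010_mul_self, ⟨isDualPair21.mem_dualCanonicalBasis 1, dual010_mul_self_notMem⟩, ?_⟩
  · have h : 2 • ![1, 0, 0, 0, 1, 0] = label42 5 := by decide
    rw [h]
    exact isDualPair42.isDualCanonical_iff 5 y
  · intro h
    exact dual010_mul_self_notMem (h.mpr ⟨0, by rw [zpow_zero, one_smul]⟩)
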